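/- **Lemma 4.1.** Let $\mathfrak g$ be a finite-dimensional complex simple Lie algebra of type $D_n$ ($n\ge 4$) or $E_6$, $\mathfrak h$ a Cartan subalgebra, $\Omega$ the root system, $\Omega^+$ a system of positive roots and $\Pi$ the set of simple roots. Let $E_\alpha$ ($\alpha\in\Omega$) be root vectors with $(E_\alpha,E_{-\alpha})=1$ for the Killing form, and let $\theta$ be a Cartan automorphism of $\mathfrak g$, that is, a Lie algebra automorphism with $\theta|_{\mathfrak h}=-1$. For $\Gamma\subseteq\Pi$ let $\Omega_\Gamma$ be the set of roots in the span of $\Gamma$, let $\mathfrak g_\Gamma$ be the Levi subalgebra generated by $\mathfrak h$ and the $E_{\pm\alpha}$, $\alpha\in\Gamma$, and let $\mathfrak m=\bigoplus_{\alpha\in\Omega\setminus\Omega_\Gamma}\mathbb C E_\alpha$ be its invariant complement. Let $\pi:\wedge^\bullet\mathfrak g\to\wedge^\bullet\mathfrak m$ be induced by the projection of $\mathfrak g$ onto $\mathfrak m$ along $\mathfrak g_\Gamma$, and let $$[\![X_1\wedge X_2,Y_1\wedge Y_2]\!]=[X_1,Y_1]\wedge X_2\wedge Y_2-[X_1,Y_2]\wedge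 X_2\wedge Y_1-[X_2,Y_1]\wedge X_1\wedge Y_2+[X_2,Y_2]\wedge X_1\wedge Y_1$$ be the Schouten bracket. Put $r=\sum_{\alpha\in\Omega^+}E_\alpha\wedge E_{-\alpha}$, $\varphi=[\![r,r]\!]\in\wedge^3\mathfrak g$ and $\varphi_M=\pi(\varphi)\in\wedge^3\mathfrak m$. Suppose that $\Gamma$ defines a good orbit $M=G/G_\Gamma$, that is: for some $t\in\mathfrak h$ with $\alpha(t)=0$ for $\alpha\in\Gamma$ and $\alpha(t)\ne0$ for $\alpha\in\Omega\setminus\Omega_\Gamma$, there are $f\in(\wedge^2\mathfrak m)^{\mathfrak g_\Gamma}$ and $K\in\mathbb C\setminus\{0\}$ with $$\pi[\![f,f]\!]=K^2\varphi_M,\qquad \pi[\![f,v]\!]=0,\qquad\text{where } v=\sum_{\alpha\in\Omega^+\setminus\Omega_\Gamma}\frac1{\alpha(t)}\,E_\alpha\wedge E_{-\alpha}$$ is the Kirillov–Kostant–Souriau bivector of the orbit through $t$. Then the space of $\mathfrak g_\Gamma$- and $\theta$-invariant elements of $\wedge^3\mathfrak m$ is spanned by $\varphi_M$: $$(\wedge^3\mathfrak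 m)^{\mathfrak g_\Gamma,\theta}=\mathbb C\,\varphi_M .$$ If moreover $M$ is not a symmetric space (that is, $[\mathfrak m,\mathfrak m]\not\subseteq\mathfrak g_\Gamma$), this space is one-dimensional. -/

import Mathlib

open scoped ExteriorAlgebra

noncomputable section

namespace LieOrbit

/-! ### Multilinear algebra: extension of an operator, Schouten bracket -/

section Exterior

theorem update_vec₃_zero {V : Type*} (A X Y Z : V) : Function.update ![X, Y, Z] 0 A = ![A, Y, Z] := by
  funext i; fin_cases i <;> rfl

theorem update_vec₃_one {V : Type*} (A X Y Z : V) : Function.update ![X, Y, Z] 1 A = ![X, A, Z] := by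
  funext i; fin_cases i <;> rfl

theorem update_vec₃_two {V : Type*} (A X Y Z : V) : Function.update ![X, Y, Z] 2 A = ![X, Y, A] := by
  funext i; fin_cases i <;> rfl

variable {L : Type*} [LieRing L] [LieAlgebra ℂ L]

/-- The alternating map `(X₁, …, Xₙ) ↦ ∑ᵢ X₁ ∧ ⋯ ∧ f Xᵢ ∧ ⋯ ∧ Xₙ`. -/
def derivationAlt (n : ℕ) (f : L →ₗ[ℂ] L) : L [⋀^Fin n]→ₗ[ℂ] ⋀[ℂ]^n L :=
  { (∑ i : Fin n, (exteriorPower.ιMulti ℂ n (M := L)).toMultilinearMap.compLinearMap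
      (fun j => if j = i then f else LinearMap.id)) with
    map_eq_zero_of_eq' := by
      intro v i j hv hij
      have key : ∀ k : Fin n, (fun l => (if l = k then f else LinearMap.id) (v l)) =
          Function.update v k (f (v k)) := by
        intro k
        funext l
        by_cases h : l = k
        · subst h; simp
        · simp [h]
      have hz : ∀ k : Fin n, k ≠ i → k ≠ j →
          exteriorPower.ιMulti ℂ n (Function.update v k (f (v k))) = 0 := by
        intro k hki hkj
        refine AlternatingMap.map_eq_zero_of_eq _ _ (i := i) (j := j) ?_ hij
        rw [Function.update_of_ne hki.symm, Function.update_of_ne hkj.symm, hv]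
      have hs : Function.update v j (f (v j)) = Function.update v i (f (v i)) ∘ Equiv.swap i j := by
        funext l
        by_cases h1 : l = i
        · subst h1
          simp [Function.update_of_ne hij, Function.update_of_ne hij.symm, hv]
        · by_cases h2 : l = j
          · subst h2; simp [hv]
          · simp [Equiv.swap_apply_of_ne_of_ne h1 h2, Function.update_of_ne h1,
              Function.update_of_ne h2]
      simp only [MultilinearMap.toFun_eq_coe, sum_apply,
        MultilinearMap.compLinearMap_apply, AlternatingMap.coe_multilinearMap, key]
      rw [← Finset.sum_subset (Finset.subset_univ {i, j}) (fun k _ hk => by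
        simp only [Finset.mem_insert, Finset.mem_singleton, not_or] at hk
        exact hz k hk.1 hk.2), Finset.sum_pair hij, hs, AlternatingMap.map_swap _ _ hij,
        add_neg_cancel] }

theorem derivationAlt_apply (n : ℕ) (f : L →ₗ[ℂ] L) (v : Fin n → L) :
    derivationAlt n f v =
      ∑ i, exteriorPower.ιMulti ℂ n (Function.update v i (f (v i))) := by
  change (∑ i : Fin n, (exteriorPower.ιMulti ℂ n (M := L)).toMultilinearMap.compLinearMap
      (fun j => if j = i then f else LinearMap.id)) v = _
  rw [sum_apply]
  refine Finset.sum_congr rfl fun i _ => ?_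
  rw [MultilinearMap.compLinearMap_apply]
  change exteriorPower.ιMulti ℂ n _ = _
  congr 1
  funext l
  by_cases h : l = i
  · subst h; simp
  · simp [h]

/-- The adjoint action of `x ∈ L` on `⋀ⁿ L`:
`x · (X₁ ∧ ⋯ ∧ Xₙ) = ∑ᵢ X₁ ∧ ⋯ ∧ [x, Xᵢ] ∧ ⋯ ∧ Xₙ`. -/
def adExt (n : ℕ) (x : L) : ⋀[ℂ]^n L →ₗ[ℂ] ⋀[ℂ]^n L :=
  exteriorPower.alternatingMapLinearEquiv (derivationAlt n (LieAlgebra.ad ℂ L x))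

theorem adExt_ιMulti (n : ℕ) (x : L) (v : Fin n → L) :
    adExt n x (exteriorPower.ιMulti ℂ n v) =
      ∑ i, exteriorPower.ιMulti ℂ n (Function.update v i ⁅x, v i⁆) := by
  simp [adExt, derivationAlt_apply]

/-- `X ∧ Y` in `⋀² L`. -/
def wedge₂ (X Y : L) : ⋀[ℂ]^2 L := exteriorPower.ιMulti ℂ 2 ![X, Y]

/-- `X ∧ Y ∧ Z` in `⋀³ L`. -/
def wedge₃ (X Y Z : L) : ⋀[ℂ]^3 L := exteriorPower.ιMulti ℂ 3 ![X, Y, Z]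

theorem wedge₃_add_left (X Y Z X' : L) :
    wedge₃ (X + X') Y Z = wedge₃ X Y Z + wedge₃ X' Y Z := by
  have h := (exteriorPower.ιMulti ℂ 3 (M := L)).map_update_add ![X, Y, Z] 0 X X'
  rwa [update_vec₃_zero, update_vec₃_zero, update_vec₃_zero] at h

theorem wedge₃_smul_left (c : ℂ) (X Y Z : L) :
    wedge₃ (c • X) Y Z = c • wedge₃ X Y Z := by
  have h := (exteriorPower.ιMulti ℂ 3 (M := L)).map_update_smul ![X, Y, Z] 0 c X
  rwa [update_vec₃_zero, update_vec₃_zero] at h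

theorem wedge₃_add_mid (X Y Z Y' : L) :
    wedge₃ X (Y + Y') Z = wedge₃ X Y Z + wedge₃ X Y' Z := by
  have h := (exteriorPower.ιMulti ℂ 3 (M := L)).map_update_add ![X, Y, Z] 1 Y Y'
  rwa [update_vec₃_one, update_vec₃_one, update_vec₃_one] at h

theorem wedge₃_smul_mid (c : ℂ) (X Y Z : L) :
    wedge₃ X (c • Y) Z = c • wedge₃ X Y Z := by
  have h := (exteriorPower.ιMulti ℂ 3 (M := L)).map_update_smul ![X, Y, Z] 1 c Y
  rwa [update_vec₃_one, update_vec₃_one] at h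

theorem wedge₃_add_right (X Y Z Z' : L) :
    wedge₃ X Y (Z + Z') = wedge₃ X Y Z + wedge₃ X Y Z' := by
  have h := (exteriorPower.ιMulti ℂ 3 (M := L)).map_update_add ![X, Y, Z] 2 Z Z'
  rwa [update_vec₃_two, update_vec₃_two, update_vec₃_two] at h

theorem wedge₃_smul_right (c : ℂ) (X Y Z : L) :
    wedge₃ X Y (c • Z) = c • wedge₃ X Y Z := by
  have h := (exteriorPower.ιMulti ℂ 3 (M := L)).map_update_smul ![X, Y, Z] 2 c Z
  rwa [update_vec₃_two, update_vec₃_two] at h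

/-- For fixed `X₁, X₂`, the Schouten bracket with `X₁ ∧ X₂` as an alternating map of `Y₁, Y₂`. -/
def schoutenRight (X : Fin 2 → L) : L [⋀^Fin 2]→ₗ[ℂ] ⋀[ℂ]^3 L where
  toFun Y := wedge₃ ⁅X 0, Y 0⁆ (X 1) (Y 1) - wedge₃ ⁅X 0, Y 1⁆ (X 1) (Y 0)
    - wedge₃ ⁅X 1, Y 0⁆ (X 0) (Y 1) + wedge₃ ⁅X 1, Y 1⁆ (X 0) (Y 0)
  map_update_add' := by
    intro dec Y i a b
    rw [Subsingleton.elim dec (instDecidableEqFin 2)]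
    fin_cases i <;>
      simp [wedge₃_add_left, wedge₃_add_right] <;> abel
  map_update_smul' := by
    intro dec Y i c a
    rw [Subsingleton.elim dec (instDecidableEqFin 2)]
    fin_cases i <;>
      simp [wedge₃_smul_left, wedge₃_smul_right, smul_sub, smul_add]
  map_eq_zero_of_eq' := by
    intro Y i j h hij
    have h01 : Y 0 = Y 1 := by
      fin_cases i <;> fin_cases j <;> simp_all
    rw [h01]
    abel

/-- The Schouten bracket of two bivectors as an alternating map of the first argument. -/
def schoutenAlt : L [⋀^Fin 2]→ₗ[ℂ] (⋀[ℂ]^2 L →ₗ[ℂ] ⋀[ℂ]^3 L) where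
  toFun X := exteriorPower.alternatingMapLinearEquiv (schoutenRight X)
  map_update_add' := by
    intro dec X i a b
    rw [Subsingleton.elim dec (instDecidableEqFin 2), ← map_add]
    congr 1
    ext Y
    fin_cases i <;>
      simp [schoutenRight, wedge₃_add_left, wedge₃_add_mid] <;> abel
  map_update_smul' := by
    intro dec X i c a
    rw [Subsingleton.elim dec (instDecidableEqFin 2), ← map_smul]
    congr 1
    ext Y
    fin_cases i <;>
      simp [schoutenRight, wedge₃_smul_left, wedge₃_smul_mid, smul_sub, smul_add]
  map_eq_zero_of_eq' := by
    intro X i j h hij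
    have h01 : X 0 = X 1 := by
      fin_cases i <;> fin_cases j <;> simp_all
    rw [← map_zero exteriorPower.alternatingMapLinearEquiv]
    congr 1
    ext Y
    simp [schoutenRight, h01]

/-- The Schouten bracket `⋀² L × ⋀² L → ⋀³ L`, that is, the bilinear map with
`⟦X₁ ∧ X₂, Y₁ ∧ Y₂⟧ = ∑ᵢⱼ (-1)^(i+j) [Xᵢ, Yⱼ] ∧ X_{3-i} ∧ Y_{3-j}`. -/
def schouten : ⋀[ℂ]^2 L →ₗ[ℂ] ⋀[ℂ]^2 L →ₗ[ℂ] ⋀[ℂ]^3 L :=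
  exteriorPower.alternatingMapLinearEquiv (R := ℂ) (M := L) (N := ⋀[ℂ]^2 L →ₗ[ℂ] ⋀[ℂ]^3 L)
    schoutenAlt

theorem schouten_wedge₂ (X₁ X₂ Y₁ Y₂ : L) :
    schouten (wedge₂ X₁ X₂) (wedge₂ Y₁ Y₂) =
      wedge₃ ⁅X₁, Y₁⁆ X₂ Y₂ - wedge₃ ⁅X₁, Y₂⁆ X₂ Y₁
        - wedge₃ ⁅X₂, Y₁⁆ X₁ Y₂ + wedge₃ ⁅X₂, Y₂⁆ X₁ Y₁ := by
  rw [schouten, wedge₂, exteriorPower.alternatingMapLinearEquiv_apply_ιMulti]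
  change exteriorPower.alternatingMapLinearEquiv (schoutenRight _) (wedge₂ Y₁ Y₂) = _
  rw [wedge₂, exteriorPower.alternatingMapLinearEquiv_apply_ιMulti]
  rfl

end Exterior

/-! ### Levi subalgebras and invariant tensors

Throughout, `L` is a complex simple Lie algebra `𝔤`, `H` a Cartan subalgebra `𝔥`, `b` a system of
simple roots `Π`, and `Γ` a set of simple roots. The orbit `M = G / G_Γ` enters through the tangent
space `𝔪 = 𝔪_Γ` at the base point: invariant polyvector fields on `M` are `𝔤_Γ`-invariant elements
of `⋀ 𝔪`. -/

variable {L : Type*} [LieRing L] [LieAlgebra ℂ L] [FiniteDimensional ℂ L]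
  [LieAlgebra.IsSimple ℂ L] {H : LieSubalgebra ℂ L} [H.IsCartanSubalgebra]

open LieAlgebra LieAlgebra.IsKilling LieModule

/-- The base `b` is of type `D_n` for some `n ≥ 4`, or of type `E₆`. -/
def IsTypeDOrE₆ (b : (rootSystem H).Base) : Prop :=
  (∃ n : ℕ, 4 ≤ n ∧ ∃ e : b.support ≃ Fin n,
    ∀ i j, b.cartanMatrix i j = CartanMatrix.D n (e i) (e j)) ∨
  (∃ e : b.support ≃ Fin 6,
    ∀ i j, b.cartanMatrix i j = CartanMatrix.E₆ (e i) (e j))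

/-- A choice of root vectors `E_α ∈ 𝔤_α` normalized by `(E_α, E_{-α}) = 1` for the Killing form.
(The value of `E` at the zero weight is irrelevant.) -/
structure RootVectors (H : LieSubalgebra ℂ L) [H.IsCartanSubalgebra] where
  E : Weight ℂ H L → L
  mem_rootSpace : ∀ α : Weight ℂ H L, α.IsNonZero → E α ∈ rootSpace H α
  killing_eq_one : ∀ α : Weight ℂ H L, α.IsNonZero → killingForm ℂ L (E α) (E (-α)) = 1

/-- `Ω_Γ`: the roots in the linear span of `Γ`. -/
def leviRoots (Γ : Finset H.root) : Set H.root :=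
  {α | (rootSystem H).root α ∈ Submodule.span ℂ ((rootSystem H).root '' (Γ : Set H.root))}

/-- The Levi subalgebra `𝔤_Γ`, generated by `𝔥` and the root spaces of `±α`, `α ∈ Γ`. -/
def levi (Γ : Finset H.root) : LieSubalgebra ℂ L :=
  LieSubalgebra.lieSpan ℂ L
    ({x | x ∈ H} ∪ {x | ∃ α ∈ Γ, x ∈ rootSpace H α.1 ∨ x ∈ rootSpace H (-α.1)})

/-- The `ad 𝔤_Γ`-invariant complement `𝔪 = 𝔪_Γ` of `𝔤_Γ`: the sum of the root spaces of the roots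
outside `Ω_Γ`. -/
def tangent (Γ : Finset H.root) : Submodule ℂ L :=
  ⨆ α : H.root, ⨆ _ : α ∉ leviRoots Γ, (rootSpace H α.1).toSubmodule

/-- `⋀ⁿ 𝔪` as a subspace of `⋀ⁿ 𝔤`. -/
def tangentPower (Γ : Finset H.root) (n : ℕ) : Submodule ℂ (⋀[ℂ]^n L) :=
  LinearMap.range (exteriorPower.map n (tangent Γ).subtype)

/-- `(⋀ⁿ 𝔪)^{𝔤_Γ}`: the invariant `n`-vector fields on the orbit. -/
def invariants (Γ : Finset H.root) (n : ℕ) : Submodule ℂ (⋀[ℂ]^n L) :=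
  tangentPower Γ n ⊓ ⨅ x : levi Γ, LinearMap.ker (adExt n (x : L))

/-- `θ` is a Cartan automorphism of `𝔤` (relative to `𝔥`): it acts on `𝔥` by `-1`, hence
interchanges the root spaces of `α` and `-α`. -/
def IsCartanAutomorphism (H : LieSubalgebra ℂ L) (θ : L ≃ₗ⁅ℂ⁆ L) : Prop :=
  ∀ x ∈ H, θ x = -x

/-- `(⋀ⁿ 𝔪)^{𝔤_Γ, θ}`: the elements of `⋀ⁿ 𝔪` that are invariant under `𝔤_Γ` and `θ`. -/
def thetaInvariants (Γ : Finset H.root) (θ : L ≃ₗ⁅ℂ⁆ L) (n : ℕ) : Submodule ℂ (⋀[ℂ]^n L) :=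
  invariants Γ n ⊓ LinearMap.eqLocus (exteriorPower.map n (θ : L →ₗ[ℂ] L)) LinearMap.id

/-! ### The three-vector `φ_M` and good orbits -/

/-- The projection of `𝔤` onto `𝔪` along `𝔤_Γ`, `x ↦ ∑ (x, E_{-α}) E_α` over the roots
`α ∉ Ω_Γ`. -/
def proj (R : RootVectors H) (Γ : Finset H.root) : L →ₗ[ℂ] L :=
  open Classical in
  ∑ α : H.root with α ∉ leviRoots Γ,
    (killingForm ℂ L (R.E (-α.1))).smulRight (R.E α.1)

/-- The Drinfeld-Jimbo `r`-matrix `r = ∑_{α > 0} E_α ∧ E_{-α}`. -/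
def rMatrix (R : RootVectors H) (b : (rootSystem H).Base) : ⋀[ℂ]^2 L :=
  open Classical in
  ∑ α : H.root with b.IsPos α, wedge₂ (R.E α.1) (R.E (-α.1))

/-- The invariant element `φ = ⟦r, r⟧ ∈ ⋀³ 𝔤`. -/
def phi (R : RootVectors H) (b : (rootSystem H).Base) : ⋀[ℂ]^3 L :=
  schouten (rMatrix R b) (rMatrix R b)

/-- `φ_M ∈ ⋀³ 𝔪`: the reduction of `φ` modulo `𝔤_Γ ∧ 𝔤 ∧ 𝔤`. -/
def phiM (R : RootVectors H) (b : (rootSystem H).Base) (Γ : Finset H.root) : ⋀[ℂ]^3 L :=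
  exteriorPower.map 3 (proj R Γ) (phi R b)

/-- The Schouten bracket on `M` of invariant bivector fields, as an element of `⋀³ 𝔪`: the reduction
of the Schouten bracket modulo `𝔤_Γ ∧ 𝔤 ∧ 𝔤`. -/
def schoutenM (R : RootVectors H) (Γ : Finset H.root) (v w : ⋀[ℂ]^2 L) : ⋀[ℂ]^3 L :=
  exteriorPower.map 3 (proj R Γ) (schouten v w)

/-- The Kirillov-Kostant-Souriau bivector `v_λ = ∑ (1 / λ(α)) E_α ∧ E_{-α}`, summed over
`α ∈ Ω⁺ ∖ Ω_Γ`, where `λ(α) = α(t)` for the element `t ∈ 𝔥` that corresponds to `λ` under the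
Killing form. -/
def kks (R : RootVectors H) (b : (rootSystem H).Base) (Γ : Finset H.root) (t : H) : ⋀[ℂ]^2 L :=
  open Classical in
  ∑ α : H.root with b.IsPos α ∧ α ∉ leviRoots Γ,
    (α.1 t)⁻¹ • wedge₂ (R.E α.1) (R.E (-α.1))

/-- `t ∈ 𝔥 ≅ 𝔥*` is a base point of an orbit whose stabilizer has Lie algebra `𝔤_Γ`: it is killed by
the roots of `Γ` and by no root outside `Ω_Γ`. -/
def IsBasePoint (Γ : Finset H.root) (t : H) : Prop :=
  (∀ α ∈ Γ, α.1 t = 0) ∧ ∀ α : H.root, α ∉ leviRoots Γ → α.1 t ≠ 0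

/-- The orbit `M = G / G_Γ`, realized as the orbit through `t`, is good: there is an invariant
bracket `f` with `⟦f, f⟧ = K² φ_M` for some `K ≠ 0`, compatible with the KKS bracket. -/
def IsGoodAt (R : RootVectors H) (b : (rootSystem H).Base) (Γ : Finset H.root) (t : H) : Prop :=
  ∃ f ∈ invariants Γ 2, ∃ K : ℂ, K ≠ 0 ∧
    schoutenM R Γ f f = K ^ 2 • phiM R b Γ ∧ schoutenM R Γ f (kks R b Γ t) = 0

/-- The homogeneous space `M = G / G_Γ` is good: one of its realizations as an orbit is good. -/
def IsGood (R : RootVectors H) (b : (rootSystem H).Base) (Γ : Finset H.root) : Prop :=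
  ∃ t : H, IsBasePoint Γ t ∧ IsGoodAt R b Γ t

/-- The orbit is a symmetric space: `[𝔪, 𝔪] ⊆ 𝔤_Γ`, that is, the linear map which is `1` on `𝔤_Γ`
and `-1` on `𝔪` is an automorphism of `𝔤`. -/
def IsSymmetricOrbit (Γ : Finset H.root) : Prop :=
  ∀ x ∈ tangent Γ, ∀ y ∈ tangent Γ, ⁅x, y⁆ ∈ levi Γ

end LieOrbit

end

noncomputable section

namespace LieOrbit

/-! ### Simply laced root systems -/

section Combinatorics

variable {V : Type*} [AddCommGroup V]

/-! Contraction with root vectors turns everything into numbers attached to roots. An invariant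
bivector f acts on E_x by an odd eigenvalue f(x). For roots x + y + z = 0 outside Ω_Γ, the two
conditions of a good orbit read f(x)f(y) + f(y)f(z) + f(z)f(x) = -K² and f(x)x(t)² + f(y)y(t)² +
f(z)z(t)² = 0 (`eigen_mul_sum`, `eigen_mul_sq_sum`). By the second, x ↦ x(t)²f(x) is additive, so it
extends to a linear functional g. With lam(x) = x(t), eliminating f gives (g(x)lam(y) - g(y)lam(x))²
= (K lam(x)lam(y)lam(x+y))² (`exists_isGoodPair`). Goodness is thereby reduced to a relation between
two functionals on a simply laced root system.

This relation has two consequences. In a D₄ subsystem its square root carries a sign for each leaf,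
and any two leaves have opposite signs, which three leaves cannot achieve
(`IsD4.false_of_isGoodPair`). Suitable D₄ subsystems of D_n and E₆ then leave at most two simple
roots outside Γ (`exists_pair_of_isTypeDOrE₆`). Moreover, the coefficients of those simple roots in
any root are at most one in absolute value (`hasSmallLevel_or_neg`).

An invariant trivector w has weight zero, so it is determined by its contractions along triples of
outer roots with sum zero. There φ_M takes the nonzero value -2([E_x, E_y], E_z), so the ratio of w
to φ_M is defined. The ratio is symmetric; θ makes it even; invariance under E_δ with δ in Ω_Γ makes
it constant along the moves (x, y, z) ↦ (x + δ, y - δ, z) (`isMoveInvariant_div`). Small levels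
force every triple, up to order and sign, to have levels (1,0), (0,1), (-1,-1), and moves connect
all of these (`IsMoveInvariant.exists_const`). So the ratio is a constant C and w = Cφ_M. If φ_M =
0, no such triple exists and M is symmetric. -/

/-- `Φ` is a simply laced root system for the form `B`, normalized by `B x x = 2`. -/
structure IsSimplyLaced (Φ : Set V) (B : V →+ V →+ ℝ) : Prop where
  symm : ∀ x y, B x y = B y x
  self : ∀ x ∈ Φ, B x x = 2
  neg_mem : ∀ x ∈ Φ, -x ∈ Φ
  cases : ∀ x ∈ Φ, ∀ y ∈ Φ, x = y ∨ x = -y ∨ B x y = -1 ∨ B x y = 0 ∨ B x y = 1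
  add_mem : ∀ x ∈ Φ, ∀ y ∈ Φ, B x y = -1 → x + y ∈ Φ

namespace IsSimplyLaced

variable {Φ : Set V} {B : V →+ V →+ ℝ} (h : IsSimplyLaced Φ B)
include h

theorem sub_mem {x y : V} (hx : x ∈ Φ) (hy : y ∈ Φ) (hxy : B x y = 1) : x - y ∈ Φ := by
  rw [sub_eq_add_neg]
  exact h.add_mem _ hx _ (h.neg_mem _ hy) (by rw [map_neg, hxy])

theorem eq_neg_one_of_add_mem {x y : V} (hx : x ∈ Φ) (hy : y ∈ Φ) (hxy : x + y ∈ Φ) :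
    B x y = -1 := by
  have := h.self _ hxy
  simp only [map_add, AddMonoidHom.add_apply, h.self _ hx, h.self _ hy, h.symm y x] at this
  linarith

end IsSimplyLaced

/-- The roots `r; y₁, y₂, y₃` are the simple roots of a subsystem of type `D₄` with center `r`. -/
structure IsD4 (Φ : Set V) (B : V →+ V →+ ℝ) (r y₁ y₂ y₃ : V) : Prop where
  mem : r ∈ Φ
  mem₁ : y₁ ∈ Φ
  mem₂ : y₂ ∈ Φ
  mem₃ : y₃ ∈ Φ
  adj₁ : B r y₁ = -1
  adj₂ : B r y₂ = -1
  adj₃ : B r y₃ = -1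
  orth₁₂ : B y₁ y₂ = 0
  orth₁₃ : B y₁ y₃ = 0
  orth₂₃ : B y₂ y₃ = 0

namespace IsD4

variable {Φ : Set V} {B : V →+ V →+ ℝ} {r y₁ y₂ y₃ : V}

theorem rotate (h : IsSimplyLaced Φ B) (d : IsD4 Φ B r y₁ y₂ y₃) : IsD4 Φ B r y₂ y₃ y₁ :=
  ⟨d.mem, d.mem₂, d.mem₃, d.mem₁, d.adj₂, d.adj₃, d.adj₁, d.orth₂₃,
    by rw [h.symm, d.orth₁₂], by rw [h.symm, d.orth₁₃]⟩

theorem add_mem (h : IsSimplyLaced Φ B) (d : IsD4 Φ B r y₁ y₂ y₃) : r + y₁ ∈ Φ :=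
  h.add_mem _ d.mem _ d.mem₁ d.adj₁

theorem add_add_mem (h : IsSimplyLaced Φ B) (d : IsD4 Φ B r y₁ y₂ y₃) : r + y₁ + y₂ ∈ Φ :=
  h.add_mem _ (d.add_mem h) _ d.mem₂ (by simp [d.adj₂, d.orth₁₂])

theorem add_add_add_mem (h : IsSimplyLaced Φ B) (d : IsD4 Φ B r y₁ y₂ y₃) :
    r + y₁ + y₂ + y₃ ∈ Φ :=
  h.add_mem _ (d.add_add_mem h) _ d.mem₃ (by simp [d.adj₃, d.orth₁₃, d.orth₂₃])

theorem highest_mem (h : IsSimplyLaced Φ B) (d : IsD4 Φ B r y₁ y₂ y₃) :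
    r + y₁ + y₂ + y₃ + r ∈ Φ :=
  h.add_mem _ (d.add_add_add_mem h) _ d.mem (by
    simp [h.symm _ r, d.adj₁, d.adj₂, d.adj₃, h.self _ d.mem]; norm_num)

/-- Another base of the same subsystem of type `D₄`. -/
theorem rebase (h : IsSimplyLaced Φ B) (d : IsD4 Φ B r y₁ y₂ y₃) :
    IsD4 Φ B y₁ r (r + y₂ + y₃) (-(r + y₁ + y₂)) := by
  have e₁ := h.self _ d.mem
  have e₂ := h.self _ d.mem₁
  have e₃ := h.self _ d.mem₂
  refine ⟨d.mem₁, d.mem, (d.rotate h).add_add_mem h, h.neg_mem _ (d.add_add_mem h), ?_, ?_, ?_, ?_,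
    ?_, ?_⟩ <;>
  simp only [map_add, map_neg, AddMonoidHom.add_apply, h.symm y₁ r, h.symm y₂ r, h.symm y₃ r,
    h.symm y₂ y₁, h.symm y₃ y₁, h.symm y₃ y₂, d.adj₁, d.adj₂, d.adj₃, d.orth₁₂, d.orth₁₃,
    d.orth₂₃, e₁, e₂, e₃] <;> norm_num

end IsD4

/-- The compatibility condition satisfied by the functionals `lam` and `g` of a good orbit. -/
def IsGoodPair (Φ : Set V) (lam g : V →+ ℂ) (K : ℂ) : Prop :=
  ∀ x ∈ Φ, ∀ y ∈ Φ, x + y ∈ Φ →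
    (g x * lam y - g y * lam x) ^ 2 = (K * (lam x * lam y * lam (x + y))) ^ 2

/-- Here a, b₁, b₂ and p, q₁, q₂ are the values of `lam` and `g` at a center r and two leaves. Each
of `e₁`, `e₂` fixes its left side up to sign. Equal signs contradict `e₃`, the relation for r + y₁
and y₂, unless some bᵢ vanishes; but then the sign at that leaf is free and can be chosen opposite.
-/
theorem exists_sign_of_good_triple {K a b₁ b₂ p q₁ q₂ : ℂ} (hK : K ≠ 0) (ha : a ≠ 0)
    (h₁ : a + b₁ ≠ 0) (h₂ : a + b₂ ≠ 0)
    (e₁ : (p * b₁ - q₁ * a) ^ 2 = (K * (a * b₁ * (a + b₁))) ^ 2)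
    (e₂ : (p * b₂ - q₂ * a) ^ 2 = (K * (a * b₂ * (a + b₂))) ^ 2)
    (e₃ : ((p + q₁) * b₂ - q₂ * (a + b₁)) ^ 2 = (K * ((a + b₁) * b₂ * (a + b₁ + b₂))) ^ 2) :
    ∃ k, k ^ 2 = K ^ 2 ∧ p * b₁ - q₁ * a = k * (a * b₁ * (a + b₁)) ∧
      p * b₂ - q₂ * a = -k * (a * b₂ * (a + b₂)) := by
  have key : ∀ k, k ^ 2 = K ^ 2 → p * b₁ - q₁ * a = k * (a * b₁ * (a + b₁)) →
      p * b₂ - q₂ * a = k * (a * b₂ * (a + b₂)) → b₁ = 0 ∨ b₂ = 0 := by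
    intro k hk f₁ f₂
    have hk0 : k ≠ 0 := by
      rintro rfl
      exact hK (by simpa using hk.symm)
    -- The factor comes from (a + b₁ + b₂)² - (a + b₂ - b₁)² = 4b₁(a + b₂).
    have h4 : (2 * (k * a * b₂ * (a + b₁))) ^ 2 * (b₁ * (a + b₂)) = 0 := by
      have f₃ : a * ((p + q₁) * b₂ - q₂ * (a + b₁)) = k * a * b₂ * (a + b₁) * (a + b₂ - b₁) := by
        linear_combination (-b₂) * f₁ + (a + b₁) * f₂
      have f₄ : (k * a * b₂ * (a + b₁) * (a + b₂ - b₁)) ^ 2 =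
          (k * a * b₂ * (a + b₁) * (a + b₁ + b₂)) ^ 2 := by
        rw [← f₃]
        linear_combination a ^ 2 * e₃ - (a * ((a + b₁) * b₂ * (a + b₁ + b₂))) ^ 2 * hk
      linear_combination -f₄
    have : b₂ = 0 ∨ b₁ = 0 := by
      simpa [hk0, ha, h₁, h₂] using h4
    exact this.symm
  rcases sq_eq_sq_iff_eq_or_eq_neg.mp e₁ with f₁ | f₁ <;>
  rcases sq_eq_sq_iff_eq_or_eq_neg.mp e₂ with f₂ | f₂
  · rcases key K rfl f₁ f₂ with rfl | rfl
    · exact ⟨-K, by ring, by simpa using f₁, by rw [f₂]; ring⟩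
    · exact ⟨K, rfl, f₁, by simpa using f₂⟩
  · exact ⟨K, rfl, f₁, by rw [f₂]; ring⟩
  · exact ⟨-K, by ring, by rw [f₁]; ring, by rw [f₂]; ring⟩
  · rcases key (-K) (by ring) (by rw [f₁]; ring) (by rw [f₂]; ring) with rfl | rfl
    · exact ⟨K, rfl, by simpa using f₁, by rw [f₂]; ring⟩
    · exact ⟨-K, by ring, by rw [f₁]; ring, by simpa using f₂⟩

/-- This is the case where both functionals vanish at the third leaf, so that `e` is the relation
for r + y₁ + y₂ + y₃ and r. Opposite signs make its left side the square of ka(b₁ - b₂)(a + b₁ +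
b₂), and (2a + b₁ + b₂)² - (b₁ - b₂)² = 4(a + b₁)(a + b₂) is not zero. -/
theorem false_of_good_D4_of_eq_zero {K a b₁ b₂ p q₁ q₂ k : ℂ} (hK : K ≠ 0) (ha : a ≠ 0)
    (h₁ : a + b₁ ≠ 0) (h₂ : a + b₂ ≠ 0) (h₁₂ : a + b₁ + b₂ ≠ 0) (hk : k ^ 2 = K ^ 2)
    (f₁ : p * b₁ - q₁ * a = k * (a * b₁ * (a + b₁)))
    (f₂ : p * b₂ - q₂ * a = -k * (a * b₂ * (a + b₂)))
    (e : ((p + q₁ + q₂) * a - p * (a + b₁ + b₂)) ^ 2 =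
      (K * ((a + b₁ + b₂) * a * (a + b₁ + b₂ + a))) ^ 2) : False := by
  have h4 : (2 * (K * a * (a + b₁ + b₂))) ^ 2 * ((a + b₁) * (a + b₂)) = 0 := by
    have f₃ : (p + q₁ + q₂) * a - p * (a + b₁ + b₂) = -(k * a * (b₁ - b₂) * (a + b₁ + b₂)) := by
      linear_combination -f₁ - f₂
    rw [f₃] at e
    linear_combination -e + (a * (b₁ - b₂) * (a + b₁ + b₂)) ^ 2 * hk
  simp [hK, ha, h₁, h₂, h₁₂] at h4

/-- Three signs cannot be pairwise opposite. If `lam` vanishes at a leaf, that leaf has no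
well-defined sign, and the relation producing the highest root gives the contradiction instead. -/
theorem IsD4.false_of_isGoodPair {Φ : Set V} {B : V →+ V →+ ℝ} (h : IsSimplyLaced Φ B)
    {lam g : V →+ ℂ} {K : ℂ} (hK : K ≠ 0) (hC : IsGoodPair Φ lam g K) {r y₁ y₂ y₃ : V}
    (d : IsD4 Φ B r y₁ y₂ y₃) (h₀ : lam r ≠ 0) (h₁ : lam (r + y₁) ≠ 0) (h₂ : lam (r + y₂) ≠ 0)
    (h₃ : lam (r + y₃) ≠ 0) (h₁₂ : lam (r + y₁ + y₂) ≠ 0) (h₂₃ : lam (r + y₂ + y₃) ≠ 0)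
    (h₃₁ : lam (r + y₃ + y₁) ≠ 0) : False := by
  have d' := d.rotate h
  have d'' := d'.rotate h
  have e₁ := hC _ d.mem _ d.mem₁ (d.add_mem h)
  have e₂ := hC _ d.mem _ d.mem₂ (d'.add_mem h)
  have e₃ := hC _ d.mem _ d.mem₃ (d''.add_mem h)
  have e₁₂ := hC _ (d.add_mem h) _ d.mem₂ (d.add_add_mem h)
  have e₂₃ := hC _ (d'.add_mem h) _ d.mem₃ (d'.add_add_mem h)
  have e₃₁ := hC _ (d''.add_mem h) _ d.mem₁ (d''.add_add_mem h)
  have e := hC _ (d.add_add_add_mem h) _ d.mem (d.highest_mem h)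
  simp only [map_add] at *
  generalize lam r = a at *
  generalize lam y₁ = b₁ at *
  generalize lam y₂ = b₂ at *
  generalize lam y₃ = b₃ at *
  generalize g r = p at *
  generalize g y₁ = q₁ at *
  generalize g y₂ = q₂ at *
  generalize g y₃ = q₃ at *
  obtain ⟨k, hk, f₁, f₂⟩ := exists_sign_of_good_triple hK h₀ h₁ h₂ e₁ e₂ e₁₂
  obtain ⟨l, hl, f₂', f₃⟩ := exists_sign_of_good_triple hK h₀ h₂ h₃ e₂ e₃ e₂₃
  obtain ⟨m, hm, f₃', f₁'⟩ := exists_sign_of_good_triple hK h₀ h₃ h₁ e₃ e₁ e₃₁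
  -- At a leaf where `lam` vanishes the relation reduces to (qa)² = 0, so `g` vanishes there too.
  have hq : ∀ b q, b = 0 → (p * b - q * a) ^ 2 = (K * (a * b * (a + b))) ^ 2 → q = 0 := by
    rintro b q rfl hb
    simpa [h₀] using hb
  by_cases hb₁ : b₁ = 0
  · have := hq _ _ hb₁ e₁
    subst hb₁ this
    exact false_of_good_D4_of_eq_zero hK h₀ h₂ h₃ h₂₃ hl f₂' f₃ (by simpa using e)
  by_cases hb₂ : b₂ = 0
  · have := hq _ _ hb₂ e₂
    subst hb₂ this
    refine false_of_good_D4_of_eq_zero hK h₀ h₃ h₁ h₃₁ hm f₃' f₁' ?_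
    simp only [add_zero] at e
    linear_combination e
  by_cases hb₃ : b₃ = 0
  · have := hq _ _ hb₃ e₃
    subst hb₃ this
    exact false_of_good_D4_of_eq_zero hK h₀ h₁ h₂ h₁₂ hk f₁ f₂ (by simpa using e)
  -- No leaf has value zero now, so the signs from the three pairs can be compared: k = -m = l = -k.
  have g₁ : k = -m := mul_right_cancel₀ (mul_ne_zero (mul_ne_zero h₀ hb₁) h₁) (f₁.symm.trans f₁')
  have g₂ : -k = l := mul_right_cancel₀ (mul_ne_zero (mul_ne_zero h₀ hb₂) h₂) (f₂.symm.trans f₂')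
  have g₃ : -l = m := mul_right_cancel₀ (mul_ne_zero (mul_ne_zero h₀ hb₃) h₃) (f₃.symm.trans f₃')
  have : k = 0 := by
    have : (2 : ℂ) * k = 0 := by linear_combination g₁ - g₂ + g₃
    simpa using this
  rw [this] at hk
  exact hK (by simpa using hk.symm)

/-- `α` is a base of the root system `Φ`, with coordinate functions `c`. -/
structure IsBased {ι : Type*} (Φ : Set V) (α : ι → V) (c : ι → V →+ ℝ) : Prop where
  mem : ∀ i, α i ∈ Φ
  coord_self : ∀ i, c i (α i) = 1
  coord_ne : ∀ i j, i ≠ j → c i (α j) = 0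
  induction : ∀ p : V → Prop, (∀ i, p (α i)) → (∀ x ∈ Φ, ∀ i, p x → x + α i ∈ Φ → p (x + α i)) →
    ∀ x ∈ Φ, p x ∨ p (-x)

namespace IsBased

variable {ι : Type*} {Φ : Set V} {α : ι → V} {c : ι → V →+ ℝ} (hb : IsBased Φ α c)
include hb

theorem coord_nonneg (i j : ι) : 0 ≤ c i (α j) := by
  by_cases h : i = j
  · rw [h, hb.coord_self]; norm_num
  · rw [hb.coord_ne _ _ h]

theorem exists_natCast_sum [Fintype ι] {x : V} (hx : x ∈ Φ) :
    ∃ n : ι → ℕ, x = ∑ i, n i • α i ∨ -x = ∑ i, n i • α i := by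
  classical
  have := hb.induction (fun x => ∃ n : ι → ℕ, x = ∑ i, n i • α i)
    (fun i => ⟨Pi.single i 1, by
      rw [Finset.sum_eq_single i] <;> simp +contextual⟩)
    (by
      rintro x - i ⟨n, rfl⟩ -
      refine ⟨n + Pi.single i 1, ?_⟩
      simp only [Pi.add_apply, add_smul, Finset.sum_add_distrib]
      congr 1
      rw [Finset.sum_eq_single i] <;> simp +contextual) x hx
  rcases this with ⟨n, h⟩ | ⟨n, h⟩
  exacts [⟨n, Or.inl h⟩, ⟨n, Or.inr h⟩]

theorem coord_sum [Fintype ι] (n : ι → ℤ) (i : ι) : c i (∑ j, n j • α j) = n i := by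
  classical
  rw [map_sum, Finset.sum_eq_single i]
  · simp [hb.coord_self]
  · intro j _ hj
    simp [hb.coord_ne _ _ hj.symm]
  · simp

theorem exists_intCast_sum [Fintype ι] {x : V} (hx : x ∈ Φ) :
    ∃ n : ι → ℤ, x = ∑ i, n i • α i := by
  obtain ⟨n, h | h⟩ := hb.exists_natCast_sum hx
  · exact ⟨fun i => n i, by simpa using h⟩
  · exact ⟨fun i => -(n i : ℤ), by rw [← neg_neg x, h]; simp⟩

/-- The difference of two roots with the same coordinates outside `Γ` lies in the lattice spanned
by `Γ`. -/
theorem sub_mem_closure [Fintype ι] {Γ : Set ι} {x y : V} (hx : x ∈ Φ) (hy : y ∈ Φ)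
    (hxy : ∀ i ∉ Γ, c i x = c i y) : x - y ∈ AddSubgroup.closure (α '' Γ) := by
  obtain ⟨m, rfl⟩ := hb.exists_intCast_sum hx
  obtain ⟨n, rfl⟩ := hb.exists_intCast_sum hy
  rw [← Finset.sum_sub_distrib]
  refine AddSubgroup.sum_mem _ fun i _ => ?_
  rw [← sub_smul]
  by_cases hi : i ∈ Γ
  · exact AddSubgroup.zsmul_mem _ (AddSubgroup.subset_closure (Set.mem_image_of_mem α hi)) _
  · have := hxy i hi
    rw [hb.coord_sum, hb.coord_sum] at this
    rw [Int.cast_injective this, sub_self, zero_smul]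
    exact zero_mem _

end IsBased

/-- The functionals `lam` and `g` vanish on the simple roots in `Γ`, and `lam` vanishes on no root
outside the span of `Γ`. -/
structure IsAdapted {ι : Type*} (Φ : Set V) (α : ι → V) (c : ι → V →+ ℝ) (Γ : Set ι)
    (lam g : V →+ ℂ) : Prop where
  lam_eq_zero : ∀ i ∈ Γ, lam (α i) = 0
  g_eq_zero : ∀ i ∈ Γ, g (α i) = 0
  lam_ne_zero : ∀ x ∈ Φ, ∀ i ∉ Γ, c i x ≠ 0 → lam x ≠ 0

/-! ### D₄ subsystems and membership in Γ -/

section Adapted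

variable {ι : Type*} {Φ : Set V} {B : V →+ V →+ ℝ} {α : ι → V} {c : ι → V →+ ℝ} {Γ : Set ι}
  {lam g : V →+ ℂ} {K : ℂ} (h : IsSimplyLaced Φ B) (hK : K ≠ 0) (hC : IsGoodPair Φ lam g K)
  (ha : IsAdapted Φ α c Γ lam g)

include h hK hC ha

/-- If i were outside Γ, all seven roots at which `lam` must not vanish would be safe, since each
has positive i-th coordinate. -/
theorem IsD4.mem_of_pos {r y₁ y₂ y₃ : V} (d : IsD4 Φ B r y₁ y₂ y₃) {i : ι} (hr : 0 < c i r)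
    (h₁ : 0 ≤ c i y₁) (h₂ : 0 ≤ c i y₂) (h₃ : 0 ≤ c i y₃) : i ∈ Γ := by
  by_contra hi
  have d' := d.rotate h
  have d'' := d'.rotate h
  have key : ∀ x ∈ Φ, 0 < c i x → lam x ≠ 0 := fun x hx hp => ha.lam_ne_zero x hx i hi hp.ne'
  refine d.false_of_isGoodPair h hK hC (key _ d.mem hr) (key _ (d.add_mem h) ?_)
    (key _ (d'.add_mem h) ?_) (key _ (d''.add_mem h) ?_) (key _ (d.add_add_mem h) ?_)
    (key _ (d'.add_add_mem h) ?_) (key _ (d''.add_add_mem h) ?_) <;> simp only [map_add] <;>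
    linarith

/-- The ends of a subsystem of type `D₄` do not all lie outside `Γ`. -/
theorem IsD4.mem_or_mem_or_mem {r y₁ y₂ y₃ : V} (d : IsD4 Φ B r y₁ y₂ y₃) {i j k : ι}
    (hr : c i r = 0 ∧ c j r = 0 ∧ c k r = 0) (h₁ : c i y₁ ≠ 0 ∧ c j y₁ = 0 ∧ c k y₁ = 0)
    (h₂ : c i y₂ = 0 ∧ c j y₂ ≠ 0 ∧ c k y₂ = 0) (h₃ : c i y₃ = 0 ∧ c j y₃ = 0 ∧ c k y₃ ≠ 0) :
    i ∈ Γ ∨ j ∈ Γ ∨ k ∈ Γ := by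
  by_contra! hcon
  obtain ⟨hi, hj, hk⟩ := hcon
  have e := d.rebase h
  have e' := e.rotate h
  have e'' := e'.rotate h
  obtain ⟨r₁, r₂, r₃⟩ := hr
  obtain ⟨a₁, a₂, a₃⟩ := h₁
  obtain ⟨b₁, b₂, b₃⟩ := h₂
  obtain ⟨c₁, c₂, c₃⟩ := h₃
  refine e.false_of_isGoodPair h hK hC (ha.lam_ne_zero _ e.mem i hi a₁)
    (ha.lam_ne_zero _ (e.add_mem h) i hi ?_) (ha.lam_ne_zero _ (e'.add_mem h) i hi ?_)
    (ha.lam_ne_zero _ (e''.add_mem h) j hj ?_) (ha.lam_ne_zero _ (e.add_add_mem h) i hi ?_)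
    (ha.lam_ne_zero _ (e'.add_add_mem h) k hk ?_)
    (ha.lam_ne_zero _ (e''.add_add_mem h) j hj ?_) <;>
  simp [*]

end Adapted

/-- The pairs of levels that occur on an orbit with at most two generators outside `Γ`. -/
def HasSmallLevel (l₁ l₂ : V →+ ℝ) (x : V) : Prop :=
  (l₁ x = 0 ∧ l₂ x = 0) ∨ (l₁ x = 1 ∧ l₂ x = 0) ∨ (l₁ x = 0 ∧ l₂ x = 1) ∨ (l₁ x = 1 ∧ l₂ x = 1)

/-- Roots are built by adding simple roots, so it suffices to exclude the steps (1,0) → (2,0) and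
(1,1) → (2,1), and their mirror images. The induction carries the values of `lam` and `g`, which
depend only on the level. -/
theorem hasSmallLevel_or_neg {ι : Type*} {Φ : Set V} {α : ι → V} {c : ι → V →+ ℝ}
    (hb : IsBased Φ α c)
    {lam g : V →+ ℂ} {K : ℂ} (hK : K ≠ 0) (hC : IsGoodPair Φ lam g K) {l₁ l₂ : V →+ ℝ}
    {a b p q : ℂ}
    (hα : ∀ i, (l₁ (α i) = 0 ∧ l₂ (α i) = 0 ∧ lam (α i) = 0 ∧ g (α i) = 0) ∨
      (l₁ (α i) = 1 ∧ l₂ (α i) = 0 ∧ lam (α i) = a ∧ g (α i) = p) ∨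
      (l₁ (α i) = 0 ∧ l₂ (α i) = 1 ∧ lam (α i) = b ∧ g (α i) = q))
    (hlam : ∀ x ∈ Φ, l₁ x ≠ 0 ∨ l₂ x ≠ 0 → lam x ≠ 0) {x : V} (hx : x ∈ Φ) :
    HasSmallLevel l₁ l₂ x ∨ HasSmallLevel l₁ l₂ (-x) := by
  -- The relation used to reach level (1,1). It involves only a, b, p, q, so it is still available
  -- for comparison at the next step.
  let X : Prop := (p * b - q * a) ^ 2 = (K * (a * b * (a + b))) ^ 2
  let P : V → Prop := fun x => (l₁ x = 0 ∧ l₂ x = 0 ∧ lam x = 0 ∧ g x = 0) ∨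
      (l₁ x = 1 ∧ l₂ x = 0 ∧ lam x = a ∧ g x = p) ∨
      (l₁ x = 0 ∧ l₂ x = 1 ∧ lam x = b ∧ g x = q) ∨
      (l₁ x = 1 ∧ l₂ x = 1 ∧ lam x = a + b ∧ g x = p + q ∧ X)
  have hP : ∀ x, P x → HasSmallLevel l₁ l₂ x := by
    rintro x (h | h | h | h)
    · exact Or.inl ⟨h.1, h.2.1⟩
    · exact Or.inr (Or.inl ⟨h.1, h.2.1⟩)
    · exact Or.inr (Or.inr (Or.inl ⟨h.1, h.2.1⟩))
    · exact Or.inr (Or.inr (Or.inr ⟨h.1, h.2.1⟩))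
  refine (hb.induction P ?_ ?_ x hx).imp (hP _) (hP _)
  · intro i
    rcases hα i with h | h | h
    · exact Or.inl h
    · exact Or.inr (Or.inl h)
    · exact Or.inr (Or.inr (Or.inl h))
  · intro x hx i hpx hxi
    have hc := hC x hx _ (hb.mem i) hxi
    have hl := hlam _ hx
    have hl' := hlam _ (hb.mem i)
    simp only [P, map_add]
    rw [map_add] at hc
    rcases hα i with ⟨u₁, u₂, u₃, u₄⟩ | ⟨u₁, u₂, u₃, u₄⟩ | ⟨u₁, u₂, u₃, u₄⟩
    · rw [u₁, u₂, u₃, u₄]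
      simpa only [add_zero] using hpx
    · rcases hpx with ⟨v₁, v₂, v₃, v₄⟩ | ⟨v₁, v₂, v₃, v₄⟩ | ⟨v₁, v₂, v₃, v₄⟩ | ⟨v₁, v₂, v₃, v₄, hX⟩
      · rw [u₁, u₂, u₃, u₄, v₁, v₂, v₃, v₄]
        simp
      · rw [v₁, v₃] at hl
        rw [u₃, u₄, v₃, v₄] at hc
        have ha : a ≠ 0 := hl (by norm_num)
        exfalso
        -- Two summands with equal values of `lam` and `g` make the left side of the relation zero.
        have : (a * a * (a + a)) ^ 2 * K ^ 2 = 0 := by linear_combination -hc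
        simp [hK, ha, ← two_mul] at this
      · rw [u₁, u₂, u₃, u₄, v₁, v₂, v₃, v₄]
        refine Or.inr (Or.inr (Or.inr ⟨by norm_num, by norm_num, by ring, by ring, ?_⟩))
        rw [u₃, u₄, v₃, v₄] at hc
        simp only [X]
        linear_combination hc
      · rw [v₁, v₂, v₃] at hl
        rw [u₁, u₃] at hl'
        rw [u₃, u₄, v₃, v₄] at hc
        simp only [X] at hX
        have h₁ : a ≠ 0 := hl' (by norm_num)
        have h₂ : a + b ≠ 0 := hl (by norm_num)
        exfalso
        -- The left side is the same as in `X`, so the right sides agree, while (2a + b)² - b² =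
        -- 4a(a + b) is not zero.
        have : (2 * (K * (a * (a + b)))) ^ 2 * (a * (a + b)) = 0 := by
          linear_combination hX - hc
        simp [hK, h₁, h₂] at this
    · rcases hpx with ⟨v₁, v₂, v₃, v₄⟩ | ⟨v₁, v₂, v₃, v₄⟩ | ⟨v₁, v₂, v₃, v₄⟩ | ⟨v₁, v₂, v₃, v₄, hX⟩
      · rw [u₁, u₂, u₃, u₄, v₁, v₂, v₃, v₄]
        simp
      · rw [u₁, u₂, u₃, u₄, v₁, v₂, v₃, v₄]
        refine Or.inr (Or.inr (Or.inr ⟨by norm_num, by norm_num, by ring, by ring, ?_⟩))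
        rw [u₃, u₄, v₃, v₄] at hc
        simp only [X]
        linear_combination hc
      · rw [v₂, v₃] at hl
        rw [u₃, u₄, v₃, v₄] at hc
        have hb : b ≠ 0 := hl (by norm_num)
        exfalso
        have : (b * b * (b + b)) ^ 2 * K ^ 2 = 0 := by linear_combination -hc
        simp [hK, hb, ← two_mul] at this
      · rw [v₁, v₂, v₃] at hl
        rw [u₂, u₃] at hl'
        rw [u₃, u₄, v₃, v₄] at hc
        simp only [X] at hX
        have h₁ : b ≠ 0 := hl' (by norm_num)
        have h₂ : a + b ≠ 0 := hl (by norm_num)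
        exfalso
        have : (2 * (K * (b * (a + b)))) ^ 2 * (b * (a + b)) = 0 := by
          linear_combination hX - hc
        simp [hK, h₁, h₂] at this

/-- Three roots with sum zero, none of which has level zero. -/
structure IsTriple (Φ : Set V) (l₁ l₂ : V →+ ℝ) (x y z : V) : Prop where
  mem₁ : x ∈ Φ
  mem₂ : y ∈ Φ
  mem₃ : z ∈ Φ
  sum : x + y + z = 0
  level₁ : l₁ x ≠ 0 ∨ l₂ x ≠ 0
  level₂ : l₁ y ≠ 0 ∨ l₂ y ≠ 0
  level₃ : l₁ z ≠ 0 ∨ l₂ z ≠ 0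

namespace IsTriple

variable {Φ : Set V} {B : V →+ V →+ ℝ} {l₁ l₂ : V →+ ℝ} {x y z : V}

theorem rotate (t : IsTriple Φ l₁ l₂ x y z) : IsTriple Φ l₁ l₂ y z x :=
  ⟨t.mem₂, t.mem₃, t.mem₁, by rw [← t.sum]; abel, t.level₂, t.level₃, t.level₁⟩

theorem swap (t : IsTriple Φ l₁ l₂ x y z) : IsTriple Φ l₁ l₂ y x z :=
  ⟨t.mem₂, t.mem₁, t.mem₃, by rw [← t.sum]; abel, t.level₂, t.level₁, t.level₃⟩

theorem neg (h : IsSimplyLaced Φ B) (t : IsTriple Φ l₁ l₂ x y z) :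
    IsTriple Φ l₁ l₂ (-x) (-y) (-z) :=
  ⟨h.neg_mem _ t.mem₁, h.neg_mem _ t.mem₂, h.neg_mem _ t.mem₃,
    by rw [← neg_zero, ← t.sum]; abel, by simpa using t.level₁, by simpa using t.level₂,
    by simpa using t.level₃⟩

end IsTriple

/-- A function on triples of roots that is symmetric, even, and constant along the moves
`(x, y, z) ↦ (x + δ, y - δ, z)` by roots `δ` of level zero. -/
structure IsMoveInvariant (Φ : Set V) (B : V →+ V →+ ℝ) (l₁ l₂ : V →+ ℝ) (ψ : V → V → V → ℂ) :
    Prop where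
  rotate : ∀ x y z, IsTriple Φ l₁ l₂ x y z → ψ y z x = ψ x y z
  swap : ∀ x y z, IsTriple Φ l₁ l₂ x y z → ψ y x z = ψ x y z
  neg : ∀ x y z, IsTriple Φ l₁ l₂ x y z → ψ (-x) (-y) (-z) = ψ x y z
  move : ∀ x y z, IsTriple Φ l₁ l₂ x y z → ∀ δ ∈ Φ, l₁ δ = 0 → l₂ δ = 0 → B x δ = -1 → B y δ = 1 →
    ψ (x + δ) (y - δ) z = ψ x y z

/-- A triple of roots with levels `(1, 0)`, `(0, 1)`, `(-1, -1)`. -/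
structure IsStandardTriple (Φ : Set V) (l₁ l₂ : V →+ ℝ) (x y z : V) : Prop where
  mem₁ : x ∈ Φ
  mem₂ : y ∈ Φ
  mem₃ : z ∈ Φ
  sum : x + y + z = 0
  level₁₁ : l₁ x = 1
  level₁₂ : l₂ x = 0
  level₂₁ : l₁ y = 0
  level₂₂ : l₂ y = 1
  level₃₁ : l₁ z = -1
  level₃₂ : l₂ z = -1

/-! ### Connectedness of triples under moves -/

section

variable {Φ : Set V} {B : V →+ V →+ ℝ} {l₁ l₂ : V →+ ℝ} {ψ : V → V → V → ℂ}

theorem IsStandardTriple.isTriple {x y z : V} (t : IsStandardTriple Φ l₁ l₂ x y z) :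
    IsTriple Φ l₁ l₂ x y z :=
  ⟨t.mem₁, t.mem₂, t.mem₃, t.sum, by simp [t.level₁₁], by simp [t.level₂₂], by simp [t.level₃₁]⟩

theorem IsStandardTriple.swap {x y z : V} (t : IsStandardTriple Φ l₁ l₂ x y z) :
    IsStandardTriple Φ l₂ l₁ y x z :=
  ⟨t.mem₂, t.mem₁, t.mem₃, by rw [← t.sum]; abel, t.level₂₂, t.level₂₁, t.level₁₂, t.level₁₁,
    t.level₃₂, t.level₃₁⟩

/-- Inspect B(x, x₀): the value -1 gives a root of level (2,0), the value 0 a root x₀ - y of level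
(1,-1), and both levels are excluded. What remains is x = x₀, or B(x, x₀) = 1 and one move by x₀ -
x. -/
theorem IsStandardTriple.eq_of_eq (h : IsSimplyLaced Φ B)
    (hlev : ∀ x ∈ Φ, HasSmallLevel l₁ l₂ x ∨ HasSmallLevel l₁ l₂ (-x))
    (hψ : IsMoveInvariant Φ B l₁ l₂ ψ) {x y x₀ y₀ z : V} (t : IsStandardTriple Φ l₁ l₂ x y z)
    (t₀ : IsStandardTriple Φ l₁ l₂ x₀ y₀ z) : ψ x y z = ψ x₀ y₀ z := by
  have hy : y = -z - x := by rw [eq_sub_iff_add_eq, eq_neg_iff_add_eq_zero, ← t.sum]; abel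
  have hy₀ : y₀ = -z - x₀ := by rw [eq_sub_iff_add_eq, eq_neg_iff_add_eq_zero, ← t₀.sum]; abel
  have hxz : B x z = -1 := by
    refine h.eq_neg_one_of_add_mem t.mem₁ t.mem₃ ?_
    have := h.neg_mem _ t.mem₂
    rwa [hy, show -(-z - x) = x + z by abel] at this
  have hxz₀ : B x₀ z = -1 := by
    refine h.eq_neg_one_of_add_mem t₀.mem₁ t.mem₃ ?_
    have := h.neg_mem _ t₀.mem₂
    rwa [hy₀, show -(-z - x₀) = x₀ + z by abel] at this
  have hxx := h.self _ t.mem₁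
  have hxx₀ := h.self _ t₀.mem₁
  have := t.level₁₁
  have := t₀.level₁₁
  rcases h.cases x t.mem₁ x₀ t₀.mem₁ with e | e | e | e | e
  · subst e
    rw [hy, hy₀]
  · have := t.level₁₁
    rw [e, map_neg] at this
    linarith
  · have hl := hlev _ (h.add_mem _ t.mem₁ _ t₀.mem₁ e)
    simp only [HasSmallLevel, map_add, map_neg] at hl
    rcases hl with (hl | hl | hl | hl) | (hl | hl | hl | hl) <;> linarith [hl.1]
  · have hl := hlev (x₀ - y) (h.sub_mem t₀.mem₁ t.mem₂ (by
      rw [hy, map_sub, map_neg, hxz₀, h.symm x₀ x, e]; norm_num))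
    have h₁ := t₀.level₁₂
    have h₂ := t.level₂₁
    have h₃ := t.level₂₂
    simp only [HasSmallLevel, map_sub, map_neg] at hl
    rcases hl with (hl | hl | hl | hl) | (hl | hl | hl | hl) <;> linarith [hl.1, hl.2]
  · have hδ := h.sub_mem t₀.mem₁ t.mem₁ ((h.symm _ _).trans e)
    rw [← hψ.move _ _ _ t.isTriple _ hδ (by rw [map_sub, t.level₁₁, t₀.level₁₁, sub_self])
      (by rw [map_sub, t.level₁₂, t₀.level₁₂, sub_self])
      (by rw [map_sub, e, hxx]; norm_num)
      (by
        rw [hy, map_sub, map_sub, map_neg, AddMonoidHom.sub_apply, AddMonoidHom.sub_apply,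
          AddMonoidHom.neg_apply, AddMonoidHom.neg_apply, h.symm z, h.symm z, hxz, hxz₀, e, hxx]
        norm_num)]
    rw [hy, hy₀]
    congr 1 <;> abel

/-- The third root is carried to z₀ by moves that use up a list of level-zero roots with sum z₀ - z,
one at a time. Positivity always supplies an entry that can be used. -/
theorem IsStandardTriple.eq_of_list_sum (h : IsSimplyLaced Φ B)
    (hlev : ∀ x ∈ Φ, HasSmallLevel l₁ l₂ x ∨ HasSmallLevel l₁ l₂ (-x))
    (hψ : IsMoveInvariant Φ B l₁ l₂ ψ) {x₀ y₀ z₀ : V} (t₀ : IsStandardTriple Φ l₁ l₂ x₀ y₀ z₀)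
    (n : ℕ) (l : List V) (hl : l.length = n) (hmem : ∀ δ ∈ l, δ ∈ Φ ∧ l₁ δ = 0 ∧ l₂ δ = 0)
    {x y z : V} (t : IsStandardTriple Φ l₁ l₂ x y z) (hz : z₀ - z = l.sum) :
    ψ x y z = ψ x₀ y₀ z₀ := by
  classical
  induction n generalizing l x y z with
  | zero =>
    rw [List.length_eq_zero_iff] at hl
    rw [hl, List.sum_nil, sub_eq_zero] at hz
    subst hz
    exact t.eq_of_eq h hlev hψ t₀
  | succ n ih =>
    by_cases hne : z = z₀
    · subst hne
      exact t.eq_of_eq h hlev hψ t₀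
    -- Distinct roots have product at most 1, while B(z, z) = 2.
    have hneg : B z (l.sum) < 0 := by
      have := h.self _ t.mem₃
      rw [← hz, map_sub]
      rcases h.cases z t.mem₃ z₀ t₀.mem₃ with e | e | e | e | e
      · exact absurd e hne
      · rw [eq_neg_iff_add_eq_zero, add_comm, ← eq_neg_iff_add_eq_zero] at e
        rw [e, map_neg]; linarith
      all_goals linarith
    obtain ⟨δ, hδl, hδ⟩ : ∃ δ ∈ l, B z δ < 0 := by
      by_contra! hcon
      rw [map_list_sum] at hneg
      exact hneg.not_ge (List.sum_nonneg (by simpa using hcon))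
    obtain ⟨hδΦ, hδ₁, hδ₂⟩ := hmem δ hδl
    have hcases : ∀ w ∈ Φ, (l₁ w ≠ 0 ∨ l₂ w ≠ 0) → B w δ = -1 ∨ B w δ = 0 ∨ B w δ = 1 := by
      intro w hw hw'
      rcases h.cases w hw δ hδΦ with e | e | e
      · rw [e, hδ₁, hδ₂] at hw'; simp at hw'
      · rw [e, map_neg, map_neg, hδ₁, hδ₂] at hw'; simp at hw'
      · exact e
    have tt := t.isTriple
    have hzδ : B z δ = -1 := by
      rcases hcases z t.mem₃ tt.level₃ with e | e | e
      · exact e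
      all_goals linarith
    -- Since x + y + z = 0 and B(z, δ) = -1. Both terms lie in {-1, 0, 1}, so one of them is 1, and
    -- δ can be taken from that root.
    have hsum : B x δ + B y δ = 1 := by
      have : B (x + y + z) δ = 0 := by rw [t.sum]; simp
      simp only [map_add, AddMonoidHom.add_apply] at this
      linarith
    have hz' : z₀ - (z + δ) = (l.erase δ).sum := by
      have := (List.perm_cons_erase hδl).sum_eq
      rw [List.sum_cons, ← hz] at this
      rw [← sub_sub, this]; abel
    have hlen : (l.erase δ).length = n := by rw [List.length_erase_of_mem hδl, hl]; rfl
    have hmem' : ∀ δ' ∈ l.erase δ, δ' ∈ Φ ∧ l₁ δ' = 0 ∧ l₂ δ' = 0 :=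
      fun δ' hδ' => hmem δ' (List.mem_of_mem_erase hδ')
    have hzΦ := h.add_mem _ t.mem₃ _ hδΦ hzδ
    have hz₁ : l₁ (z + δ) = -1 := by rw [map_add, hδ₁, t.level₃₁, add_zero]
    have hz₂ : l₂ (z + δ) = -1 := by rw [map_add, hδ₂, t.level₃₂, add_zero]
    have hor : B x δ = 1 ∨ B y δ = 1 := by
      rcases hcases x t.mem₁ tt.level₁ with e | e | e
      · rcases hcases y t.mem₂ tt.level₂ with e' | e' | e' <;> linarith
      · right; linarith
      · exact Or.inl e
    rcases hor with e | e
    · have t' : IsStandardTriple Φ l₁ l₂ (x - δ) y (z + δ) :=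
        ⟨h.sub_mem t.mem₁ hδΦ e, t.mem₂, hzΦ, by rw [← t.sum]; abel,
          by rw [map_sub, hδ₁, t.level₁₁, sub_zero], by rw [map_sub, hδ₂, t.level₁₂, sub_zero],
          t.level₂₁, t.level₂₂, hz₁, hz₂⟩
      rw [← ih _ hlen hmem' t' hz', hψ.rotate _ _ _ t'.isTriple.rotate.rotate,
        hψ.rotate _ _ _ tt.rotate.rotate]
      exact (hψ.move _ _ _ tt.rotate.rotate _ hδΦ hδ₁ hδ₂ hzδ e).symm
    · have t' : IsStandardTriple Φ l₁ l₂ x (y - δ) (z + δ) :=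
        ⟨t.mem₁, h.sub_mem t.mem₂ hδΦ e, hzΦ, by rw [← t.sum]; abel,
          t.level₁₁, t.level₁₂, by rw [map_sub, hδ₁, t.level₂₁, sub_zero],
          by rw [map_sub, hδ₂, t.level₂₂, sub_zero], hz₁, hz₂⟩
      rw [← ih _ hlen hmem' t' hz', ← hψ.rotate _ _ _ t'.isTriple, ← hψ.rotate _ _ _ tt,
        ← hψ.swap _ _ _ t'.isTriple.rotate, ← hψ.swap _ _ _ tt.rotate]
      exact (hψ.move _ _ _ tt.rotate.swap _ hδΦ hδ₁ hδ₂ hzδ e).symm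

theorem IsTriple.isStandardTriple_or_of_small {x y z : V} (t : IsTriple Φ l₁ l₂ x y z)
    (hx : HasSmallLevel l₁ l₂ x) (hy : HasSmallLevel l₁ l₂ y) (hz : HasSmallLevel l₁ l₂ (-z)) :
    IsStandardTriple Φ l₁ l₂ x y z ∨ IsStandardTriple Φ l₁ l₂ y x z := by
  have s₁ : l₁ x + l₁ y + l₁ z = 0 := by rw [← map_add, ← map_add, t.sum, map_zero]
  have s₂ : l₂ x + l₂ y + l₂ z = 0 := by rw [← map_add, ← map_add, t.sum, map_zero]
  have hx0 := t.level₁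
  have hy0 := t.level₂
  have hz0 := t.level₃
  have hs' : y + x + z = 0 := by rw [← t.sum]; abel
  simp only [HasSmallLevel, map_neg] at hx hy hz
  rcases hx with ⟨a, b⟩ | ⟨a, b⟩ | ⟨a, b⟩ | ⟨a, b⟩
  · simp [a, b] at hx0
  · rcases hy with ⟨c, d⟩ | ⟨c, d⟩ | ⟨c, d⟩ | ⟨c, d⟩
    · simp [c, d] at hy0
    · rcases hz with hz | hz | hz | hz <;> linarith [hz.1]
    · exact Or.inl ⟨t.mem₁, t.mem₂, t.mem₃, t.sum, a, b, c, d, by linarith, by linarith⟩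
    · rcases hz with hz | hz | hz | hz <;> linarith [hz.1]
  · rcases hy with ⟨c, d⟩ | ⟨c, d⟩ | ⟨c, d⟩ | ⟨c, d⟩
    · simp [c, d] at hy0
    · exact Or.inr ⟨t.mem₂, t.mem₁, t.mem₃, hs', c, d, a, b, by linarith, by linarith⟩
    · rcases hz with hz | hz | hz | hz <;> linarith [hz.2]
    · rcases hz with hz | hz | hz | hz <;> linarith [hz.2]
  · rcases hy with ⟨c, d⟩ | ⟨c, d⟩ | ⟨c, d⟩ | ⟨c, d⟩
    · simp [c, d] at hy0
    · rcases hz with hz | hz | hz | hz <;> linarith [hz.1]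
    · rcases hz with hz | hz | hz | hz <;> linarith [hz.2]
    · rcases hz with hz | hz | hz | hz <;> linarith [hz.1]

/-- Three roots of nonzero small level cannot have sum zero. So, after a permutation and possibly a
change of sign, two are small and the third is minus a small one; the function does not notice
either change. -/
theorem IsTriple.exists_isStandardTriple (h : IsSimplyLaced Φ B)
    (hlev : ∀ x ∈ Φ, HasSmallLevel l₁ l₂ x ∨ HasSmallLevel l₁ l₂ (-x))
    (hψ : IsMoveInvariant Φ B l₁ l₂ ψ) {x y z : V} (t : IsTriple Φ l₁ l₂ x y z) :
    ∃ x' y' z', IsStandardTriple Φ l₁ l₂ x' y' z' ∧ ψ x y z = ψ x' y' z' := by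
  have key : ∀ {x y z : V}, IsTriple Φ l₁ l₂ x y z → HasSmallLevel l₁ l₂ x →
      HasSmallLevel l₁ l₂ y → HasSmallLevel l₁ l₂ (-z) →
      ∃ x' y' z', IsStandardTriple Φ l₁ l₂ x' y' z' ∧ ψ x y z = ψ x' y' z' := by
    intro x y z t hx hy hz
    rcases t.isStandardTriple_or_of_small hx hy hz with s | s
    · exact ⟨_, _, _, s, rfl⟩
    · exact ⟨_, _, _, s, (hψ.swap _ _ _ t).symm⟩
  have hsame : ∀ {x y z : V}, IsTriple Φ l₁ l₂ x y z → HasSmallLevel l₁ l₂ x →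
      HasSmallLevel l₁ l₂ y → HasSmallLevel l₁ l₂ z → False := by
    intro x y z t hx hy hz
    have s₁ : l₁ x + l₁ y + l₁ z = 0 := by rw [← map_add, ← map_add, t.sum, map_zero]
    have s₂ : l₂ x + l₂ y + l₂ z = 0 := by rw [← map_add, ← map_add, t.sum, map_zero]
    have hnn : ∀ w, HasSmallLevel l₁ l₂ w → 0 ≤ l₁ w ∧ 0 ≤ l₂ w := by
      rintro w (⟨a, b⟩ | ⟨a, b⟩ | ⟨a, b⟩ | ⟨a, b⟩) <;> rw [a, b] <;> norm_num
    have hx' := hnn x hx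
    have hy' := hnn y hy
    have hz' := hnn z hz
    rcases t.level₁ with e | e
    · exact e (by linarith)
    · exact e (by linarith)
  have hr₁ := hψ.rotate _ _ _ t
  have hr₂ := hψ.rotate _ _ _ t.rotate
  have tn := t.neg h
  have hn := hψ.neg _ _ _ t
  have hn₁ := hψ.rotate _ _ _ tn
  have hn₂ := hψ.rotate _ _ _ tn.rotate
  rcases hlev x t.mem₁ with hx | hx <;> rcases hlev y t.mem₂ with hy | hy <;>
  rcases hlev z t.mem₃ with hz | hz
  · exact (hsame t hx hy hz).elim
  · exact key t hx hy hz
  · rw [← hr₁, ← hr₂]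
    exact key t.rotate.rotate hz hx hy
  · rw [← hn, ← hn₁]
    exact key tn.rotate hy hz (by rwa [neg_neg])
  · rw [← hr₁]
    exact key t.rotate hy hz hx
  · rw [← hn, ← hn₁, ← hn₂]
    exact key tn.rotate.rotate hz hx (by rwa [neg_neg])
  · rw [← hn]
    exact key tn hx hy (by rwa [neg_neg])
  · exact (hsame tn hx hy hz).elim

/-- A function on triples that is constant along moves is constant. -/
theorem IsMoveInvariant.exists_const (h : IsSimplyLaced Φ B)
    (hlev : ∀ x ∈ Φ, HasSmallLevel l₁ l₂ x ∨ HasSmallLevel l₁ l₂ (-x))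
    (hcl : ∀ x ∈ Φ, ∀ y ∈ Φ, l₁ x = l₁ y → l₂ x = l₂ y →
      x - y ∈ AddSubgroup.closure {δ | δ ∈ Φ ∧ l₁ δ = 0 ∧ l₂ δ = 0})
    (hψ : IsMoveInvariant Φ B l₁ l₂ ψ) : ∃ C, ∀ x y z, IsTriple Φ l₁ l₂ x y z → ψ x y z = C := by
  by_cases hex : ∃ x₀ y₀ z₀, IsTriple Φ l₁ l₂ x₀ y₀ z₀
  · obtain ⟨x₀, y₀, z₀, t₀⟩ := hex
    refine ⟨ψ x₀ y₀ z₀, fun x y z t => ?_⟩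
    obtain ⟨x', y', z', s, e⟩ := t.exists_isStandardTriple h hlev hψ
    obtain ⟨x₀', y₀', z₀', s₀, e₀⟩ := t₀.exists_isStandardTriple h hlev hψ
    have hmem := hcl _ s₀.mem₃ _ s.mem₃
      (by rw [s₀.level₃₁, s.level₃₁]) (by rw [s₀.level₃₂, s.level₃₂])
    rw [← AddSubgroup.mem_toAddSubmonoid, AddSubgroup.closure_toAddSubmonoid] at hmem
    obtain ⟨l, hl, hsum⟩ := AddSubmonoid.exists_list_of_mem_closure hmem
    rw [e, e₀]
    refine IsStandardTriple.eq_of_list_sum h hlev hψ s₀ _ l rfl (fun δ hδ => ?_) s hsum.symm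
    rcases hl δ hδ with hd | hd
    · exact hd
    · rw [Set.mem_neg] at hd
      exact ⟨by simpa using h.neg_mem _ hd.1, by simpa using hd.2.1, by simpa using hd.2.2⟩
  · exact ⟨0, fun x y z t => (hex ⟨x, y, z, t⟩).elim⟩

end

/-! ### At most two simple roots outside Γ: types D and E₆ -/

section TypeD

variable {m : ℕ} {Φ : Set V} {B : V →+ V →+ ℝ} {α : Fin (m + 3) → V} {c : Fin (m + 3) → V →+ ℝ}
  {Γ : Set (Fin (m + 3))} {lam g : V →+ ℂ} {K : ℂ} (h : IsSimplyLaced Φ B) (hb : IsBased Φ α c)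
  (hD : ∀ i j, B (α i) (α j) = CartanMatrix.D (m + 3) i j)

include h hb hD

/-- The sum of the simple roots from the node `m - t` to the trivalent node `m` is a root. -/
theorem exists_chain_root (t : ℕ) (ht : t ≤ m) :
    ∃ r ∈ Φ, (∀ j, c j r = if m ≤ (j : ℕ) + t ∧ (j : ℕ) ≤ m then 1 else 0) ∧
      (∀ j : Fin (m + 3), (j : ℕ) + t < m → B r (α j) = if (j : ℕ) + t + 1 = m then -1 else 0) ∧
      (∀ j : Fin (m + 3), m < (j : ℕ) → B r (α j) = -1) := by
  induction t with
  | zero =>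
    refine ⟨α ⟨m, by omega⟩, hb.mem _, fun j => ?_, fun j hj => ?_, fun j hj => ?_⟩
    · by_cases hj : j = ⟨m, by omega⟩
      · rw [hj, hb.coord_self, if_pos ⟨by simp, by simp⟩]
      · rw [hb.coord_ne _ _ hj, if_neg]
        rintro ⟨h₁, h₂⟩
        exact hj (Fin.ext (by simp at *; omega))
    · rw [hD]
      simp only [CartanMatrix.D, Matrix.of_apply, Fin.ext_iff]
      split_ifs <;> first | omega | simp
    · have := j.2
      rw [hD]
      simp only [CartanMatrix.D, Matrix.of_apply, Fin.ext_iff, true_and]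
      split_ifs <;> first | omega | simp
  | succ t ih =>
    obtain ⟨r, hr, h₁, h₂, h₃⟩ := ih (by omega)
    have hadj := h₂ ⟨m - (t + 1), by omega⟩ (by simp; omega)
    rw [if_pos (by simp; omega)] at hadj
    refine ⟨r + α ⟨m - (t + 1), by omega⟩, h.add_mem _ hr _ (hb.mem _) hadj, fun j => ?_,
      fun j hj => ?_, fun j hj => ?_⟩
    · rw [map_add, h₁]
      by_cases hj : j = ⟨m - (t + 1), by omega⟩
      · rw [hj, hb.coord_self]
        simp only
        split_ifs <;> first | omega | simp
      · rw [hb.coord_ne _ _ hj]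
        simp only [Fin.ext_iff] at hj
        split_ifs <;> first | omega | simp
    · rw [map_add, AddMonoidHom.add_apply, h₂ _ (by omega), hD]
      simp only [CartanMatrix.D, Matrix.of_apply, Fin.ext_iff]
      split_ifs <;> first | omega | simp
    · rw [map_add, AddMonoidHom.add_apply, h₃ _ hj, hD]
      have := j.2
      simp only [CartanMatrix.D, Matrix.of_apply, Fin.ext_iff]
      split_ifs <;> first | omega | simp

/-- The segment from node i to the trivalent node m acts as a single root joined to node i - 1 and
to the two prongs. -/
theorem exists_isD4_of_typeD (i : ℕ) (hi : 1 ≤ i) (him : i ≤ m) :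
    ∃ r, IsD4 Φ B r (α ⟨i - 1, by omega⟩) (α ⟨m + 1, by omega⟩) (α ⟨m + 2, by omega⟩) ∧
      ∀ j, c j r = if i ≤ (j : ℕ) ∧ (j : ℕ) ≤ m then 1 else 0 := by
  obtain ⟨r, hr, h₁, h₂, h₃⟩ := exists_chain_root h hb hD (m - i) (by omega)
  have hadj := h₂ ⟨i - 1, by omega⟩ (by simp; omega)
  rw [if_pos (by simp; omega)] at hadj
  refine ⟨r, ⟨hr, hb.mem _, hb.mem _, hb.mem _, hadj, h₃ _ (by simp), h₃ _ (by simp), ?_, ?_, ?_⟩,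
    fun j => ?_⟩
  · rw [hD]
    simp only [CartanMatrix.D, Matrix.of_apply, Fin.ext_iff]
    split_ifs <;> first | omega | simp
  · rw [hD]
    simp only [CartanMatrix.D, Matrix.of_apply, Fin.ext_iff]
    split_ifs <;> first | omega | simp
  · rw [hD]
    simp only [CartanMatrix.D, Matrix.of_apply, Fin.ext_iff]
    split_ifs <;> first | omega | simp
  · rw [h₁]
    split_ifs <;> first | omega | simp

/-- Contracting segments puts every node from 1 to m in Γ. Only the three ends can be outside, and
the D₄ subsystem having these ends as leaves prevents all three from being so. -/
theorem exists_pair_of_typeD (hm : 1 ≤ m) (hK : K ≠ 0) (hC : IsGoodPair Φ lam g K)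
    (ha : IsAdapted Φ α c Γ lam g) : ∃ j k, j ≠ k ∧ ∀ i ∉ Γ, i = j ∨ i = k := by
  have hint : ∀ i : Fin (m + 3), 1 ≤ (i : ℕ) → (i : ℕ) ≤ m → i ∈ Γ := by
    intro i hi him
    obtain ⟨r, d, hr⟩ := exists_isD4_of_typeD h hb hD i hi him
    refine d.mem_of_pos h hK hC ha (i := i) ?_ (hb.coord_nonneg _ _) (hb.coord_nonneg _ _)
      (hb.coord_nonneg _ _)
    rw [hr, if_pos ⟨le_rfl, him⟩]
    norm_num
  have hends : ∀ i : Fin (m + 3), i ∉ Γ →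
      i = ⟨0, by omega⟩ ∨ i = ⟨m + 1, by omega⟩ ∨ i = ⟨m + 2, by omega⟩ := by
    intro i hi
    have h₁ := i.2
    simp only [Fin.ext_iff]
    by_contra! hcon
    exact hi (hint i (by omega) (by omega))
  obtain ⟨r, d, hr⟩ := exists_isD4_of_typeD h hb hD 1 le_rfl hm
  have hne : ∀ i j : Fin (m + 3), (i : ℕ) ≠ j → c i (α j) = 0 :=
    fun i j hij => hb.coord_ne _ _ (fun e => hij (by rw [e]))
  have hself : ∀ i, c i (α i) ≠ 0 := fun i => by rw [hb.coord_self]; norm_num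
  rcases d.mem_or_mem_or_mem h hK hC ha (i := ⟨0, by omega⟩) (j := ⟨m + 1, by omega⟩)
    (k := ⟨m + 2, by omega⟩) ⟨by rw [hr]; simp, by rw [hr]; simp, by rw [hr]; simp⟩
    ⟨hself _, hne _ _ (by simp), hne _ _ (by simp)⟩
    ⟨hne _ _ (by simp), hself _, hne _ _ (by simp)⟩
    ⟨hne _ _ (by simp), hne _ _ (by simp), hself _⟩ with hΓ | hΓ | hΓ
  · refine ⟨⟨m + 1, by omega⟩, ⟨m + 2, by omega⟩, by simp, fun i hi => ?_⟩
    rcases hends i hi with rfl | e | e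
    exacts [absurd hΓ hi, Or.inl e, Or.inr e]
  · refine ⟨⟨0, by omega⟩, ⟨m + 2, by omega⟩, by simp, fun i hi => ?_⟩
    rcases hends i hi with e | rfl | e
    exacts [Or.inl e, absurd hΓ hi, Or.inr e]
  · refine ⟨⟨0, by omega⟩, ⟨m + 1, by omega⟩, by simp, fun i hi => ?_⟩
    rcases hends i hi with e | e | rfl
    exacts [Or.inl e, Or.inr e, absurd hΓ hi]

end TypeD

/-- The chain is 0-2-3-4-5, with 1 attached to 3. Each of the nodes 1, 2, 3, 4 occurs in the center
of a D₄ subsystem whose leaves are nonnegative combinations of simple roots, so only 0 and 5 can lie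
outside Γ. -/
theorem exists_pair_of_typeE₆ {Φ : Set V} {B : V →+ V →+ ℝ} {α : Fin 6 → V} {c : Fin 6 → V →+ ℝ}
    {Γ : Set (Fin 6)} {lam g : V →+ ℂ} {K : ℂ} (h : IsSimplyLaced Φ B) (hb : IsBased Φ α c)
    (hE : ∀ i j, B (α i) (α j) = CartanMatrix.E₆ i j) (hK : K ≠ 0) (hC : IsGoodPair Φ lam g K)
    (ha : IsAdapted Φ α c Γ lam g) : ∃ j k, j ≠ k ∧ ∀ i ∉ Γ, i = j ∨ i = k := by
  have hB : ∀ i j, ∀ z : ℤ, CartanMatrix.E₆ i j = z → B (α i) (α j) = z :=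
    fun i j z hz => by rw [hE, hz]
  have b01 := hB 0 1 0 (by decide)
  have b02 := hB 0 2 (-1) (by decide)
  have b03 := hB 0 3 0 (by decide)
  have b04 := hB 0 4 0 (by decide)
  have b05 := hB 0 5 0 (by decide)
  have b12 := hB 1 2 0 (by decide)
  have b13 := hB 1 3 (-1) (by decide)
  have b14 := hB 1 4 0 (by decide)
  have b15 := hB 1 5 0 (by decide)
  have b23 := hB 2 3 (-1) (by decide)
  have b24 := hB 2 4 0 (by decide)
  have b25 := hB 2 5 0 (by decide)
  have b34 := hB 3 4 (-1) (by decide)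
  have b35 := hB 3 5 0 (by decide)
  have b45 := hB 4 5 (-1) (by decide)
  have bs := fun i => h.self _ (hb.mem i)
  push_cast at *
  clear hE hB
  have s := fun i j (_ : j < i) => h.symm (α i) (α j)
  have m23 : α 2 + α 3 ∈ Φ := h.add_mem _ (hb.mem _) _ (hb.mem _) b23
  have m34 : α 3 + α 4 ∈ Φ := h.add_mem _ (hb.mem _) _ (hb.mem _) b34
  have m234 : α 2 + α 3 + α 4 ∈ Φ := h.add_mem _ m23 _ (hb.mem _) (by simp [*])
  have m0234 : α 2 + α 3 + α 4 + α 0 ∈ Φ := h.add_mem _ m234 _ (hb.mem _) (by simp [*])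
  have m02345 : α 2 + α 3 + α 4 + α 0 + α 5 ∈ Φ := h.add_mem _ m0234 _ (hb.mem _) (by simp [*])
  have d3 : IsD4 Φ B (α 3) (α 1) (α 2) (α 4) := by
    refine ⟨hb.mem _, hb.mem _, hb.mem _, hb.mem _, ?_, ?_, ?_, ?_, ?_, ?_⟩ <;> simp [*]
  have d2 : IsD4 Φ B (α 2 + α 3) (α 0) (α 1) (α 4) := by
    refine ⟨m23, hb.mem _, hb.mem _, hb.mem _, ?_, ?_, ?_, ?_, ?_, ?_⟩ <;> simp [*]
  have d4 : IsD4 Φ B (α 3 + α 4) (α 1) (α 2) (α 5) := by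
    refine ⟨m34, hb.mem _, hb.mem _, hb.mem _, ?_, ?_, ?_, ?_, ?_, ?_⟩ <;> simp [*]
  -- Node 1 has one neighbor only, so the other two leaves are sums of simple roots along the chain
  -- through node 3.
  have d1 : IsD4 Φ B (α 1) (α 3) (α 2 + α 3 + α 4) (α 2 + α 3 + α 4 + α 0 + α 5) := by
    refine ⟨hb.mem _, hb.mem _, m234, m02345, ?_, ?_, ?_, ?_, ?_, ?_⟩ <;> simp [*] <;> norm_num
  have hself := hb.coord_self
  have hne := hb.coord_ne
  have g3 : (3 : Fin 6) ∈ Γ := d3.mem_of_pos h hK hC ha (i := 3) (by simp [hself])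
    (hb.coord_nonneg _ _) (hb.coord_nonneg _ _) (hb.coord_nonneg _ _)
  have g2 : (2 : Fin 6) ∈ Γ := d2.mem_of_pos h hK hC ha (i := 2)
    (by rw [map_add, hself, hne _ _ (by decide)]; norm_num)
    (hb.coord_nonneg _ _) (hb.coord_nonneg _ _) (hb.coord_nonneg _ _)
  have g4 : (4 : Fin 6) ∈ Γ := d4.mem_of_pos h hK hC ha (i := 4)
    (by rw [map_add, hself, hne _ _ (by decide)]; norm_num)
    (hb.coord_nonneg _ _) (hb.coord_nonneg _ _) (hb.coord_nonneg _ _)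
  have g1 : (1 : Fin 6) ∈ Γ := d1.mem_of_pos h hK hC ha (i := 1) (by simp [hself])
    (hb.coord_nonneg _ _)
    (by
      simp only [map_add]
      linarith [hb.coord_nonneg 1 2, hb.coord_nonneg 1 3, hb.coord_nonneg 1 4])
    (by
      simp only [map_add]
      linarith [hb.coord_nonneg 1 2, hb.coord_nonneg 1 3, hb.coord_nonneg 1 4,
        hb.coord_nonneg 1 0, hb.coord_nonneg 1 5])
  refine ⟨0, 5, by decide, fun i hi => ?_⟩
  fin_cases i
  exacts [Or.inl rfl, absurd g1 hi, absurd g2 hi, absurd g3 hi, absurd g4 hi, Or.inr rfl]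

/-- On a good orbit, every root has levels at most one with respect to two generators that
generate the complement of `Γ`, and any even symmetric function on triples that is constant
along moves is constant. -/
theorem exists_const_of_isGoodPair {ι : Type*} [Fintype ι] {Φ : Set V} {B : V →+ V →+ ℝ}
    {α : ι → V} {c : ι → V →+ ℝ} {Γ : Set ι} {lam g : V →+ ℂ} {K : ℂ} (h : IsSimplyLaced Φ B)
    (hb : IsBased Φ α c) (hK : K ≠ 0) (hC : IsGoodPair Φ lam g K)
    (ha : IsAdapted Φ α c Γ lam g) (hjk : ∃ j k, j ≠ k ∧ ∀ i ∉ Γ, i = j ∨ i = k) :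
    ∃ l₁ l₂ : V →+ ℝ, (∀ x, (l₁ x = 0 ∧ l₂ x = 0) ↔ ∀ i ∉ Γ, c i x = 0) ∧
      ∀ ψ : V → V → V → ℂ, IsMoveInvariant Φ B l₁ l₂ ψ →
        ∃ C, ∀ x y z, IsTriple Φ l₁ l₂ x y z → ψ x y z = C := by
  classical
  obtain ⟨j, k, hne, hjk⟩ := hjk
  -- Coordinates at nodes of Γ are replaced by zero, which covers the case where j or k itself lies
  -- in Γ.
  let l : ι → V →+ ℝ := fun i => if i ∈ Γ then 0 else c i
  have hl : ∀ i x, i ∉ Γ → l i x = c i x := fun i x hi => by simp [l, hi]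
  have hl' : ∀ i x, i ∈ Γ → l i x = 0 := fun i x hi => by simp [l, hi]
  have hzero : ∀ x, (l j x = 0 ∧ l k x = 0) ↔ ∀ i ∉ Γ, c i x = 0 := by
    intro x
    constructor
    · rintro ⟨h₁, h₂⟩ i hi
      rw [← hl _ _ hi]
      rcases hjk i hi with rfl | rfl <;> assumption
    · intro h'
      have : ∀ i, l i x = 0 := fun i => by
        by_cases hi : i ∈ Γ
        · exact hl' _ _ hi
        · rw [hl _ _ hi, h' i hi]
      exact ⟨this j, this k⟩
  refine ⟨l j, l k, hzero, fun ψ hψ => hψ.exists_const h (fun x hx => ?_) fun x hx y hy h₁ h₂ => ?_⟩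
  · refine hasSmallLevel_or_neg hb hK hC (l₁ := l j) (l₂ := l k) (a := lam (α j)) (b := lam (α k))
      (p := g (α j)) (q := g (α k)) (fun i => ?_) (fun x hx hx' => ?_) hx
    · by_cases hi : i ∈ Γ
      · have := (hzero (α i)).2 fun i' hi' => hb.coord_ne _ _ (fun e => hi' (by rwa [e]))
        exact Or.inl ⟨this.1, this.2, ha.lam_eq_zero _ hi, ha.g_eq_zero _ hi⟩
      · have h0 : ∀ i', i' ≠ i → l i' (α i) = 0 := fun i' hi' => by
          by_cases hm : i' ∈ Γ
          · exact hl' _ _ hm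
          · rw [hl _ _ hm, hb.coord_ne _ _ hi']
        have h1 : l i (α i) = 1 := by rw [hl _ _ hi, hb.coord_self]
        rcases hjk i hi with rfl | rfl
        · exact Or.inr (Or.inl ⟨h1, h0 _ hne.symm, rfl, rfl⟩)
        · exact Or.inr (Or.inr ⟨h0 _ hne, h1, rfl, rfl⟩)
    · have : ¬ ∀ i ∉ Γ, c i x = 0 := fun h' => by
        have := (hzero x).2 h'
        tauto
      push Not at this
      obtain ⟨i, hi, hx'⟩ := this
      exact ha.lam_ne_zero x hx i hi hx'
  · refine AddSubgroup.closure_mono ?_ (hb.sub_mem_closure (Γ := Γ) hx hy fun i hi => ?_)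
    · rintro _ ⟨i, hi, rfl⟩
      exact ⟨hb.mem i, (hzero (α i)).2 fun i' hi' => hb.coord_ne _ _ (fun e => hi' (by rwa [e]))⟩
    · have := (hzero (x - y)).1 ⟨by rw [map_sub, h₁, sub_self], by rw [map_sub, h₂, sub_self]⟩ i hi
      rwa [map_sub, sub_eq_zero] at this

end Combinatorics

/-! ### Contractions of bivectors and trivectors with the Killing form -/

section Contraction

variable {L : Type*} [LieRing L] [LieAlgebra ℂ L]

theorem bivector_induction {p : ⋀[ℂ]^2 L → Prop} (wedge : ∀ X Y, p (wedge₂ X Y))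
    (add : ∀ v w, p v → p w → p (v + w)) (smul : ∀ (c : ℂ) v, p v → p (c • v)) (v : ⋀[ℂ]^2 L) :
    p v := by
  have hv : v ∈ Submodule.span ℂ (Set.range (exteriorPower.ιMulti ℂ 2 (M := L))) := by
    rw [exteriorPower.ιMulti_span]; trivial
  induction hv using Submodule.span_induction with
  | mem x hx =>
    obtain ⟨w, rfl⟩ := hx
    rw [show w = ![w 0, w 1] by funext i; fin_cases i <;> rfl]
    exact wedge _ _
  | zero => simpa using smul 0 _ (wedge 0 0)
  | add x y _ _ hx hy => exact add _ _ hx hy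
  | smul c x _ hx => exact smul _ _ hx

theorem trivector_induction {p : ⋀[ℂ]^3 L → Prop} (wedge : ∀ X Y Z, p (wedge₃ X Y Z))
    (add : ∀ v w, p v → p w → p (v + w)) (smul : ∀ (c : ℂ) v, p v → p (c • v)) (v : ⋀[ℂ]^3 L) :
    p v := by
  have hv : v ∈ Submodule.span ℂ (Set.range (exteriorPower.ιMulti ℂ 3 (M := L))) := by
    rw [exteriorPower.ιMulti_span]; trivial
  induction hv using Submodule.span_induction with
  | mem x hx =>
    obtain ⟨w, rfl⟩ := hx
    rw [show w = ![w 0, w 1, w 2] by funext i; fin_cases i <;> rfl]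
    exact wedge _ _ _
  | zero => simpa using smul 0 _ (wedge 0 0 0)
  | add x y _ _ hx hy => exact add _ _ hx hy
  | smul c x _ hx => exact smul _ _ hx

theorem adExt_wedge₂ (x X Y : L) :
    adExt 2 x (wedge₂ X Y) = wedge₂ ⁅x, X⁆ Y + wedge₂ X ⁅x, Y⁆ := by
  rw [wedge₂, adExt_ιMulti, Fin.sum_univ_two, wedge₂, wedge₂]
  congr 2 <;> funext i <;> fin_cases i <;> rfl

theorem adExt_wedge₃ (x X Y Z : L) :
    adExt 3 x (wedge₃ X Y Z) = wedge₃ ⁅x, X⁆ Y Z + wedge₃ X ⁅x, Y⁆ Z + wedge₃ X Y ⁅x, Z⁆ := by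
  rw [wedge₃, adExt_ιMulti, Fin.sum_univ_three, update_vec₃_zero, update_vec₃_one,
    update_vec₃_two]
  rfl

theorem map_wedge₃ (f : L →ₗ[ℂ] L) (X Y Z : L) :
    exteriorPower.map 3 f (wedge₃ X Y Z) = wedge₃ (f X) (f Y) (f Z) := by
  rw [wedge₃, exteriorPower.map_apply_ιMulti, wedge₃]
  congr 1; funext i; fin_cases i <;> rfl

theorem killingForm_lie_left (x a y : L) :
    killingForm ℂ L ⁅x, a⁆ y = -killingForm ℂ L a ⁅x, y⁆ := by
  rw [← lie_skew, map_neg, LinearMap.neg_apply, LieModule.traceForm_apply_lie_apply]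

/-- The contraction of a trivector with `a, b, c` under the Killing form. -/
def tri (a b c : L) : ⋀[ℂ]^3 L →ₗ[ℂ] ℂ :=
  exteriorPower.alternatingMapToDual ℂ L 3
    ![killingForm ℂ L a, killingForm ℂ L b, killingForm ℂ L c]

theorem tri_wedge₃ (a b c X Y Z : L) :
    tri a b c (wedge₃ X Y Z) =
      killingForm ℂ L a X *
          (killingForm ℂ L b Y * killingForm ℂ L c Z - killingForm ℂ L b Z * killingForm ℂ L c Y) -
        killingForm ℂ L a Y *
          (killingForm ℂ L b X * killingForm ℂ L c Z - killingForm ℂ L b Z * killingForm ℂ L c X) +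
        killingForm ℂ L a Z *
          (killingForm ℂ L b X * killingForm ℂ L c Y -
            killingForm ℂ L b Y * killingForm ℂ L c X) := by
  rw [tri, wedge₃, exteriorPower.alternatingMapToDual_apply_ιMulti, Matrix.det_fin_three]
  simp only [Matrix.of_apply, Matrix.cons_val]
  ring

theorem tri_add_left (a a' b c : L) (w : ⋀[ℂ]^3 L) :
    tri (a + a') b c w = tri a b c w + tri a' b c w := by
  induction w using trivector_induction with
  | wedge X Y Z => simp only [tri_wedge₃, map_add, LinearMap.add_apply]; ring
  | add v w hv hw => rw [map_add, map_add, map_add, hv, hw]; ring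
  | smul r v hv => rw [map_smul, map_smul, map_smul, hv, smul_add]

theorem tri_smul_left (r : ℂ) (a b c : L) (w : ⋀[ℂ]^3 L) :
    tri (r • a) b c w = r * tri a b c w := by
  induction w using trivector_induction with
  | wedge X Y Z =>
    simp only [tri_wedge₃, map_smul, LinearMap.smul_apply, smul_eq_mul]; ring
  | add v w hv hw => rw [map_add, map_add, hv, hw]; ring
  | smul s v hv => rw [map_smul, map_smul, hv, smul_eq_mul, smul_eq_mul]; ring

theorem tri_rotate (a b c : L) (w : ⋀[ℂ]^3 L) : tri b c a w = tri a b c w := by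
  induction w using trivector_induction with
  | wedge X Y Z => simp only [tri_wedge₃]; ring
  | add v w hv hw => rw [map_add, map_add, hv, hw]
  | smul s v hv => rw [map_smul, map_smul, hv]

theorem tri_swap (a b c : L) (w : ⋀[ℂ]^3 L) : tri b a c w = -tri a b c w := by
  induction w using trivector_induction with
  | wedge X Y Z => simp only [tri_wedge₃]; ring
  | add v w hv hw => rw [map_add, map_add, hv, hw]; ring
  | smul s v hv => rw [map_smul, map_smul, hv, smul_neg]

theorem tri_smul_mid (r : ℂ) (a b c : L) (w : ⋀[ℂ]^3 L) :
    tri a (r • b) c w = r * tri a b c w := by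
  rw [← tri_rotate, tri_smul_left, tri_rotate]

theorem tri_smul_right (r : ℂ) (a b c : L) (w : ⋀[ℂ]^3 L) :
    tri a b (r • c) w = r * tri a b c w := by
  rw [← tri_rotate, ← tri_rotate, tri_smul_left, tri_rotate, tri_rotate]

theorem tri_adExt (x a b c : L) (w : ⋀[ℂ]^3 L) :
    tri a b c (adExt 3 x w) = -(tri ⁅x, a⁆ b c w + tri a ⁅x, b⁆ c w + tri a b ⁅x, c⁆ w) := by
  induction w using trivector_induction with
  | wedge X Y Z =>
    simp only [adExt_wedge₃, map_add, tri_wedge₃, killingForm_lie_left]; ring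
  | add v w hv hw => simp only [map_add, hv, hw]; ring
  | smul s v hv => simp only [map_smul, hv, smul_eq_mul]; ring

/-- Stated through transposes so as to apply both to the projection onto 𝔪 and to Lie algebra
automorphisms. -/
theorem tri_map (f : L →ₗ[ℂ] L) {a b c a' b' c' : L}
    (ha : ∀ x, killingForm ℂ L a (f x) = killingForm ℂ L a' x)
    (hb : ∀ x, killingForm ℂ L b (f x) = killingForm ℂ L b' x)
    (hc : ∀ x, killingForm ℂ L c (f x) = killingForm ℂ L c' x) (w : ⋀[ℂ]^3 L) :
    tri a b c (exteriorPower.map 3 f w) = tri a' b' c' w := by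
  induction w using trivector_induction with
  | wedge X Y Z => simp only [map_wedge₃, tri_wedge₃, ha, hb, hc]
  | add v w hv hw => simp only [map_add, hv, hw]
  | smul s v hv => simp only [map_smul, hv]

/-- For fixed `X, Y`, the endomorphism `a ↦ (a, Y) X - (a, X) Y`, as an alternating map. -/
def sharpAlt : L [⋀^Fin 2]→ₗ[ℂ] (L →ₗ[ℂ] L) where
  toFun v := ((killingForm ℂ L).flip (v 1)).smulRight (v 0) -
    ((killingForm ℂ L).flip (v 0)).smulRight (v 1)
  map_update_add' := by
    intro dec v i x y
    rw [Subsingleton.elim dec (instDecidableEqFin 2)]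
    ext a
    fin_cases i <;> simp [add_smul] <;> abel
  map_update_smul' := by
    intro dec v i c x
    rw [Subsingleton.elim dec (instDecidableEqFin 2)]
    ext a
    fin_cases i <;> simp [smul_sub, mul_smul, smul_comm _ c]
  map_eq_zero_of_eq' := by
    intro v i j h hij
    have h01 : v 0 = v 1 := by
      fin_cases i <;> fin_cases j <;> simp_all
    rw [h01, sub_self]

/-- The endomorphism attached to a bivector by the Killing form. -/
def sharp : ⋀[ℂ]^2 L →ₗ[ℂ] (L →ₗ[ℂ] L) := exteriorPower.alternatingMapLinearEquiv sharpAlt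

theorem sharp_wedge₂ (X Y a : L) :
    sharp (wedge₂ X Y) a = killingForm ℂ L a Y • X - killingForm ℂ L a X • Y := by
  rw [sharp, wedge₂, exteriorPower.alternatingMapLinearEquiv_apply_ιMulti]
  rfl

theorem killingForm_sharp (f : ⋀[ℂ]^2 L) (a b : L) :
    killingForm ℂ L (sharp f a) b = -killingForm ℂ L a (sharp f b) := by
  induction f using bivector_induction with
  | wedge X Y =>
    simp only [sharp_wedge₂, map_sub, map_smul, LinearMap.sub_apply, LinearMap.smul_apply,
      smul_eq_mul, LieModule.traceForm_comm ℂ L L b]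
    ring
  | add v w hv hw => simp only [map_add, LinearMap.add_apply, hv, hw]; ring
  | smul s v hv => simp only [map_smul, LinearMap.smul_apply, hv, smul_neg]

theorem sharp_adExt (x : L) (f : ⋀[ℂ]^2 L) (a : L) :
    sharp (adExt 2 x f) a = ⁅x, sharp f a⁆ - sharp f ⁅x, a⁆ := by
  induction f using bivector_induction with
  | wedge X Y =>
    simp only [adExt_wedge₂, map_add, LinearMap.add_apply, sharp_wedge₂, lie_sub, lie_smul,
      killingForm_lie_left, neg_smul]
    abel
  | add v w hv hw => simp only [map_add, LinearMap.add_apply, hv, hw, lie_add]; abel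
  | smul s v hv => simp only [map_smul, LinearMap.smul_apply, hv, lie_smul, smul_sub]

/-- Bilinearity reduces this to decomposable bivectors. The formula matters because root vectors
will be eigenvectors of the endomorphisms on the right. -/
theorem tri_schouten (f g : ⋀[ℂ]^2 L) (a b c : L) :
    tri a b c (schouten f g) =
      killingForm ℂ L c (⁅sharp f a, sharp g b⁆ + ⁅sharp g a, sharp f b⁆) +
      killingForm ℂ L a (⁅sharp f b, sharp g c⁆ + ⁅sharp g b, sharp f c⁆) +
      killingForm ℂ L b (⁅sharp f c, sharp g a⁆ + ⁅sharp g c, sharp f a⁆) := by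
  induction f using bivector_induction with
  | wedge X₁ X₂ =>
    induction g using bivector_induction with
    | wedge Y₁ Y₂ =>
      simp only [schouten_wedge₂, sharp_wedge₂, map_sub, map_add, tri_wedge₃, lie_sub, sub_lie,
        smul_lie, lie_smul, map_smul, smul_eq_mul, ← lie_skew X₁ Y₁, ← lie_skew X₁ Y₂,
        ← lie_skew X₂ Y₁, ← lie_skew X₂ Y₂, map_neg]
      ring
    | add v w hv hw =>
      simp only [map_add, LinearMap.add_apply, hv, hw, lie_add, add_lie]
      ring
    | smul s v hv =>
      simp only [map_smul, LinearMap.smul_apply, hv, lie_smul, smul_lie, map_add, smul_eq_mul]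
      ring
  | add v w hv hw =>
    simp only [map_add, LinearMap.add_apply, hv, hw, lie_add, add_lie]
    ring
  | smul s v hv =>
    simp only [map_smul, LinearMap.smul_apply, hv, lie_smul, smul_lie, map_add, smul_eq_mul]
    ring

end Contraction

/-! ### The root system of a Lie algebra with symmetric Cartan matrix -/

section RootSystem

open LieAlgebra LieAlgebra.IsKilling LieModule

variable {L : Type*} [LieRing L] [LieAlgebra ℂ L] [FiniteDimensional ℂ L]
  [LieAlgebra.IsSimple ℂ L] {H : LieSubalgebra ℂ L} [H.IsCartanSubalgebra]

/-- The set of roots in the dual of the Cartan subalgebra. -/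
def rootSet (H : LieSubalgebra ℂ L) [H.IsCartanSubalgebra] : Set (Module.Dual ℂ H) :=
  Set.range (rootSystem H).root

theorem root_mem_rootSet (i : H.root) : (rootSystem H).root i ∈ rootSet H := ⟨i, rfl⟩

theorem neg_mem_rootSet {x : Module.Dual ℂ H} (hx : x ∈ rootSet H) : -x ∈ rootSet H :=
  ((rootSystem H).neg_mem_range_root_iff).2 hx

theorem isTypeDOrE₆_symm {b : (rootSystem H).Base} (hb : IsTypeDOrE₆ b) (i j : b.support) :
    b.cartanMatrix i j = b.cartanMatrix j i := by
  rcases hb with ⟨n, -, e, he⟩ | ⟨e, he⟩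
  · rw [he, he, (CartanMatrix.D_isSymm n).apply]
  · rw [he, he, CartanMatrix.E₆_isSymm.apply]

/-- The linear map that sends each simple root to its coroot. -/
def corootMap (b : (rootSystem H).Base) : Module.Dual ℂ H →ₗ[ℂ] H :=
  b.toWeightBasis.constr ℂ fun i => (rootSystem H).coroot i

theorem corootMap_simple (b : (rootSystem H).Base) (i : b.support) :
    corootMap b ((rootSystem H).root i) = (rootSystem H).coroot i := by
  rw [← b.toWeightBasis_apply, corootMap, Module.Basis.constr_basis]

theorem root_coroot_eq_intCast (i j : H.root) :
    (rootSystem H).root i ((rootSystem H).coroot j) = ((rootSystem H).pairingIn ℤ i j : ℂ) := by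
  have h₁ := (rootSystem H).root_coroot_eq_pairing i j
  have h₂ := (rootSystem H).algebraMap_pairingIn ℤ i j
  rw [← h₂] at h₁
  exact h₁

variable {b : (rootSystem H).Base} (hs : ∀ i j : b.support, b.cartanMatrix i j = b.cartanMatrix j i)
include hs

/-- Both sides are bilinear; on the basis of simple roots this is the symmetry of the Cartan matrix.
-/
theorem corootMap_symm (x y : Module.Dual ℂ H) : x (corootMap b y) = y (corootMap b x) := by
  let F : Module.Dual ℂ H →ₗ[ℂ] Module.Dual ℂ H →ₗ[ℂ] ℂ :=
    LinearMap.mk₂ ℂ (fun x y => x (corootMap b y)) (by intros; simp) (by intros; simp)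
      (by intros; simp) (by intros; simp)
  suffices h : F = F.flip by
    exact LinearMap.congr_fun (LinearMap.congr_fun h x) y
  refine b.toWeightBasis.ext fun i => b.toWeightBasis.ext fun j => ?_
  change b.toWeightBasis i (corootMap b (b.toWeightBasis j)) =
    b.toWeightBasis j (corootMap b (b.toWeightBasis i))
  rw [b.toWeightBasis_apply, b.toWeightBasis_apply, corootMap_simple, corootMap_simple,
    root_coroot_eq_intCast, root_coroot_eq_intCast]
  exact_mod_cast hs i j

/-- Induction over simple reflections: the formulas for roots and coroots use transposed pairings,
and `corootMap_symm` makes these equal. -/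
theorem corootMap_root (i : H.root) :
    corootMap b ((rootSystem H).root i) = (rootSystem H).coroot i := by
  induction i using b.induction_reflect with
  | h₀ i hi =>
    have h₁ : (rootSystem H).root ((rootSystem H).reflectionPerm i i) =
        -(rootSystem H).root i := by
      rw [RootPairing.root_reflectionPerm, RootPairing.reflection_apply_self]
    have h₂ : (rootSystem H).coroot ((rootSystem H).reflectionPerm i i) =
        -(rootSystem H).coroot i := by
      rw [RootPairing.coroot_reflectionPerm, RootPairing.coreflection_apply_self]
    rw [h₁, h₂, map_neg, hi]
  | h₁ i hi => exact corootMap_simple b ⟨i, hi⟩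
  | h₂ i j hi hj =>
    have hj' := corootMap_simple b ⟨j, hj⟩
    have hp : (rootSystem H).pairing i j = (rootSystem H).pairing j i := by
      have h := corootMap_symm hs ((rootSystem H).root i) ((rootSystem H).root j)
      rw [hi, hj'] at h
      exact h
    rw [RootPairing.root_reflectionPerm, RootPairing.coroot_reflectionPerm,
      RootPairing.reflection_apply_root, RootPairing.coreflection_apply_coroot, map_sub, map_smul,
      hi, hj', hp]

omit hs in
/-- The invariant form on the dual of the Cartan subalgebra for which all roots have square length
two (its real part, which contains all the information on the lattice of roots). -/
def rootForm (b : (rootSystem H).Base) : Module.Dual ℂ H →+ Module.Dual ℂ H →+ ℝ :=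
  AddMonoidHom.mk' (fun x => AddMonoidHom.mk' (fun y => (x (corootMap b y)).re)
    (by intros; simp)) (by intros; ext; simp)

theorem rootForm_root (i j : H.root) :
    rootForm b ((rootSystem H).root i) ((rootSystem H).root j) =
      ((rootSystem H).pairingIn ℤ i j : ℝ) := by
  change ((rootSystem H).root i (corootMap b ((rootSystem H).root j))).re = _
  rw [corootMap_root hs, root_coroot_eq_intCast, Complex.intCast_re]

theorem isSimplyLaced_rootSet : IsSimplyLaced (rootSet H) (rootForm b) where
  symm x y := congrArg Complex.re (corootMap_symm hs x y)
  self := by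
    rintro _ ⟨i, rfl⟩
    rw [rootForm_root hs]
    simp
  neg_mem _ := neg_mem_rootSet
  cases := by
    rintro _ ⟨i, rfl⟩ _ ⟨j, rfl⟩
    by_cases h₁ : (rootSystem H).root i = (rootSystem H).root j
    · exact Or.inl h₁
    by_cases h₂ : (rootSystem H).root i = -(rootSystem H).root j
    · exact Or.inr (Or.inl h₂)
    -- The possible pairs of integer pairings for nonproportional roots; symmetry leaves only -1, 0
    -- and 1.
    have hmem := (rootSystem H).pairingIn_pairingIn_mem_set_of_isCrystal_of_isRed' i j h₁ h₂
    have hsymm : (rootSystem H).pairingIn ℤ i j = (rootSystem H).pairingIn ℤ j i := by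
      have h := congrArg Complex.re
        (corootMap_symm hs ((rootSystem H).root i) ((rootSystem H).root j))
      rw [corootMap_root hs, corootMap_root hs, root_coroot_eq_intCast,
        root_coroot_eq_intCast, Complex.intCast_re, Complex.intCast_re] at h
      exact_mod_cast h
    rw [← hsymm] at hmem
    rw [rootForm_root hs]
    simp only [Set.mem_insert_iff, Set.mem_singleton_iff, Prod.mk.injEq] at hmem
    have : (rootSystem H).pairingIn ℤ i j = -1 ∨ (rootSystem H).pairingIn ℤ i j = 0 ∨
        (rootSystem H).pairingIn ℤ i j = 1 := by omega
    rcases this with e | e | e <;> rw [e] <;> norm_num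
  add_mem := by
    rintro _ ⟨i, rfl⟩ _ ⟨j, rfl⟩ h
    rw [rootForm_root hs] at h
    have h' : (rootSystem H).pairingIn ℤ i j = -1 := by exact_mod_cast h
    refine (rootSystem H).root_add_root_mem_of_pairingIn_neg (by rw [h']; norm_num) fun e => ?_
    have h₂ := rootForm_root hs i j
    rw [e, map_neg, AddMonoidHom.neg_apply, rootForm_root hs, h'] at h₂
    norm_num at h₂

omit hs

/-- The (real parts of the) coordinates with respect to the base. -/
def baseCoord (b : (rootSystem H).Base) (i : b.support) : Module.Dual ℂ H →+ ℝ :=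
  AddMonoidHom.mk' (fun x => (b.toWeightBasis.repr x i).re) (by intros; simp)

theorem baseCoord_apply (i : b.support) (x : Module.Dual ℂ H) :
    baseCoord b i x = (b.toWeightBasis.repr x i).re := rfl

theorem isBased_rootSet (b : (rootSystem H).Base) :
    IsBased (rootSet H) (fun i : b.support => (rootSystem H).root i) (baseCoord b) where
  mem i := root_mem_rootSet _
  coord_self i := by
    rw [baseCoord_apply, b.toWeightBasis_repr_root]
    simp
  coord_ne i j h := by
    rw [baseCoord_apply, b.toWeightBasis_repr_root, Finsupp.single_eq_of_ne h]
    simp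
  induction p h₁ h₂ := by
    have key : ∀ i, b.IsPos i → p ((rootSystem H).root i) := by
      intro i hi
      refine hi.induction_on_add (p := fun i => p ((rootSystem H).root i))
        (fun i hi => h₁ ⟨i, hi⟩) fun i j k hk hi hj => ?_
      rw [hk]
      exact h₂ _ (root_mem_rootSet i) ⟨j, hj⟩ hi (by rw [← hk]; exact root_mem_rootSet k)
    rintro _ ⟨i, rfl⟩
    let := (rootSystem H).indexNeg
    rcases RootPairing.Base.IsPos.or_neg b i with h | h
    · exact Or.inl (key i h)
    · refine Or.inr ?_
      have := key _ h
      rwa [RootPairing.indexNeg_neg, RootPairing.root_reflectionPerm,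
        RootPairing.reflection_apply_self] at this

theorem IsBased.reindex {V ι κ : Type*} [AddCommGroup V] {Φ : Set V} {α : ι → V} {c : ι → V →+ ℝ}
    (hb : IsBased Φ α c) (e : κ ≃ ι) : IsBased Φ (α ∘ e) (c ∘ e) where
  mem i := hb.mem _
  coord_self i := hb.coord_self _
  coord_ne i j h := hb.coord_ne _ _ (e.injective.ne h)
  induction p h₁ h₂ := hb.induction p (fun i => by simpa using h₁ (e.symm i))
    fun x hx i hi hm => by simpa using h₂ x hx (e.symm i) hi (by simpa using hm)

theorem exists_pair_of_isTypeDOrE₆ (hb : IsTypeDOrE₆ b) {Γ : Set b.support}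
    {lam g : Module.Dual ℂ H →+ ℂ} {K : ℂ} (hK : K ≠ 0) (hC : IsGoodPair (rootSet H) lam g K)
    (ha : IsAdapted (rootSet H) (fun i : b.support => (rootSystem H).root i) (baseCoord b) Γ lam g) :
    ∃ j k, j ≠ k ∧ ∀ i ∉ Γ, i = j ∨ i = k := by
  have hs := isTypeDOrE₆_symm hb
  have h := isSimplyLaced_rootSet hs
  have hform : ∀ i j : b.support, rootForm b ((rootSystem H).root i) ((rootSystem H).root j) =
      b.cartanMatrix i j := fun i j => rootForm_root hs i j
  have key : ∀ (n : ℕ) (e : b.support ≃ Fin n),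
      (∃ j k, j ≠ k ∧ ∀ i ∉ (e.symm ⁻¹' Γ), i = j ∨ i = k) →
      ∃ j k, j ≠ k ∧ ∀ i ∉ Γ, i = j ∨ i = k := by
    rintro n e ⟨j, k, hjk, hall⟩
    refine ⟨e.symm j, e.symm k, e.symm.injective.ne hjk, fun i hi => ?_⟩
    simp only [Equiv.eq_symm_apply]
    exact hall (e i) (by simpa using hi)
  have ha' : ∀ (n : ℕ) (e : b.support ≃ Fin n), IsAdapted (rootSet H)
      ((fun i : b.support => (rootSystem H).root i) ∘ e.symm) (baseCoord b ∘ e.symm)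
      (e.symm ⁻¹' Γ) lam g := fun n e =>
    ⟨fun i hi => ha.lam_eq_zero _ hi, fun i hi => ha.g_eq_zero _ hi,
      fun x hx i hi => ha.lam_ne_zero x hx _ hi⟩
  rcases hb with ⟨n, hn, e, he⟩ | ⟨e, he⟩
  · obtain ⟨m, rfl⟩ : ∃ m, n = m + 3 := ⟨n - 3, by omega⟩
    refine key _ e (exists_pair_of_typeD h ((isBased_rootSet b).reindex e.symm) (fun i j => ?_)
      (by omega) hK hC (ha' _ e))
    rw [Function.comp_apply, Function.comp_apply, hform, he, e.apply_symm_apply,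
      e.apply_symm_apply]
  · refine key _ e (exists_pair_of_typeE₆ h ((isBased_rootSet b).reindex e.symm) (fun i j => ?_)
      hK hC (ha' _ e))
    rw [Function.comp_apply, Function.comp_apply, hform, he, e.apply_symm_apply,
      e.apply_symm_apply]

end RootSystem

/-! ### Root vectors indexed by the dual of the Cartan subalgebra -/

section RootVectors

open LieAlgebra LieAlgebra.IsKilling LieModule

variable {L : Type*} [LieRing L] [LieAlgebra ℂ L] [FiniteDimensional ℂ L]
  [LieAlgebra.IsSimple ℂ L] {H : LieSubalgebra ℂ L} [H.IsCartanSubalgebra]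

/-- The negative of a root, as a root. -/
def negRoot (i : H.root) : H.root :=
  ⟨-i.1, Finset.mem_filter.2 ⟨Finset.mem_univ _, (H.isNonZero_coe_root i).neg⟩⟩

theorem root_negRoot (i : H.root) :
    (rootSystem H).root (negRoot i) = -(rootSystem H).root i := by
  simp [negRoot]

theorem mem_rootSet_of_rootSpace_ne_bot {x : Module.Dual ℂ H} (hx : x ≠ 0)
    (h : rootSpace H x ≠ ⊥) : x ∈ rootSet H := by
  refine ⟨⟨⟨x, h⟩, Finset.mem_filter.2 ⟨Finset.mem_univ _, fun h0 => hx ?_⟩⟩, ?_⟩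
  · ext t; exact congrFun h0 t
  · ext t; rfl

open Classical in
/-- The root vector attached to a root, viewed as an element of the dual of the Cartan
subalgebra. -/
def RootVectors.vec (R : RootVectors H) (x : Module.Dual ℂ H) : L :=
  if h : ∃ i : H.root, (rootSystem H).root i = x then R.E h.choose.1 else 0

namespace RootVectors

variable (R : RootVectors H)

theorem vec_root (i : H.root) : R.vec ((rootSystem H).root i) = R.E i.1 := by
  have h : ∃ j : H.root, (rootSystem H).root j = (rootSystem H).root i := ⟨i, rfl⟩
  rw [vec, dif_pos h, (rootSystem H).root.injective h.choose_spec]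

theorem vec_neg_root (i : H.root) : R.vec (-(rootSystem H).root i) = R.E (-i.1) := by
  rw [← root_negRoot, vec_root]
  rfl

variable {x y : Module.Dual ℂ H}

theorem vec_mem (hx : x ∈ rootSet H) : R.vec x ∈ rootSpace H x := by
  obtain ⟨i, rfl⟩ := hx
  rw [vec_root]
  exact R.mem_rootSpace _ (H.isNonZero_coe_root i)

theorem vec_root_mem (i : H.root) : R.vec ((rootSystem H).root i) ∈ rootSpace H i.1 := by
  rw [vec_root]
  exact R.mem_rootSpace _ (H.isNonZero_coe_root i)

theorem vec_neg_root_mem (i : H.root) :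
    R.vec (-(rootSystem H).root i) ∈ rootSpace H (-i.1) := by
  have h := R.mem_rootSpace _ (H.isNonZero_coe_root i).neg
  rw [Weight.coe_neg] at h
  rwa [vec_neg_root]

theorem lie_vec (hx : x ∈ rootSet H) {h : L} (hh : h ∈ H) : ⁅h, R.vec x⁆ = x ⟨h, hh⟩ • R.vec x :=
  lie_eq_smul_of_mem_rootSpace (R.vec_mem hx) ⟨h, hh⟩

theorem killingForm_vec_neg (hx : x ∈ rootSet H) :
    killingForm ℂ L (R.vec x) (R.vec (-x)) = 1 := by
  obtain ⟨i, rfl⟩ := hx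
  rw [vec_root, vec_neg_root]
  exact R.killing_eq_one _ (H.isNonZero_coe_root i)

theorem vec_ne_zero (hx : x ∈ rootSet H) : R.vec x ≠ 0 := fun h => by
  have := R.killingForm_vec_neg hx
  simp [h] at this

theorem killingForm_eq_zero {a : L} (ha : a ∈ rootSpace H x) (hy : y ∈ rootSet H)
    (hxy : x + y ≠ 0) : killingForm ℂ L a (R.vec y) = 0 := by
  refine killingForm_apply_eq_zero_of_mem_rootSpace_of_add_ne_zero ℂ L H ha (R.vec_mem hy)
    fun h => hxy ?_
  ext t; exact congrFun h t

theorem killingForm_vec_vec (hx : x ∈ rootSet H) (hy : y ∈ rootSet H) (hxy : x + y ≠ 0) :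
    killingForm ℂ L (R.vec x) (R.vec y) = 0 :=
  R.killingForm_eq_zero (R.vec_mem hx) hy hxy

theorem eq_smul_vec (hx : x ∈ rootSet H) {a : L} (ha : a ∈ rootSpace H x) :
    a = killingForm ℂ L a (R.vec (-x)) • R.vec x := by
  have h1 : Module.finrank ℂ (rootSpace H x) = 1 := by
    obtain ⟨i, rfl⟩ := hx
    exact finrank_rootSpace_eq_one _ (H.isNonZero_coe_root i)
  obtain ⟨c, hc⟩ := (finrank_eq_one_iff_of_nonzero' (⟨R.vec x, R.vec_mem hx⟩ : rootSpace H x)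
    (fun h => R.vec_ne_zero hx (congrArg Subtype.val h))).1 h1 ⟨a, ha⟩
  have hc' : c • R.vec x = a := congrArg Subtype.val hc
  rw [← hc', map_smul, LinearMap.smul_apply, R.killingForm_vec_neg hx, smul_eq_mul, mul_one]

theorem lie_vec_mem (hx : x ∈ rootSet H) (hy : y ∈ rootSet H) :
    ⁅R.vec x, R.vec y⁆ ∈ rootSpace H (x + y : Module.Dual ℂ H) :=
  lie_mem_genWeightSpace_of_mem_genWeightSpace (R.vec_mem hx) (R.vec_mem hy)

theorem lie_vec_eq_zero (hx : x ∈ rootSet H) (hy : y ∈ rootSet H) (h0 : x + y ≠ 0)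
    (hxy : x + y ∉ rootSet H) : ⁅R.vec x, R.vec y⁆ = 0 := by
  by_contra hne
  refine hxy (mem_rootSet_of_rootSpace_ne_bot h0 fun h => hne ?_)
  have := R.lie_vec_mem hx hy
  rw [h] at this
  exact this

theorem lie_vec_neg (i : H.root) :
    ⁅R.vec ((rootSystem H).root i), R.vec (-(rootSystem H).root i)⁆ =
      ((cartanEquivDual H).symm i.1 : L) := by
  have h₁ := R.killingForm_vec_neg (root_mem_rootSet i)
  have h₂ := R.mem_rootSpace _ (H.isNonZero_coe_root i)
  have h₃ := R.mem_rootSpace _ (H.isNonZero_coe_root i).neg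
  rw [vec_root, vec_neg_root] at h₁ ⊢
  rw [Weight.coe_neg] at h₃
  rw [lie_eq_killingForm_smul_of_mem_rootSpace_of_mem_rootSpace_neg h₂ h₃, h₁, one_smul]

theorem lie_vec_eq_smul (hx : x ∈ rootSet H) (hy : y ∈ rootSet H) (hxy : x + y ∈ rootSet H) :
    ⁅R.vec x, R.vec y⁆ = killingForm ℂ L ⁅R.vec x, R.vec y⁆ (R.vec (-(x + y))) • R.vec (x + y) :=
  R.eq_smul_vec hxy (R.lie_vec_mem hx hy)

/-- Since B(x, y) = -1, the difference y - x is neither zero nor a root. If [E_x, E_y] were zero,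
the Jacobi identity would give [[E_x, E_{-x}], E_y] = 0, hence a zero pairing of y with the coroot
of x. -/
theorem lie_vec_ne_zero {b : (rootSystem H).Base}
    (hs : ∀ i j : b.support, b.cartanMatrix i j = b.cartanMatrix j i) (hx : x ∈ rootSet H) (hy : y ∈ rootSet H)
    (hxy : x + y ∈ rootSet H) : ⁅R.vec x, R.vec y⁆ ≠ 0 := by
  intro h0
  have hB := isSimplyLaced_rootSet hs
  have hB1 := hB.eq_neg_one_of_add_mem hx hy hxy
  have hne : -x + y ≠ 0 := fun h => by
    rw [show y = x by rwa [neg_add_eq_zero, eq_comm] at h, hB.self _ hx] at hB1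
    norm_num at hB1
  have hnm : -x + y ∉ rootSet H := fun h => by
    have := hB.eq_neg_one_of_add_mem (hB.neg_mem _ hx) hy h
    rw [map_neg, AddMonoidHom.neg_apply, hB1] at this
    norm_num at this
  obtain ⟨i, rfl⟩ := hx
  obtain ⟨j, rfl⟩ := hy
  have hj := lie_lie (R.vec ((rootSystem H).root i)) (R.vec (-(rootSystem H).root i))
    (R.vec ((rootSystem H).root j))
  rw [R.lie_vec_eq_zero (neg_mem_rootSet (root_mem_rootSet i)) (root_mem_rootSet j) hne hnm, h0,
    lie_zero, lie_zero, sub_zero, R.lie_vec_neg, R.lie_vec (root_mem_rootSet j)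
    (SetLike.coe_mem _)] at hj
  rcases smul_eq_zero.1 hj with hz | hz
  · have hz' : (rootSystem H).root j ((rootSystem H).coroot i) = 0 := by
      change (rootSystem H).root j ((cartanEquivDual H).symm i.1) = 0 at hz
      rw [rootSystem_coroot_apply, coroot, map_nsmul, map_smul, hz, smul_zero, smul_zero]
    rw [root_coroot_eq_intCast] at hz'
    rw [hB.symm, rootForm_root hs, Int.cast_eq_zero.1 hz'] at hB1
    norm_num at hB1
  · exact R.vec_ne_zero (root_mem_rootSet j) hz

end RootVectors

end RootVectors

/-! ### Levi subalgebras and the tangent space -/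

section Levi

open LieAlgebra LieAlgebra.IsKilling LieModule

variable {L : Type*} [LieRing L] [LieAlgebra ℂ L] [FiniteDimensional ℂ L]
  [LieAlgebra.IsSimple ℂ L] {H : LieSubalgebra ℂ L} [H.IsCartanSubalgebra]

/-- The span of `Γ` in the dual of the Cartan subalgebra. -/
def leviSpan (Γ : Finset H.root) : Submodule ℂ (Module.Dual ℂ H) :=
  Submodule.span ℂ ((rootSystem H).root '' (Γ : Set H.root))

/-- The roots outside the span of `Γ`. -/
def outerRoots (Γ : Finset H.root) : Set (Module.Dual ℂ H) := {x ∈ rootSet H | x ∉ leviSpan Γ}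

variable {Γ : Finset H.root} {x y z : Module.Dual ℂ H}

theorem neg_mem_outerRoots (hx : x ∈ outerRoots Γ) : -x ∈ outerRoots Γ :=
  ⟨neg_mem_rootSet hx.1, fun h => hx.2 ((leviSpan Γ).neg_mem_iff.1 h)⟩

theorem add_mem_outerRoots (hx : x ∈ leviSpan Γ) (hy : y ∈ outerRoots Γ)
    (hxy : x + y ∈ rootSet H) : x + y ∈ outerRoots Γ :=
  ⟨hxy, fun h => hy.2 (((leviSpan Γ).add_mem_iff_right hx).1 h)⟩

/-- Coordinates of roots are integers, so passing to real parts loses nothing. -/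
theorem repr_eq_zero_iff (b : (rootSystem H).Base) (hx : x ∈ rootSet H) (i : b.support) :
    b.toWeightBasis.repr x i = 0 ↔ baseCoord b i x = 0 := by
  obtain ⟨n, hn⟩ := (isBased_rootSet b).exists_intCast_sum hx
  have h : b.toWeightBasis.repr x i = (n i : ℂ) := by
    rw [hn, map_sum, Finset.sum_apply', Finset.sum_eq_single i]
    · rw [map_zsmul, b.toWeightBasis_repr_root]; simp
    · intro j _ hj
      rw [map_zsmul, b.toWeightBasis_repr_root]
      simp [hj]
    · simp
  rw [baseCoord_apply, h, Complex.intCast_re, Int.cast_eq_zero, Int.cast_eq_zero]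

theorem mem_leviSpan_iff {b : (rootSystem H).Base} (hΓ : Γ ⊆ b.support) (hx : x ∈ rootSet H) :
    x ∈ leviSpan Γ ↔ ∀ i : b.support, (i : H.root) ∉ Γ → baseCoord b i x = 0 := by
  have himage : (rootSystem H).root '' (Γ : Set H.root) =
      b.toWeightBasis '' {i : b.support | (i : H.root) ∈ Γ} := by
    ext y
    constructor
    · rintro ⟨i, hi, rfl⟩
      exact ⟨⟨i, hΓ hi⟩, hi, b.toWeightBasis_apply _⟩
    · rintro ⟨i, hi, rfl⟩
      exact ⟨i, hi, (b.toWeightBasis_apply _).symm⟩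
  rw [leviSpan, himage, Module.Basis.mem_span_image]
  constructor
  · intro h i hi
    rw [← repr_eq_zero_iff b hx]
    by_contra hne
    exact hi (h (Finsupp.mem_support_iff.2 hne))
  · intro h i hi
    by_contra hne
    exact (Finsupp.mem_support_iff.1 hi) ((repr_eq_zero_iff b hx i).2 (h i hne))

variable (R : RootVectors H)

omit [IsSimple ℂ L] in
theorem cartan_le_levi {a : L} (ha : a ∈ H) : a ∈ levi Γ :=
  LieSubalgebra.subset_lieSpan (Or.inl ha)

/-- The generators involve only simple roots. A chain of simple roots leading to a root in the span
of Γ stays in that span, because coordinates along it are nonnegative, and each step has a nonzero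
structure constant. -/
theorem vec_mem_levi {b : (rootSystem H).Base}
    (hs : ∀ i j : b.support, b.cartanMatrix i j = b.cartanMatrix j i) (hΓ : Γ ⊆ b.support)
    (hx : x ∈ rootSet H) (hxΓ : x ∈ leviSpan Γ) : R.vec x ∈ levi Γ := by
  have hb := isBased_rootSet b
  have hroot : ∀ i : H.root, i ∈ Γ → R.vec ((rootSystem H).root i) ∈ levi Γ ∧
      R.vec (-(rootSystem H).root i) ∈ levi Γ := fun i hi =>
    ⟨LieSubalgebra.subset_lieSpan (Or.inr ⟨i, hi, Or.inl (R.vec_root_mem i)⟩),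
      LieSubalgebra.subset_lieSpan (Or.inr ⟨i, hi, Or.inr (R.vec_neg_root_mem i)⟩)⟩
  have hstep : ∀ x y, x ∈ rootSet H → y ∈ rootSet H → x + y ∈ rootSet H → R.vec x ∈ levi Γ →
      R.vec y ∈ levi Γ → R.vec (x + y) ∈ levi Γ := by
    intro x y hx hy hxy h₁ h₂
    have h := (levi Γ).lie_mem h₁ h₂
    have hne := R.lie_vec_ne_zero hs hx hy hxy
    rw [R.lie_vec_eq_smul hx hy hxy] at h hne
    exact ((levi Γ).toSubmodule.smul_mem_iff (smul_ne_zero_iff.1 hne).1).1 h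
  have key := hb.induction (fun x => x ∈ rootSet H ∧ (∀ i, 0 ≤ baseCoord b i x) ∧
      ((∀ i : b.support, (i : H.root) ∉ Γ → baseCoord b i x = 0) →
        R.vec x ∈ levi Γ ∧ R.vec (-x) ∈ levi Γ))
    (fun i => ⟨hb.mem i, fun j => hb.coord_nonneg j i, fun h => hroot i (by
      by_contra hi
      have := h i hi
      rw [hb.coord_self] at this
      norm_num at this)⟩)
    (by
      rintro x hx i ⟨-, hp, ih⟩ hxi
      refine ⟨hxi, fun j => ?_, fun h => ?_⟩
      · rw [map_add]
        exact add_nonneg (hp j) (hb.coord_nonneg j i)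
      · have h' : ∀ j : b.support, (j : H.root) ∉ Γ → baseCoord b j x = 0 ∧
            baseCoord b j ((rootSystem H).root i) = 0 := fun j hj => by
          have h₁ := h j hj
          have h₂ := hb.coord_nonneg j i
          rw [map_add] at h₁
          exact ⟨by linarith [hp j], by linarith [hp j]⟩
        have hi : (i : H.root) ∈ Γ := by
          by_contra hi
          have := (h' i hi).2
          rw [hb.coord_self] at this
          norm_num at this
        obtain ⟨h₁, h₂⟩ := ih fun j hj => (h' j hj).1
        obtain ⟨h₃, h₄⟩ := hroot i hi
        refine ⟨hstep _ _ hx (hb.mem i) hxi h₁ h₃, ?_⟩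
        have hneg := neg_mem_rootSet hxi
        rw [neg_add] at hneg ⊢
        exact hstep _ _ (neg_mem_rootSet hx) (neg_mem_rootSet (hb.mem i)) hneg h₂ h₄) x hx
  have h0 := (mem_leviSpan_iff hΓ hx).1 hxΓ
  rcases key with h | h
  · exact (h.2.2 h0).1
  · have := (h.2.2 fun i hi => by rw [map_neg, h0 i hi, neg_zero]).2
    rwa [neg_neg] at this

theorem tangent_eq_span : tangent Γ = Submodule.span ℂ (R.vec '' outerRoots Γ) := by
  apply le_antisymm
  · refine iSup_le fun i => iSup_le fun hi a ha => ?_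
    rw [R.eq_smul_vec (root_mem_rootSet i) ha]
    exact Submodule.smul_mem _ _ (Submodule.subset_span ⟨_, ⟨root_mem_rootSet i, hi⟩, rfl⟩)
  · rw [Submodule.span_le]
    rintro _ ⟨x, ⟨⟨i, rfl⟩, hx⟩, rfl⟩
    exact Submodule.mem_iSup_of_mem i (Submodule.mem_iSup_of_mem hx (R.vec_root_mem i))

theorem vec_mem_tangent (hx : x ∈ outerRoots Γ) : R.vec x ∈ tangent Γ := by
  rw [tangent_eq_span R]
  exact Submodule.subset_span ⟨x, hx, rfl⟩

-- Adding a root of Ω_Γ to an outer root never gives zero, and gives an outer root whenever it gives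
-- a root. Commutators of generators follow from the Jacobi identity.
include R in
theorem lie_mem_tangent {a m : L} (ha : a ∈ levi Γ) (hm : m ∈ tangent Γ) : ⁅a, m⁆ ∈ tangent Γ := by
  have hroot : ∀ x ∈ rootSet H, x ∈ leviSpan Γ → ∀ a ∈ rootSpace H x, ∀ m ∈ tangent Γ,
      ⁅a, m⁆ ∈ tangent Γ := by
    intro x hx hxΓ a ha m hm
    rw [R.eq_smul_vec hx ha, smul_lie]
    refine Submodule.smul_mem _ _ ?_
    rw [tangent_eq_span R] at hm
    induction hm using Submodule.span_induction with
    | mem _ h =>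
      obtain ⟨y, hy, rfl⟩ := h
      by_cases hxy : x + y ∈ rootSet H
      · rw [R.lie_vec_eq_smul hx hy.1 hxy]
        exact Submodule.smul_mem _ _ (vec_mem_tangent R (add_mem_outerRoots hxΓ hy hxy))
      · rw [R.lie_vec_eq_zero hx hy.1 (fun h => hy.2 ?_) hxy]
        · exact zero_mem _
        · rw [eq_neg_of_add_eq_zero_right h]
          exact (leviSpan Γ).neg_mem hxΓ
    | zero => rw [lie_zero]; exact zero_mem _
    | add _ _ _ _ h₁ h₂ => rw [lie_add]; exact add_mem h₁ h₂
    | smul c _ _ h => rw [lie_smul]; exact Submodule.smul_mem _ _ h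
  induction ha using LieSubalgebra.lieSpan_induction generalizing m with
  | mem a ha =>
    rcases ha with ha | ⟨i, hi, ha | ha⟩
    · rw [tangent_eq_span R] at hm
      induction hm using Submodule.span_induction with
      | mem _ h =>
        obtain ⟨y, hy, rfl⟩ := h
        rw [R.lie_vec hy.1 ha]
        exact Submodule.smul_mem _ _ (vec_mem_tangent R hy)
      | zero => rw [lie_zero]; exact zero_mem _
      | add _ _ _ _ h₁ h₂ => rw [lie_add]; exact add_mem h₁ h₂
      | smul c _ _ h => rw [lie_smul]; exact Submodule.smul_mem _ _ h
    · exact hroot _ (root_mem_rootSet i) (Submodule.subset_span ⟨i, hi, rfl⟩) a ha m hm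
    · exact hroot _ (neg_mem_rootSet (root_mem_rootSet i))
        ((leviSpan Γ).neg_mem (Submodule.subset_span ⟨i, hi, rfl⟩)) a ha m hm
  | zero => rw [zero_lie]; exact zero_mem _
  | add _ _ _ _ h₁ h₂ => rw [add_lie]; exact add_mem (h₁ hm) (h₂ hm)
  | smul c _ _ h => rw [smul_lie]; exact Submodule.smul_mem _ _ (h hm)
  | lie a a' _ _ h₁ h₂ => rw [lie_lie]; exact sub_mem (h₁ (h₂ hm)) (h₂ (h₁ hm))

theorem proj_apply (a : L) : open Classical in proj R Γ a =
    ∑ i : H.root with i ∉ leviRoots Γ, killingForm ℂ L (R.E (-i.1)) a • R.E i.1 := by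
  rw [proj, LinearMap.sum_apply]
  rfl

theorem proj_mem_tangent (a : L) : proj R Γ a ∈ tangent Γ := by
  classical
  rw [proj_apply]
  refine Submodule.sum_mem _ fun i hi => Submodule.smul_mem _ _ ?_
  rw [← R.vec_root]
  exact vec_mem_tangent R ⟨root_mem_rootSet i, (Finset.mem_filter.1 hi).2⟩

theorem killingForm_vec_proj (hx : x ∈ outerRoots Γ) (a : L) :
    killingForm ℂ L (R.vec x) (proj R Γ a) = killingForm ℂ L (R.vec x) a := by
  classical
  obtain ⟨i, hi⟩ := neg_mem_rootSet hx.1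
  have hx' := neg_mem_outerRoots hx
  have hix : x = -(rootSystem H).root i := by rw [hi, neg_neg]
  rw [proj_apply, map_sum, Finset.sum_eq_single i]
  · rw [map_smul, ← R.vec_root, ← R.vec_neg_root, hi, neg_neg, R.killingForm_vec_neg hx.1,
      smul_eq_mul, mul_one]
  · intro j _ hj
    rw [map_smul, ← R.vec_root, R.killingForm_vec_vec hx.1 (root_mem_rootSet j), smul_zero]
    intro h
    rw [hix, neg_add_eq_zero] at h
    exact hj ((rootSystem H).root.injective h).symm
  · intro h
    exact absurd (Finset.mem_filter.2 ⟨Finset.mem_univ _, by rw [← hi] at hx'; exact hx'.2⟩) h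

theorem proj_vec (hx : x ∈ outerRoots Γ) : proj R Γ (R.vec x) = R.vec x := by
  classical
  obtain ⟨⟨i, rfl⟩, hi⟩ := hx
  rw [proj_apply, Finset.sum_eq_single i]
  · rw [← R.vec_neg_root, LieModule.traceForm_comm, R.killingForm_vec_neg (root_mem_rootSet i),
      R.vec_root, one_smul]
  · intro j _ hj
    rw [← R.vec_neg_root, R.killingForm_vec_vec (neg_mem_rootSet (root_mem_rootSet j))
      (root_mem_rootSet i), zero_smul]
    intro h
    rw [neg_add_eq_zero] at h
    exact hj ((rootSystem H).root.injective h)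
  · intro h
    exact absurd (Finset.mem_filter.2 ⟨Finset.mem_univ i, hi⟩) h

theorem proj_eq_self {m : L} (hm : m ∈ tangent Γ) : proj R Γ m = m := by
  rw [tangent_eq_span R] at hm
  induction hm using Submodule.span_induction with
  | mem _ h =>
    obtain ⟨y, hy, rfl⟩ := h
    exact proj_vec R hy
  | zero => rw [map_zero]
  | add _ _ _ _ h₁ h₂ => rw [map_add, h₁, h₂]
  | smul c _ _ h => rw [map_smul, h]

theorem map_proj_mem_tangentPower (n : ℕ) (w : ⋀[ℂ]^n L) :
    exteriorPower.map n (proj R Γ) w ∈ tangentPower Γ n := by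
  refine ⟨exteriorPower.map n ((proj R Γ).codRestrict _ (proj_mem_tangent R)) w, ?_⟩
  rw [← LinearMap.comp_apply, ← exteriorPower.map_comp, LinearMap.subtype_comp_codRestrict]

theorem map_proj_eq_self {n : ℕ} {w : ⋀[ℂ]^n L} (hw : w ∈ tangentPower Γ n) :
    exteriorPower.map n (proj R Γ) w = w := by
  obtain ⟨u, rfl⟩ := hw
  rw [← LinearMap.comp_apply, ← exteriorPower.map_comp]
  congr 2
  ext m
  exact proj_eq_self R m.2

theorem wedge₃_mem_tangentPower {X Y Z : L} (hX : X ∈ tangent Γ) (hY : Y ∈ tangent Γ)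
    (hZ : Z ∈ tangent Γ) : wedge₃ X Y Z ∈ tangentPower Γ 3 := by
  refine ⟨exteriorPower.ιMulti ℂ 3 ![⟨X, hX⟩, ⟨Y, hY⟩, ⟨Z, hZ⟩], ?_⟩
  rw [exteriorPower.map_apply_ιMulti, wedge₃]
  congr 1; funext i; fin_cases i <;> rfl

theorem tri_map_proj (hx : x ∈ outerRoots Γ) (hy : y ∈ outerRoots Γ) (hz : z ∈ outerRoots Γ)
    (w : ⋀[ℂ]^3 L) : tri (R.vec x) (R.vec y) (R.vec z) (exteriorPower.map 3 (proj R Γ) w) =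
      tri (R.vec x) (R.vec y) (R.vec z) w :=
  tri_map _ (killingForm_vec_proj R hx) (killingForm_vec_proj R hy) (killingForm_vec_proj R hz) w

end Levi

/-! ### Recovering a trivector from its contractions -/

section Nondegenerate

variable {L : Type*} [LieRing L] [LieAlgebra ℂ L]

theorem wedge₃_swap (X Y Z : L) : wedge₃ Y X Z = -wedge₃ X Y Z := by
  have h : wedge₃ (X + Y) (X + Y) Z = 0 :=
    (exteriorPower.ιMulti ℂ 3 (M := L)).map_eq_zero_of_eq _ (i := 0) (j := 1) rfl (by decide)
  have h₁ : wedge₃ X X Z = 0 :=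
    (exteriorPower.ιMulti ℂ 3 (M := L)).map_eq_zero_of_eq _ (i := 0) (j := 1) rfl (by decide)
  have h₂ : wedge₃ Y Y Z = 0 :=
    (exteriorPower.ιMulti ℂ 3 (M := L)).map_eq_zero_of_eq _ (i := 0) (j := 1) rfl (by decide)
  rw [wedge₃_add_left, wedge₃_add_mid, wedge₃_add_mid, h₁, h₂, zero_add, add_zero] at h
  exact eq_neg_of_add_eq_zero_right h

theorem wedge₃_swap_right (X Y Z : L) : wedge₃ X Z Y = -wedge₃ X Y Z := by
  have h : wedge₃ X (Y + Z) (Y + Z) = 0 :=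
    (exteriorPower.ιMulti ℂ 3 (M := L)).map_eq_zero_of_eq _ (i := 1) (j := 2) rfl (by decide)
  have h₁ : wedge₃ X Y Y = 0 :=
    (exteriorPower.ιMulti ℂ 3 (M := L)).map_eq_zero_of_eq _ (i := 1) (j := 2) rfl (by decide)
  have h₂ : wedge₃ X Z Z = 0 :=
    (exteriorPower.ιMulti ℂ 3 (M := L)).map_eq_zero_of_eq _ (i := 1) (j := 2) rfl (by decide)
  rw [wedge₃_add_mid, wedge₃_add_right, wedge₃_add_right, h₁, h₂, zero_add, add_zero] at h
  exact eq_neg_of_add_eq_zero_right h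

/-- The trilinear map underlying the wedge product. -/
def wedgeHom : L →ₗ[ℂ] L →ₗ[ℂ] L →ₗ[ℂ] ⋀[ℂ]^3 L :=
  LinearMap.mk₂ ℂ (fun X Y =>
    { toFun := fun Z => wedge₃ X Y Z
      map_add' := fun _ _ => wedge₃_add_right _ _ _ _
      map_smul' := fun _ _ => wedge₃_smul_right _ _ _ _ })
    (fun _ _ _ => LinearMap.ext fun _ => wedge₃_add_left _ _ _ _)
    (fun _ _ _ => LinearMap.ext fun _ => wedge₃_smul_left _ _ _ _)
    (fun _ _ _ => LinearMap.ext fun _ => wedge₃_add_mid _ _ _ _)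
    (fun _ _ _ => LinearMap.ext fun _ => wedge₃_smul_mid _ _ _ _)

theorem wedge₃_sum {ι : Type*} (s : Finset ι) (E : ι → L) (p q r : ι → ℂ) :
    wedge₃ (∑ i ∈ s, p i • E i) (∑ i ∈ s, q i • E i) (∑ i ∈ s, r i • E i) =
      ∑ i ∈ s, ∑ j ∈ s, ∑ k ∈ s, (p i * q j * r k) • wedge₃ (E i) (E j) (E k) := by
  change wedgeHom _ _ _ = ∑ i ∈ s, ∑ j ∈ s, ∑ k ∈ s, (p i * q j * r k) • wedgeHom (E i) (E j) (E k)
  simp only [map_sum wedgeHom, LinearMap.sum_apply]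
  refine Finset.sum_congr rfl fun i _ => ?_
  rw [map_sum (wedgeHom (p i • E i)), LinearMap.sum_apply]
  refine Finset.sum_congr rfl fun j _ => ?_
  rw [map_sum]
  refine Finset.sum_congr rfl fun k _ => ?_
  simp only [map_smul, LinearMap.smul_apply, smul_smul]
  congr 1
  ring

/-- A trivector is recovered, up to the factor `6`, from its contractions. -/
theorem six_smul_map {ι : Type*} (s : Finset ι) (E F : ι → L) (w : ⋀[ℂ]^3 L) :
    ∑ i ∈ s, ∑ j ∈ s, ∑ k ∈ s, tri (F i) (F j) (F k) w • wedge₃ (E i) (E j) (E k) =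
      (6 : ℂ) • exteriorPower.map 3 (∑ i ∈ s, (killingForm ℂ L (F i)).smulRight (E i)) w := by
  induction w using trivector_induction with
  | wedge X Y Z =>
    have key : ∀ A B C : L, wedge₃ (∑ i ∈ s, killingForm ℂ L (F i) A • E i)
        (∑ i ∈ s, killingForm ℂ L (F i) B • E i) (∑ i ∈ s, killingForm ℂ L (F i) C • E i) =
        ∑ i ∈ s, ∑ j ∈ s, ∑ k ∈ s, (killingForm ℂ L (F i) A * killingForm ℂ L (F j) B *
          killingForm ℂ L (F k) C) • wedge₃ (E i) (E j) (E k) := fun A B C => wedge₃_sum ..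
    -- The six signed orderings are all equal to the same wedge; they match the six terms of the
    -- determinant in `tri_wedge₃`.
    have h₆ : ∀ A B C : L, (6 : ℂ) • wedge₃ A B C = wedge₃ A B C - wedge₃ A C B - wedge₃ B A C +
        wedge₃ B C A + wedge₃ C A B - wedge₃ C B A := fun A B C => by
      rw [wedge₃_swap B C A, wedge₃_swap A C B, wedge₃_swap_right B A C, wedge₃_swap_right A B C,
        wedge₃_swap A B C]
      module
    rw [map_wedge₃]
    simp only [LinearMap.sum_apply, LinearMap.smulRight_apply]
    rw [h₆]
    simp only [key, ← Finset.sum_sub_distrib, ← Finset.sum_add_distrib]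
    refine Finset.sum_congr rfl fun i _ => Finset.sum_congr rfl fun j _ =>
      Finset.sum_congr rfl fun k _ => ?_
    rw [tri_wedge₃]
    module
  | add v w hv hw =>
    simp only [map_add, add_smul, Finset.sum_add_distrib, hv, hw, smul_add]
  | smul c v hv =>
    rw [map_smul, smul_comm, ← hv]
    simp only [map_smul, smul_assoc, Finset.smul_sum]

end Nondegenerate

section Determination

open LieAlgebra LieAlgebra.IsKilling LieModule

variable {L : Type*} [LieRing L] [LieAlgebra ℂ L] [FiniteDimensional ℂ L]
  [LieAlgebra.IsSimple ℂ L] {H : LieSubalgebra ℂ L} [H.IsCartanSubalgebra] (R : RootVectors H)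
  {Γ : Finset H.root}

/-- A trivector on the tangent space is determined by its contractions with root vectors. -/
theorem eq_zero_of_tri {w : ⋀[ℂ]^3 L} (hw : w ∈ tangentPower Γ 3)
    (h : ∀ x ∈ outerRoots Γ, ∀ y ∈ outerRoots Γ, ∀ z ∈ outerRoots Γ,
      tri (R.vec x) (R.vec y) (R.vec z) w = 0) : w = 0 := by
  classical
  have key := six_smul_map (Finset.univ.filter fun i : H.root => i ∉ leviRoots Γ)
    (fun i => R.E i.1) (fun i => R.E (-i.1)) w
  have hs : ∀ i ∈ Finset.univ.filter fun i : H.root => i ∉ leviRoots Γ,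
      -(rootSystem H).root i ∈ outerRoots Γ := fun i hi =>
    neg_mem_outerRoots ⟨root_mem_rootSet i, (Finset.mem_filter.1 hi).2⟩
  rw [Finset.sum_eq_zero fun i hi => Finset.sum_eq_zero fun j hj => Finset.sum_eq_zero
    fun k hk => by
      rw [← R.vec_neg_root, ← R.vec_neg_root, ← R.vec_neg_root,
        h _ (hs i hi) _ (hs j hj) _ (hs k hk), zero_smul]] at key
  rw [← map_proj_eq_self R hw]
  have h6 := (smul_eq_zero.1 key.symm).resolve_left (by norm_num)
  rwa [show proj R Γ = _ by unfold proj; congr!]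

theorem eq_of_tri {v w : ⋀[ℂ]^3 L} (hv : v ∈ tangentPower Γ 3) (hw : w ∈ tangentPower Γ 3)
    (h : ∀ x ∈ outerRoots Γ, ∀ y ∈ outerRoots Γ, ∀ z ∈ outerRoots Γ,
      tri (R.vec x) (R.vec y) (R.vec z) v = tri (R.vec x) (R.vec y) (R.vec z) w) : v = w := by
  rw [← sub_eq_zero]
  refine eq_zero_of_tri R (sub_mem hv hw) fun x hx y hy z hz => ?_
  rw [map_sub, h x hx y hy z hz, sub_self]

end Determination

/-! ### Invariant bivectors and good orbits -/

section Bivectors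

open LieAlgebra LieAlgebra.IsKilling LieModule

/-- The signs are not all equal, so two of the three products are -1 and one is 1. Applied to
heights, this computes φ. -/
theorem sign_sum_of_add_eq_zero {a b c : ℤ} (hc : c ≠ 0)
    (h : a + b + c = 0) {p q r : ℂ} (hp : p = if 0 < a then 1 else -1)
    (hq : q = if 0 < b then 1 else -1) (hr : r = if 0 < c then 1 else -1) :
    p * q + q * r + r * p = -1 := by
  split_ifs at hp hq hr <;> subst hp hq hr <;> first | (exfalso; omega) | norm_num

variable {L : Type*} [LieRing L] [LieAlgebra ℂ L]

theorem tri_schouten_of_sharp_eq_smul {f g : ⋀[ℂ]^2 L} {a b c : L} {p q r p' q' r' : ℂ}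
    (ha : sharp f a = p • a) (hb : sharp f b = q • b) (hc : sharp f c = r • c)
    (ha' : sharp g a = p' • a) (hb' : sharp g b = q' • b) (hc' : sharp g c = r' • c) :
    tri a b c (schouten f g) =
      (p * q' + p' * q + q * r' + q' * r + r * p' + r' * p) * killingForm ℂ L ⁅a, b⁆ c := by
  have h₁ : killingForm ℂ L a ⁅b, c⁆ = killingForm ℂ L ⁅a, b⁆ c :=
    (LieModule.traceForm_apply_lie_apply ..).symm
  have h₂ : killingForm ℂ L b ⁅c, a⁆ = killingForm ℂ L ⁅a, b⁆ c := by
    rw [← LieModule.traceForm_apply_lie_apply, LieModule.traceForm_comm, h₁]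
  rw [tri_schouten, ha, hb, hc, ha', hb', hc']
  simp only [smul_lie, lie_smul, map_add, map_smul, smul_eq_mul, h₁, h₂,
    LieModule.traceForm_comm ℂ L L c ⁅a, b⁆]
  ring

variable [FiniteDimensional ℂ L]
  [LieAlgebra.IsSimple ℂ L] {H : LieSubalgebra ℂ L} [H.IsCartanSubalgebra] (R : RootVectors H)
  {Γ : Finset H.root} {b : (rootSystem H).Base} {x y z : Module.Dual ℂ H}

open Classical in
theorem sharp_sum_vec (s : Finset H.root) (t : H.root → ℂ) (i : H.root) :
    sharp (∑ j ∈ s, t j • wedge₂ (R.E j.1) (R.E (-j.1))) (R.vec ((rootSystem H).root i)) =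
      ((if i ∈ s then t i else 0) - (if negRoot i ∈ s then t (negRoot i) else 0)) •
        R.vec ((rootSystem H).root i) := by
  have h₁ : ∀ j, killingForm ℂ L (R.vec ((rootSystem H).root i)) (R.vec (-(rootSystem H).root j)) •
      R.vec ((rootSystem H).root j) = if i = j then R.vec ((rootSystem H).root i) else 0 := by
    intro j
    split_ifs with h
    · subst h
      rw [R.killingForm_vec_neg (root_mem_rootSet i), one_smul]
    · rw [R.killingForm_vec_vec (root_mem_rootSet i) (neg_mem_rootSet (root_mem_rootSet j)),
        zero_smul]
      rw [← sub_eq_add_neg, sub_ne_zero]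
      exact fun e => h ((rootSystem H).root.injective e)
  have h₂ : ∀ j, killingForm ℂ L (R.vec ((rootSystem H).root i)) (R.vec ((rootSystem H).root j)) •
      R.vec (-(rootSystem H).root j) =
        if negRoot i = j then R.vec ((rootSystem H).root i) else 0 := by
    intro j
    split_ifs with h
    · subst h
      rw [root_negRoot, R.killingForm_vec_neg (root_mem_rootSet i), one_smul, neg_neg]
    · rw [R.killingForm_vec_vec (root_mem_rootSet i) (root_mem_rootSet j), zero_smul]
      intro e
      refine h ((rootSystem H).root.injective ?_)
      rw [root_negRoot, neg_eq_of_add_eq_zero_right e]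
  rw [map_sum, LinearMap.sum_apply]
  simp only [map_smul, LinearMap.smul_apply, sharp_wedge₂, ← R.vec_root, ← R.vec_neg_root, h₁, h₂,
    smul_sub, Finset.sum_sub_distrib, smul_ite, smul_zero, Finset.sum_ite_eq, sub_smul, ite_smul,
    zero_smul]

theorem height_negRoot (i : H.root) : b.height (negRoot i) = -b.height i := by
  have h := b.height_add_zsmul (i := i) (j := i) (k := negRoot i) (z := -2)
    (by rw [root_negRoot]; module)
  rw [h, smul_eq_mul]
  ring

theorem isPos_negRoot_iff (i : H.root) : b.IsPos (negRoot i) ↔ ¬ b.IsPos i := by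
  rw [b.isPos_iff, b.isPos_iff, height_negRoot]
  have := b.height_ne_zero i
  omega

open Classical in
theorem sharp_rMatrix (i : H.root) : sharp (rMatrix R b) (R.vec ((rootSystem H).root i)) =
    (if 0 < b.height i then 1 else -1 : ℂ) • R.vec ((rootSystem H).root i) := by
  have h := sharp_sum_vec R (Finset.univ.filter fun j : H.root => b.IsPos j) (fun _ => 1) i
  simp only [one_smul] at h
  rw [rMatrix]
  refine (by convert h using 3 : _ = _).trans ?_
  congr 1
  simp only [Finset.mem_filter, Finset.mem_univ, true_and, isPos_negRoot_iff]
  simp only [b.isPos_iff]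
  split_ifs <;> simp_all

theorem negRoot_notMem_leviRoots_iff {i : H.root} : negRoot i ∉ leviRoots Γ ↔ i ∉ leviRoots Γ := by
  change (rootSystem H).root (negRoot i) ∉ leviSpan Γ ↔ (rootSystem H).root i ∉ leviSpan Γ
  rw [root_negRoot, (leviSpan Γ).neg_mem_iff]

/-- For a negative root two signs cancel: that of the wedge and that of the reciprocal. So one
formula serves both signs, unlike for r. -/
theorem sharp_kks (t : H) (hx : x ∈ outerRoots Γ) :
    sharp (kks R b Γ t) (R.vec x) = (x t)⁻¹ • R.vec x := by
  classical
  obtain ⟨⟨i, rfl⟩, hi⟩ := hx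
  have h := sharp_sum_vec R (Finset.univ.filter fun j : H.root => b.IsPos j ∧ j ∉ leviRoots Γ)
    (fun j => (j.1 t)⁻¹) i
  rw [kks]
  refine (by convert h using 3 : _ = _).trans ?_
  congr 1
  have hi' : i ∉ leviRoots Γ := hi
  have ht : (negRoot i).1 t = -(i.1 t) := rfl
  have ht' : (rootSystem H).root i t = i.1 t := rfl
  simp only [Finset.mem_filter, Finset.mem_univ, true_and, isPos_negRoot_iff,
    negRoot_notMem_leviRoots_iff, hi', not_false_eq_true, and_true, ht, ht']
  split_ifs <;> simp_all

theorem tri_schouten_rMatrix (hx : x ∈ rootSet H) (hy : y ∈ rootSet H) (hz : z ∈ rootSet H)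
    (h : x + y + z = 0) : tri (R.vec x) (R.vec y) (R.vec z) (phi R b) =
      -2 * killingForm ℂ L ⁅R.vec x, R.vec y⁆ (R.vec z) := by
  obtain ⟨i, rfl⟩ := hx
  obtain ⟨j, rfl⟩ := hy
  obtain ⟨k, rfl⟩ := hz
  have hk : b.height (negRoot k) = b.height i + b.height j :=
    b.height_add (by rw [root_negRoot]; exact (eq_neg_of_add_eq_zero_left h).symm)
  rw [height_negRoot] at hk
  have hsum := sign_sum_of_add_eq_zero (a := b.height i) (b := b.height j) (b.height_ne_zero k)
    (by omega) rfl rfl rfl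
  rw [phi, tri_schouten_of_sharp_eq_smul (sharp_rMatrix R i) (sharp_rMatrix R j) (sharp_rMatrix R k)
    (sharp_rMatrix R i) (sharp_rMatrix R j) (sharp_rMatrix R k)]
  linear_combination 2 * killingForm ℂ L
    ⁅R.vec ((rootSystem H).root i), R.vec ((rootSystem H).root j)⁆
    (R.vec ((rootSystem H).root k)) * hsum

/-- The eigenvalue of a bivector on a root vector. -/
def eigen (f : ⋀[ℂ]^2 L) (x : Module.Dual ℂ H) : ℂ :=
  killingForm ℂ L (sharp f (R.vec x)) (R.vec (-x))

theorem eigen_neg (f : ⋀[ℂ]^2 L) : eigen R f (-x) = -eigen R f x := by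
  rw [eigen, killingForm_sharp, neg_neg, LieModule.traceForm_comm, eigen]

theorem adExt_eq_zero {n : ℕ} {w : ⋀[ℂ]^n L} (hw : w ∈ invariants Γ n) {a : L} (ha : a ∈ levi Γ) :
    adExt n a w = 0 :=
  (Submodule.mem_iInf _).1 hw.2 ⟨a, ha⟩

/-- Invariance under 𝔥 makes the endomorphism preserve weights, and root spaces are one-dimensional.
-/
theorem sharp_vec {f : ⋀[ℂ]^2 L} (hf : f ∈ invariants Γ 2) (hx : x ∈ rootSet H) :
    sharp f (R.vec x) = eigen R f x • R.vec x := by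
  refine R.eq_smul_vec hx (weightSpace_le_genWeightSpace L _ ?_)
  rw [mem_weightSpace]
  intro h
  have h₁ := sharp_adExt (h : L) f (R.vec x)
  rw [adExt_eq_zero hf (cartan_le_levi h.2), map_zero, LinearMap.zero_apply, R.lie_vec hx h.2,
    map_smul, eq_comm, sub_eq_zero] at h₁
  exact h₁

theorem eigen_add {f : ⋀[ℂ]^2 L}
    (hs : ∀ i j : b.support, b.cartanMatrix i j = b.cartanMatrix j i) (hΓ : Γ ⊆ b.support)
    (hf : f ∈ invariants Γ 2) (hx : x ∈ rootSet H) (hy : y ∈ rootSet H)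
    (hxy : x + y ∈ rootSet H) (hxΓ : x ∈ leviSpan Γ) : eigen R f (x + y) = eigen R f y := by
  have h₁ := sharp_adExt (R.vec x) f (R.vec y)
  have hne := R.lie_vec_ne_zero hs hx hy hxy
  rw [adExt_eq_zero hf (vec_mem_levi R hs hΓ hx hxΓ), map_zero, LinearMap.zero_apply,
    sharp_vec R hf hy, lie_smul, R.lie_vec_eq_smul hx hy hxy, map_smul, sharp_vec R hf hxy,
    smul_comm, ← smul_sub, ← sub_smul] at h₁
  rw [R.lie_vec_eq_smul hx hy hxy] at hne
  have h₂ := (smul_eq_zero.1 h₁.symm).resolve_left (smul_ne_zero_iff.1 hne).1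
  exact (sub_eq_zero.1 ((smul_eq_zero.1 h₂).resolve_right (R.vec_ne_zero hxy))).symm

theorem killingForm_lie_vec_ne_zero
    (hs : ∀ i j : b.support, b.cartanMatrix i j = b.cartanMatrix j i)
    (hx : x ∈ rootSet H) (hy : y ∈ rootSet H) (hz : z ∈ rootSet H) (h : x + y + z = 0) :
    killingForm ℂ L ⁅R.vec x, R.vec y⁆ (R.vec z) ≠ 0 := by
  have hxy : x + y = -z := eq_neg_of_add_eq_zero_left h
  have hm : x + y ∈ rootSet H := hxy ▸ neg_mem_rootSet hz
  intro h0
  refine R.lie_vec_ne_zero hs hx hy hm ?_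
  rw [R.lie_vec_eq_smul hx hy hm, hxy, neg_neg, h0, zero_smul]

section Good

variable {t : H} (hs : ∀ i j : b.support, b.cartanMatrix i j = b.cartanMatrix j i)
  (hx : x ∈ outerRoots Γ) (hy : y ∈ outerRoots Γ) (hz : z ∈ outerRoots Γ) (h : x + y + z = 0)
include hs hx hy hz h

theorem eigen_mul_sum {f : ⋀[ℂ]^2 L} (hf : f ∈ invariants Γ 2) {K : ℂ}
    (hK : schoutenM R Γ f f = K ^ 2 • phiM R b Γ) :
    eigen R f x * eigen R f y + eigen R f y * eigen R f z + eigen R f z * eigen R f x =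
      -K ^ 2 := by
  have h₁ := congrArg (tri (R.vec x) (R.vec y) (R.vec z)) hK
  rw [schoutenM, phiM, map_smul, tri_map_proj R hx hy hz, tri_map_proj R hx hy hz,
    tri_schouten_rMatrix R hx.1 hy.1 hz.1 h, tri_schouten_of_sharp_eq_smul (sharp_vec R hf hx.1)
    (sharp_vec R hf hy.1) (sharp_vec R hf hz.1) (sharp_vec R hf hx.1)
    (sharp_vec R hf hy.1) (sharp_vec R hf hz.1), smul_eq_mul] at h₁
  refine mul_right_cancel₀ (killingForm_lie_vec_ne_zero R hs hx.1 hy.1 hz.1 h) ?_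
  linear_combination h₁ / 2

/-- Since 1/y(t) + 1/z(t) = -x(t)²/(x(t)y(t)z(t)), clearing the common denominator turns the
reciprocals of the orbit bivector into squares. -/
theorem eigen_mul_sq_sum (ht : IsBasePoint Γ t) {f : ⋀[ℂ]^2 L} (hf : f ∈ invariants Γ 2)
    (hkks : schoutenM R Γ f (kks R b Γ t) = 0) :
    eigen R f x * x t ^ 2 + eigen R f y * y t ^ 2 + eigen R f z * z t ^ 2 = 0 := by
  have hne : ∀ x ∈ outerRoots Γ, x t ≠ 0 := by
    rintro _ ⟨⟨i, rfl⟩, hi⟩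
    exact ht.2 i hi
  have h₁ := congrArg (tri (R.vec x) (R.vec y) (R.vec z)) hkks
  rw [schoutenM, map_zero, tri_map_proj R hx hy hz, tri_schouten_of_sharp_eq_smul
    (sharp_vec R hf hx.1) (sharp_vec R hf hy.1) (sharp_vec R hf hz.1) (sharp_kks R t hx)
    (sharp_kks R t hy) (sharp_kks R t hz)] at h₁
  have h₂ := (mul_eq_zero.1 h₁).resolve_right (killingForm_lie_vec_ne_zero R hs hx.1 hy.1 hz.1 h)
  have hz' : z t = -(x t + y t) := by
    rw [eq_neg_of_add_eq_zero_right h]; rfl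
  have h₃ := hne z hz
  have hxt := hne x hx
  have hyt := hne y hy
  field_simp at h₂
  rw [hz'] at h₂ ⊢
  linear_combination -h₂

end Good

section GoodPair

open Classical in
/-- The function `x ↦ x(t)² f(x)` on roots, which is additive when `f` is compatible with the
bivector of the orbit through `t`. -/
def eigenScaled (Γ : Finset H.root) (f : ⋀[ℂ]^2 L) (t : H) (x : Module.Dual ℂ H) : ℂ :=
  if x ∈ leviSpan Γ then 0 else x t ^ 2 * eigen R f x

theorem eigenScaled_neg (f : ⋀[ℂ]^2 L) (t : H) :
    eigenScaled R Γ f t (-x) = -eigenScaled R Γ f t x := by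
  rw [eigenScaled, eigenScaled, (leviSpan Γ).neg_mem_iff]
  split_ifs
  · simp
  · rw [eigen_neg, LinearMap.neg_apply]; ring

theorem apply_eq_zero_of_mem_leviSpan {t : H} (ht : IsBasePoint Γ t) (hx : x ∈ leviSpan Γ) :
    x t = 0 := by
  induction hx using Submodule.span_induction with
  | mem _ h =>
    obtain ⟨i, hi, rfl⟩ := h
    exact ht.1 i hi
  | zero => rfl
  | add _ _ _ _ h₁ h₂ => rw [LinearMap.add_apply, h₁, h₂, add_zero]
  | smul c _ _ h => rw [LinearMap.smul_apply, h, smul_zero]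

theorem apply_ne_zero_of_mem_outerRoots {t : H} (ht : IsBasePoint Γ t) (hx : x ∈ outerRoots Γ) :
    x t ≠ 0 := by
  obtain ⟨⟨i, rfl⟩, hi⟩ := hx
  exact ht.2 i hi

variable {t : H} (hs : ∀ i j : b.support, b.cartanMatrix i j = b.cartanMatrix j i)
  (hΓ : Γ ⊆ b.support) (ht : IsBasePoint Γ t) {f : ⋀[ℂ]^2 L} (hf : f ∈ invariants Γ 2)
  (hkks : schoutenM R Γ f (kks R b Γ t) = 0)
include hs hΓ ht hf hkks

/-- If one of x, y, x + y lies in the span of Γ, the invariance of f suffices. The compatibility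
with the orbit bivector is needed only when all three are outer. -/
theorem eigenScaled_add (hx : x ∈ rootSet H) (hy : y ∈ rootSet H) (hxy : x + y ∈ rootSet H) :
    eigenScaled R Γ f t (x + y) = eigenScaled R Γ f t x + eigenScaled R Γ f t y := by
  have inner : ∀ {x y}, x ∈ rootSet H → y ∈ rootSet H → x + y ∈ rootSet H → x ∈ leviSpan Γ →
      eigenScaled R Γ f t (x + y) = eigenScaled R Γ f t x + eigenScaled R Γ f t y := by
    intro x y hx hy hxy hxΓ
    rw [eigenScaled, eigenScaled, eigenScaled, (leviSpan Γ).add_mem_iff_right hxΓ, if_pos hxΓ,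
      zero_add, eigen_add R hs hΓ hf hx hy hxy hxΓ, LinearMap.add_apply,
      apply_eq_zero_of_mem_leviSpan ht hxΓ, zero_add]
  by_cases hxΓ : x ∈ leviSpan Γ
  · exact inner hx hy hxy hxΓ
  by_cases hyΓ : y ∈ leviSpan Γ
  · rw [add_comm, inner hy hx (by rwa [add_comm]) hyΓ, add_comm]
  by_cases hxyΓ : x + y ∈ leviSpan Γ
  · have h := inner (x := x + y) (y := -x) hxy (neg_mem_rootSet hx) (by simpa using hy) hxyΓ
    rw [add_neg_cancel_comm, eigenScaled_neg] at h
    rw [h]; ring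
  · have h := eigen_mul_sq_sum R hs ⟨hx, hxΓ⟩ ⟨hy, hyΓ⟩ (neg_mem_outerRoots ⟨hxy, hxyΓ⟩)
      (by abel) ht hf hkks
    rw [eigen_neg, LinearMap.neg_apply] at h
    rw [eigenScaled, eigenScaled, eigenScaled, if_neg hxΓ, if_neg hyΓ, if_neg hxyΓ]
    linear_combination -h

/-- The functional `x ↦ x(t)² f(x)` extends to a linear one. -/
theorem exists_linear_eq_eigenScaled :
    ∃ G : Module.Dual ℂ H →ₗ[ℂ] ℂ, ∀ x ∈ rootSet H, G x = eigenScaled R Γ f t x := by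
  let G := b.toWeightBasis.constr ℂ fun i => eigenScaled R Γ f t ((rootSystem H).root i)
  have hG : ∀ i : b.support, G ((rootSystem H).root i) =
      eigenScaled R Γ f t ((rootSystem H).root i) := fun i => by
    rw [← b.toWeightBasis_apply, Module.Basis.constr_basis, b.toWeightBasis_apply]
  refine ⟨G, fun x hx => ?_⟩
  rcases (isBased_rootSet b).induction (fun x => G x = eigenScaled R Γ f t x) hG
    (fun x hx i ih hxi => by
      rw [map_add, ih, hG, eigenScaled_add R hs hΓ ht hf hkks hx (root_mem_rootSet _) hxi]) x hx
    with h | h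
  · exact h
  · rwa [map_neg, eigenScaled_neg, neg_inj] at h

theorem exists_isGoodPair {K : ℂ} (hK : schoutenM R Γ f f = K ^ 2 • phiM R b Γ) :
    ∃ lam g : Module.Dual ℂ H →+ ℂ, IsGoodPair (rootSet H) lam g K ∧
      IsAdapted (rootSet H) (fun i : b.support => (rootSystem H).root i) (baseCoord b)
        {i : b.support | (i : H.root) ∈ Γ} lam g := by
  obtain ⟨G, hG⟩ := exists_linear_eq_eigenScaled R hs hΓ ht hf hkks
  let lam : Module.Dual ℂ H →ₗ[ℂ] ℂ := LinearMap.applyₗ t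
  have hlam : ∀ x, lam x = x t := fun _ => rfl
  have hzero : ∀ x ∈ rootSet H, x ∈ leviSpan Γ → lam x = 0 ∧ G x = 0 := fun x hx hxΓ =>
    ⟨apply_eq_zero_of_mem_leviSpan ht hxΓ, by rw [hG x hx, eigenScaled, if_pos hxΓ]⟩
  have hsimple : ∀ i : b.support, (i : H.root) ∈ Γ → (rootSystem H).root i ∈ leviSpan Γ :=
    fun i hi => Submodule.subset_span ⟨i, hi, rfl⟩
  refine ⟨lam.toAddMonoidHom, G.toAddMonoidHom, fun x hx y hy hxy => ?_,
    fun i hi => (hzero _ (root_mem_rootSet _) (hsimple i hi)).1,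
    fun i hi => (hzero _ (root_mem_rootSet _) (hsimple i hi)).2,
    fun x hx i hi hc => apply_ne_zero_of_mem_outerRoots ht ⟨hx, fun hxΓ => hc ?_⟩⟩
  · change (G x * lam y - G y * lam x) ^ 2 = (K * (lam x * lam y * lam (x + y))) ^ 2
    by_cases hxΓ : x ∈ leviSpan Γ
    · rw [(hzero x hx hxΓ).1, (hzero x hx hxΓ).2]; ring
    by_cases hyΓ : y ∈ leviSpan Γ
    · rw [(hzero y hy hyΓ).1, (hzero y hy hyΓ).2]; ring
    by_cases hxyΓ : x + y ∈ leviSpan Γ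
    · obtain ⟨h₁, h₂⟩ := hzero _ hxy hxyΓ
      rw [h₁]
      rw [map_add] at h₁ h₂
      linear_combination (G x * lam y - G y * lam x) * (lam y * h₂ - G y * h₁)
    · have h₁ := eigen_mul_sum R hs ⟨hx, hxΓ⟩ ⟨hy, hyΓ⟩ (neg_mem_outerRoots ⟨hxy, hxyΓ⟩)
        (by abel) hf hK
      have h₂ := eigen_mul_sq_sum R hs ⟨hx, hxΓ⟩ ⟨hy, hyΓ⟩ (neg_mem_outerRoots ⟨hxy, hxyΓ⟩)
        (by abel) ht hf hkks
      rw [eigen_neg] at h₁ h₂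
      rw [LinearMap.neg_apply, LinearMap.add_apply] at h₂
      rw [hG x hx, hG y hy, map_add, hlam, hlam, eigenScaled, eigenScaled, if_neg hxΓ, if_neg hyΓ]
      -- The coefficients are chosen so that the eigenvalue at x + y cancels.
      linear_combination (x t * y t) ^ 2 * (-(x t + y t) ^ 2 * h₁ +
        (eigen R f x + eigen R f y) * h₂)
  · exact (mem_leviSpan_iff hΓ hx).1 hxΓ i hi

end GoodPair

end Bivectors

/-! ### Invariant trivectors -/

section Trivectors

open LieAlgebra LieAlgebra.IsKilling LieModule

variable {L : Type*} [LieRing L] [LieAlgebra ℂ L] [FiniteDimensional ℂ L]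
  [LieAlgebra.IsSimple ℂ L] {H : LieSubalgebra ℂ L} [H.IsCartanSubalgebra] (R : RootVectors H)
  {Γ : Finset H.root} {b : (rootSystem H).Base} {x y z : Module.Dual ℂ H}

theorem tri_phiM_vec (hx : x ∈ outerRoots Γ) (hy : y ∈ outerRoots Γ) (hz : z ∈ outerRoots Γ) :
    tri (R.vec x) (R.vec y) (R.vec z) (phiM R b Γ) =
      -2 * killingForm ℂ L ⁅R.vec x, R.vec y⁆ (R.vec z) := by
  rw [phiM, tri_map_proj R hx hy hz]
  by_cases h : x + y + z = 0
  · exact tri_schouten_rMatrix R hx.1 hy.1 hz.1 h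
  · obtain ⟨i, hi⟩ := hx.1
    obtain ⟨j, hj⟩ := hy.1
    obtain ⟨k, hk⟩ := hz.1
    have h₁ := sharp_rMatrix (b := b) R i
    have h₂ := sharp_rMatrix (b := b) R j
    have h₃ := sharp_rMatrix (b := b) R k
    rw [hi] at h₁
    rw [hj] at h₂
    rw [hk] at h₃
    rw [phi, tri_schouten_of_sharp_eq_smul h₁ h₂ h₃ h₁ h₂ h₃,
      R.killingForm_eq_zero (R.lie_vec_mem hx.1 hy.1) hz.1 h, mul_zero, mul_zero]

/-- On 𝔪, the trivector φ_M is -2 times the invariant 3-form ([u, v], w). This form of the statement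
makes its invariance under 𝔤_Γ and θ evident. -/
theorem tri_phiM {m₁ m₂ m₃ : L} (h₁ : m₁ ∈ tangent Γ) (h₂ : m₂ ∈ tangent Γ)
    (h₃ : m₃ ∈ tangent Γ) :
    tri m₁ m₂ m₃ (phiM R b Γ) = -2 * killingForm ℂ L ⁅m₁, m₂⁆ m₃ := by
  have hrot : ∀ u v w : L, tri u v w (phiM R b Γ) = -2 * killingForm ℂ L ⁅u, v⁆ w →
      tri v w u (phiM R b Γ) = -2 * killingForm ℂ L ⁅v, w⁆ u := by
    intro u v w h
    rw [tri_rotate, h, LieModule.traceForm_apply_lie_apply, LieModule.traceForm_comm]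
  have hleft : ∀ v w : L, (∀ x ∈ outerRoots Γ, tri (R.vec x) v w (phiM R b Γ) =
      -2 * killingForm ℂ L ⁅R.vec x, v⁆ w) → ∀ u ∈ tangent Γ,
        tri u v w (phiM R b Γ) = -2 * killingForm ℂ L ⁅u, v⁆ w := by
    intro v w h u hu
    rw [tangent_eq_span R] at hu
    induction hu using Submodule.span_induction with
    | mem _ hx =>
      obtain ⟨x, hx, rfl⟩ := hx
      exact h x hx
    | zero =>
      have := tri_smul_left 0 0 v w (phiM R b Γ)
      rw [zero_smul, zero_mul] at this
      rw [this, zero_lie, map_zero, LinearMap.zero_apply, mul_zero]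
    | add u u' _ _ hu hu' =>
      rw [tri_add_left, hu, hu', add_lie, map_add, LinearMap.add_apply, mul_add]
    | smul c u _ hu =>
      rw [tri_smul_left, hu, smul_lie, map_smul, LinearMap.smul_apply, smul_eq_mul]
      ring
  refine hleft _ _ (fun x hx => hrot _ _ _ (hrot _ _ _ ?_)) _ h₁
  refine hleft _ _ (fun y hy => hrot _ _ _ (hrot _ _ _ ?_)) _ h₂
  refine hleft _ _ (fun z hz => ?_) _ h₃
  exact tri_phiM_vec R hz hx hy

include R in
theorem adExt_mem_tangentPower {a : L} (ha : a ∈ levi Γ) {w : ⋀[ℂ]^3 L}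
    (hw : w ∈ tangentPower Γ 3) : adExt 3 a w ∈ tangentPower Γ 3 := by
  rw [← map_proj_eq_self R hw]
  clear hw
  induction w using trivector_induction with
  | wedge X Y Z =>
    rw [map_wedge₃, adExt_wedge₃]
    have hp := proj_mem_tangent (Γ := Γ) R
    exact add_mem (add_mem
      (wedge₃_mem_tangentPower (lie_mem_tangent R ha (hp X)) (hp Y) (hp Z))
      (wedge₃_mem_tangentPower (hp X) (lie_mem_tangent R ha (hp Y)) (hp Z)))
      (wedge₃_mem_tangentPower (hp X) (hp Y) (lie_mem_tangent R ha (hp Z)))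
  | add v w hv hw => simp only [map_add, add_mem hv hw]
  | smul c v hv => simp only [map_smul, Submodule.smul_mem _ c hv]

theorem phiM_mem_invariants : phiM R b Γ ∈ invariants Γ 3 := by
  have hm : phiM R b Γ ∈ tangentPower Γ 3 := map_proj_mem_tangentPower R 3 _
  refine ⟨hm, (Submodule.mem_iInf _).2 fun a => ?_⟩
  refine eq_zero_of_tri R (adExt_mem_tangentPower R a.2 hm) fun x hx y hy z hz => ?_
  have h₁ := vec_mem_tangent R hx
  have h₂ := vec_mem_tangent R hy
  have h₃ := vec_mem_tangent R hz
  rw [tri_adExt, tri_phiM R (lie_mem_tangent R a.2 h₁) h₂ h₃,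
    tri_phiM R h₁ (lie_mem_tangent R a.2 h₂) h₃, tri_phiM R h₁ h₂ (lie_mem_tangent R a.2 h₃)]
  have h := killingForm_lie_left (a : L) ⁅R.vec x, R.vec y⁆ (R.vec z)
  rw [leibniz_lie, map_add, LinearMap.add_apply] at h
  linear_combination 2 * h

/-! ### Consequences of θ-invariance -/

section Automorphism

variable {θ : L ≃ₗ⁅ℂ⁆ L}

omit [FiniteDimensional ℂ L] [IsSimple ℂ L] [H.IsCartanSubalgebra] in
theorem IsCartanAutomorphism.symm (hθ : IsCartanAutomorphism H θ) :
    IsCartanAutomorphism H θ.symm := fun x hx => by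
  rw [← θ.symm_apply_apply (-x), ← neg_neg x, hθ _ (H.neg_mem (H.neg_mem (H.neg_mem hx)))]
  simp

variable (hθ : IsCartanAutomorphism H θ)
include hθ

theorem exists_map_vec_eq_smul (hx : x ∈ rootSet H) : ∃ k : ℂ, θ (R.vec x) = k • R.vec (-x) := by
  refine ⟨_, R.eq_smul_vec (neg_mem_rootSet hx) (weightSpace_le_genWeightSpace L _ ?_)⟩
  rw [mem_weightSpace]
  intro h
  have h₁ : (h : L) = θ (-(h : L)) := by rw [map_neg, hθ _ h.2, neg_neg]
  change ⁅(h : L), θ (R.vec x)⁆ = _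
  rw [h₁, ← LieEquiv.map_lie, neg_lie, R.lie_vec hx h.2, map_neg, map_smul, LinearMap.neg_apply,
    neg_smul]

include R in
theorem map_mem_tangent {m : L} (hm : m ∈ tangent Γ) : θ m ∈ tangent Γ := by
  rw [tangent_eq_span R] at hm
  induction hm using Submodule.span_induction with
  | mem _ hx =>
    obtain ⟨x, hx, rfl⟩ := hx
    obtain ⟨k, hk⟩ := exists_map_vec_eq_smul R hθ hx.1
    rw [hk]
    exact Submodule.smul_mem _ _ (vec_mem_tangent R (neg_mem_outerRoots hx))
  | zero => rw [map_zero]; exact zero_mem _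
  | add _ _ _ _ h₁ h₂ => rw [map_add]; exact add_mem h₁ h₂
  | smul c _ _ h => rw [map_smul]; exact Submodule.smul_mem _ _ h

include R in
theorem map_mem_tangentPower {w : ⋀[ℂ]^3 L} (hw : w ∈ tangentPower Γ 3) :
    exteriorPower.map 3 (θ : L →ₗ[ℂ] L) w ∈ tangentPower Γ 3 := by
  rw [← map_proj_eq_self R hw]
  clear hw
  induction w using trivector_induction with
  | wedge X Y Z =>
    rw [map_wedge₃, map_wedge₃]
    have hp := fun X => map_mem_tangent R hθ (proj_mem_tangent (Γ := Γ) R X)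
    exact wedge₃_mem_tangentPower (hp X) (hp Y) (hp Z)
  | add v w hv hw => simp only [map_add, add_mem hv hw]
  | smul c v hv => simp only [map_smul, Submodule.smul_mem _ c hv]

omit [FiniteDimensional ℂ L] [IsSimple ℂ L] [H.IsCartanSubalgebra] hθ in
theorem tri_map_equiv (u v m : L) (w : ⋀[ℂ]^3 L) :
    tri (θ u) (θ v) (θ m) (exteriorPower.map 3 (θ : L →ₗ[ℂ] L) w) = tri u v m w :=
  tri_map _ (killingForm_of_equiv_apply θ u) (killingForm_of_equiv_apply θ v)
    (killingForm_of_equiv_apply θ m) w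

theorem phiM_mem_thetaInvariants : phiM R b Γ ∈ thetaInvariants Γ θ 3 := by
  have hm : phiM R b Γ ∈ tangentPower Γ 3 := map_proj_mem_tangentPower R 3 _
  refine ⟨phiM_mem_invariants R, ?_⟩
  refine eq_of_tri R (map_mem_tangentPower R hθ hm) hm fun x hx y hy z hz => ?_
  have h₁ := vec_mem_tangent R hx
  have h₂ := vec_mem_tangent R hy
  have h₃ := vec_mem_tangent R hz
  have hm' := fun {m : L} (hm : m ∈ tangent Γ) => map_mem_tangent R hθ.symm hm
  have h := tri_map_equiv (θ := θ) (θ.symm (R.vec x)) (θ.symm (R.vec y)) (θ.symm (R.vec z))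
    (phiM R b Γ)
  rw [tri_phiM R (hm' h₁) (hm' h₂) (hm' h₃), ← LieEquiv.map_lie, killingForm_of_equiv_apply,
    θ.apply_symm_apply, θ.apply_symm_apply, θ.apply_symm_apply] at h
  exact h.trans (tri_phiM R h₁ h₂ h₃).symm

/-- The automorphism multiplies the contractions of v and w by the same constants, so these cancel
in the ratio. -/
theorem tri_vec_neg {v w : ⋀[ℂ]^3 L} (hv : v ∈ thetaInvariants Γ θ 3)
    (hw : w ∈ thetaInvariants Γ θ 3) (hx : x ∈ rootSet H) (hy : y ∈ rootSet H)
    (hz : z ∈ rootSet H) (hne : tri (R.vec x) (R.vec y) (R.vec z) v ≠ 0) :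
    tri (R.vec (-x)) (R.vec (-y)) (R.vec (-z)) w / tri (R.vec (-x)) (R.vec (-y)) (R.vec (-z)) v =
      tri (R.vec x) (R.vec y) (R.vec z) w / tri (R.vec x) (R.vec y) (R.vec z) v := by
  obtain ⟨p, hp⟩ := exists_map_vec_eq_smul R hθ hx
  obtain ⟨q, hq⟩ := exists_map_vec_eq_smul R hθ hy
  obtain ⟨r, hr⟩ := exists_map_vec_eq_smul R hθ hz
  have key : ∀ u ∈ thetaInvariants Γ θ 3, tri (R.vec x) (R.vec y) (R.vec z) u =
      (p * q * r) * tri (R.vec (-x)) (R.vec (-y)) (R.vec (-z)) u := fun u hu => by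
    rw [← tri_map_equiv (θ := θ), show exteriorPower.map 3 (θ : L →ₗ[ℂ] L) u = u from hu.2, hp, hq,
      hr, tri_smul_left, tri_smul_mid, tri_smul_right]
    ring
  rw [key v hv, key w hw, mul_div_mul_left]
  intro h0
  rw [key v hv, h0, zero_mul] at hne
  exact hne rfl

end Automorphism

/-- An element of 𝔥 on which the total weight does not vanish multiplies the contraction by a
nonzero number, yet annihilates w. -/
theorem tri_vec_eq_zero {w : ⋀[ℂ]^3 L} (hw : w ∈ invariants Γ 3) (hx : x ∈ rootSet H)
    (hy : y ∈ rootSet H) (hz : z ∈ rootSet H) (h : x + y + z ≠ 0) :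
    tri (R.vec x) (R.vec y) (R.vec z) w = 0 := by
  obtain ⟨t, ht⟩ : ∃ t, (x + y + z) t ≠ 0 := by
    by_contra! hcon
    exact h (LinearMap.ext hcon)
  have h₁ := tri_adExt (t : L) (R.vec x) (R.vec y) (R.vec z) w
  rw [adExt_eq_zero hw (cartan_le_levi t.2), map_zero, R.lie_vec hx t.2, R.lie_vec hy t.2,
    R.lie_vec hz t.2, tri_smul_left, tri_smul_mid, tri_smul_right] at h₁
  refine (mul_eq_zero.1 (?_ : (x + y + z) t * _ = 0)).resolve_left ht
  change (x t + y t + z t) * _ = 0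
  linear_combination h₁

variable (hs : ∀ i j : b.support, b.cartanMatrix i j = b.cartanMatrix j i) (hΓ : Γ ⊆ b.support)
include hs hΓ

/-- Apply invariance under E_δ to the contraction with E_x, E_{y-δ}, E_z. The term in z drops out
because B(z, δ) = 0, and the remaining relation has coefficients independent of the trivector. -/
theorem tri_vec_move {v w : ⋀[ℂ]^3 L} (hv : v ∈ invariants Γ 3) (hw : w ∈ invariants Γ 3)
    (hx : x ∈ rootSet H) (hy : y ∈ rootSet H) (hz : z ∈ outerRoots Γ) (h : x + y + z = 0)
    {δ : Module.Dual ℂ H} (hδ : δ ∈ rootSet H) (hδΓ : δ ∈ leviSpan Γ)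
    (hxδ : rootForm b x δ = -1) (hyδ : rootForm b y δ = 1)
    (hv₁ : tri (R.vec x) (R.vec y) (R.vec z) v ≠ 0)
    (hv₂ : tri (R.vec (x + δ)) (R.vec (y - δ)) (R.vec z) v ≠ 0) :
    tri (R.vec (x + δ)) (R.vec (y - δ)) (R.vec z) w /
        tri (R.vec (x + δ)) (R.vec (y - δ)) (R.vec z) v =
      tri (R.vec x) (R.vec y) (R.vec z) w / tri (R.vec x) (R.vec y) (R.vec z) v := by
  have hB := isSimplyLaced_rootSet hs
  have hxm := hB.add_mem _ hx _ hδ hxδ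
  have hym := hB.sub_mem hy hδ hyδ
  have hδx : δ + x ∈ rootSet H := by rwa [add_comm]
  have hδy : δ + (y - δ) ∈ rootSet H := by rwa [add_sub_cancel]
  have hz0 : δ + z ≠ 0 := fun h0 => hz.2 (by
    rw [eq_neg_of_add_eq_zero_right h0]
    exact (leviSpan Γ).neg_mem hδΓ)
  have hzm : δ + z ∉ rootSet H := fun hm => by
    have h₁ := hB.eq_neg_one_of_add_mem hδ hz.1 hm
    rw [hB.symm, eq_neg_of_add_eq_zero_right h, map_neg, map_add, AddMonoidHom.neg_apply,
      AddMonoidHom.add_apply, hxδ, hyδ] at h₁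
    norm_num at h₁
  obtain ⟨p, hp⟩ : ∃ p, ⁅R.vec δ, R.vec x⁆ = p • R.vec (x + δ) := by
    rw [add_comm x δ]
    exact ⟨_, R.lie_vec_eq_smul hδ hx hδx⟩
  obtain ⟨q, hq⟩ : ∃ q, ⁅R.vec δ, R.vec (y - δ)⁆ = q • R.vec y := by
    have := R.lie_vec_eq_smul hδ hym hδy
    rw [add_sub_cancel] at this
    exact ⟨_, this⟩
  have hp0 : p ≠ 0 := fun h0 => R.lie_vec_ne_zero hs hδ hx hδx (by rw [hp, h0, zero_smul])
  have key : ∀ u ∈ invariants Γ 3, p * tri (R.vec (x + δ)) (R.vec (y - δ)) (R.vec z) u =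
      -q * tri (R.vec x) (R.vec y) (R.vec z) u := by
    intro u hu
    have h₁ := tri_adExt (R.vec δ) (R.vec x) (R.vec (y - δ)) (R.vec z) u
    have h₂ := tri_smul_right 0 (R.vec x) (R.vec (y - δ)) 0 u
    rw [zero_smul, zero_mul] at h₂
    rw [adExt_eq_zero hu (vec_mem_levi R hs hΓ hδ hδΓ), map_zero, hp, hq,
      R.lie_vec_eq_zero hδ hz.1 hz0 hzm, tri_smul_left, tri_smul_mid, h₂] at h₁
    linear_combination h₁
  rw [div_eq_div_iff hv₂ hv₁]
  refine mul_left_cancel₀ hp0 ?_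
  linear_combination tri (R.vec x) (R.vec y) (R.vec z) v * key w hw -
    tri (R.vec x) (R.vec y) (R.vec z) w * key v hv

omit hΓ in
theorem tri_phiM_ne_zero (hx : x ∈ outerRoots Γ) (hy : y ∈ outerRoots Γ) (hz : z ∈ outerRoots Γ)
    (h : x + y + z = 0) : tri (R.vec x) (R.vec y) (R.vec z) (phiM R b Γ) ≠ 0 := by
  rw [tri_phiM_vec R hx hy hz]
  exact mul_ne_zero (by norm_num) (killingForm_lie_vec_ne_zero R hs hx.1 hy.1 hz.1 h)

theorem isMoveInvariant_div {θ : L ≃ₗ⁅ℂ⁆ L} (hθ : IsCartanAutomorphism H θ) {w : ⋀[ℂ]^3 L}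
    (hw : w ∈ thetaInvariants Γ θ 3) {l₁ l₂ : Module.Dual ℂ H →+ ℝ}
    (hl : ∀ x ∈ rootSet H, (l₁ x = 0 ∧ l₂ x = 0) ↔ x ∈ leviSpan Γ) :
    IsMoveInvariant (rootSet H) (rootForm b) l₁ l₂ fun x y z =>
      tri (R.vec x) (R.vec y) (R.vec z) w / tri (R.vec x) (R.vec y) (R.vec z) (phiM R b Γ) := by
  have hout : ∀ {x}, x ∈ rootSet H → l₁ x ≠ 0 ∨ l₂ x ≠ 0 → x ∈ outerRoots Γ := fun hx h =>
    ⟨hx, fun hxΓ => by have := (hl _ hx).2 hxΓ; tauto⟩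
  have hφ := phiM_mem_thetaInvariants (b := b) (Γ := Γ) R hθ
  have hB := isSimplyLaced_rootSet hs
  refine ⟨fun x y z _ => ?_, fun x y z _ => ?_, fun x y z h => ?_,
    fun x y z h δ hδ h₁ h₂ hxδ hyδ => ?_⟩
  · simp only [tri_rotate]
  · simp only [tri_swap (R.vec x) (R.vec y), neg_div_neg_eq]
  · exact tri_vec_neg R hθ hφ hw h.mem₁ h.mem₂ h.mem₃ (tri_phiM_ne_zero R hs (hout h.mem₁ h.level₁)
      (hout h.mem₂ h.level₂) (hout h.mem₃ h.level₃) h.sum)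
  · have hx := hout h.mem₁ h.level₁
    have hy := hout h.mem₂ h.level₂
    have hz := hout h.mem₃ h.level₃
    refine tri_vec_move R hs hΓ hφ.1 hw.1 hx.1 hy.1 hz h.sum hδ ((hl δ hδ).1 ⟨h₁, h₂⟩) hxδ hyδ
      (tri_phiM_ne_zero R hs hx hy hz h.sum) (tri_phiM_ne_zero R hs (hout ?_ ?_) (hout ?_ ?_) hz ?_)
    · exact hB.add_mem _ hx.1 _ hδ hxδ
    · simpa [h₁, h₂] using h.level₁
    · exact hB.sub_mem hy.1 hδ hyδ
    · simpa [h₁, h₂] using h.level₂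
    · rw [← h.sum]; abel

/-- If two outer roots summed to an outer root, they would form with its negative a triple on which
φ_M is not zero. So every bracket of outer root vectors lies in 𝔤_Γ. -/
theorem isSymmetricOrbit_of_phiM_eq_zero (h0 : phiM R b Γ = 0) : IsSymmetricOrbit Γ := by
  have hroot : ∀ x ∈ outerRoots Γ, ∀ y ∈ outerRoots Γ, ⁅R.vec x, R.vec y⁆ ∈ levi Γ := by
    intro x hx y hy
    by_cases hxy : x + y = 0
    · rw [eq_neg_of_add_eq_zero_right hxy]
      obtain ⟨i, rfl⟩ := hx.1
      rw [R.lie_vec_neg]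
      exact cartan_le_levi (SetLike.coe_mem _)
    by_cases hm : x + y ∈ rootSet H
    · rw [R.lie_vec_eq_smul hx.1 hy.1 hm]
      refine (levi Γ).smul_mem _ (vec_mem_levi R hs hΓ hm ?_)
      by_contra hΓ'
      refine tri_phiM_ne_zero R hs hx hy (neg_mem_outerRoots ⟨hm, hΓ'⟩) (add_neg_cancel _) ?_
      rw [h0, map_zero]
    · rw [R.lie_vec_eq_zero hx.1 hy.1 hxy hm]
      exact zero_mem _
  intro m hm m' hm'
  rw [tangent_eq_span R] at hm hm'
  induction hm using Submodule.span_induction with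
  | mem _ hx =>
    obtain ⟨x, hx, rfl⟩ := hx
    induction hm' using Submodule.span_induction with
    | mem _ hy =>
      obtain ⟨y, hy, rfl⟩ := hy
      exact hroot x hx y hy
    | zero => rw [lie_zero]; exact zero_mem _
    | add _ _ _ _ h₁ h₂ => rw [lie_add]; exact add_mem h₁ h₂
    | smul c _ _ h => rw [lie_smul]; exact (levi Γ).smul_mem _ h
  | zero => rw [zero_lie]; exact zero_mem _
  | add _ _ _ _ h₁ h₂ => rw [add_lie]; exact add_mem h₁ h₂
  | smul c _ _ h => rw [smul_lie]; exact (levi Γ).smul_mem _ h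

omit hs in
theorem thetaInvariants_eq_span (hb : IsTypeDOrE₆ b) {θ : L ≃ₗ⁅ℂ⁆ L}
    (hθ : IsCartanAutomorphism H θ) (hgood : IsGood R b Γ) :
    thetaInvariants Γ θ 3 = Submodule.span ℂ {phiM R b Γ} := by
  have hs := isTypeDOrE₆_symm hb
  have hφ := phiM_mem_thetaInvariants (b := b) (Γ := Γ) R hθ
  apply le_antisymm
  · intro w hw
    obtain ⟨t, ht, f, hf, K, hK, hff, hkks⟩ := hgood
    obtain ⟨lam, g, hC, ha⟩ := exists_isGoodPair R hs hΓ ht hf hkks hff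
    obtain ⟨l₁, l₂, hl, hconst⟩ := exists_const_of_isGoodPair (isSimplyLaced_rootSet hs)
      (isBased_rootSet b) hK hC ha (exists_pair_of_isTypeDOrE₆ hb hK hC ha)
    have hl' : ∀ x ∈ rootSet H, (l₁ x = 0 ∧ l₂ x = 0) ↔ x ∈ leviSpan Γ := fun x hx =>
      (hl x).trans (mem_leviSpan_iff hΓ hx).symm
    -- The constant ratio of w to φ_M is the scalar sought. Triples with nonzero sum contribute
    -- nothing to either side.
    obtain ⟨C, hC⟩ := hconst _ (isMoveInvariant_div R hs hΓ hθ hw hl')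
    rw [Submodule.mem_span_singleton]
    refine ⟨C, eq_of_tri R (Submodule.smul_mem _ _ hφ.1.1) hw.1.1 fun x hx y hy z hz => ?_⟩
    rw [map_smul, smul_eq_mul]
    by_cases h : x + y + z = 0
    · have hlevel : ∀ x ∈ outerRoots Γ, l₁ x ≠ 0 ∨ l₂ x ≠ 0 := fun x hx => by
        have := mt (hl' x hx.1).1 hx.2
        tauto
      rw [← hC x y z ⟨hx.1, hy.1, hz.1, h, hlevel x hx, hlevel y hy, hlevel z hz⟩,
        div_mul_cancel₀ _ (tri_phiM_ne_zero R hs hx hy hz h)]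
    · rw [tri_vec_eq_zero R hφ.1 hx.1 hy.1 hz.1 h, tri_vec_eq_zero R hw.1 hx.1 hy.1 hz.1 h,
        mul_zero]
  · rw [Submodule.span_singleton_le_iff_mem]
    exact hφ

end Trivectors

end LieOrbit

end

theorem lemma4p1 {L : Type*} [LieRing L] [LieAlgebra ℂ L] [FiniteDimensional ℂ L]
    [LieAlgebra.IsSimple ℂ L] (H : LieSubalgebra ℂ L) [H.IsCartanSubalgebra]
    (b : (LieAlgebra.IsKilling.rootSystem H).Base) (hb : LieOrbit.IsTypeDOrE₆ b)
    (R : LieOrbit.RootVectors H)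
    (θ : L ≃ₗ⁅ℂ⁆ L) (hθ : LieOrbit.IsCartanAutomorphism H θ)
    (Γ : Finset H.root) (hΓ : Γ ⊆ b.support) (hgood : LieOrbit.IsGood R b Γ) :
    LieOrbit.thetaInvariants Γ θ 3 = Submodule.span ℂ {LieOrbit.phiM R b Γ} ∧
      (¬ LieOrbit.IsSymmetricOrbit Γ →
        Module.finrank ℂ (LieOrbit.thetaInvariants Γ θ 3) = 1) := by
  have h := LieOrbit.thetaInvariants_eq_span R hΓ hb hθ hgood
  refine ⟨h, fun hsymm => ?_⟩
  rw [h]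
  exact finrank_span_singleton fun h0 => hsymm
    (LieOrbit.isSymmetricOrbit_of_phiM_eq_zero R (LieOrbit.isTypeDOrE₆_symm hb) hΓ h0)
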